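/- **Setting.** Let $U\subseteq\mathbb R^4$ be open, with coordinates $(x^\mu)=(t,x^1,x^2,x^3)$ adapted to the foliation by the leaves $t=\mathrm{const}$. Indices $\mu,\nu$ and $a,b,c,d$ run over $0,\dots,3$; $A,B,C$ and $i,j,k,l,m$ run over $1,2,3$; $\eta=\mathrm{diag}(-1,1,1,1)$; $\epsilon_{abcd}$, $\epsilon_{ijk}$ are the Levi-Civita symbols with $\epsilon_{0123}=\epsilon_{123}=1$. Let $\gamma\in\mathbb R\setminus\{0\}$ (Holst parameter) and $\Lambda\in\mathbb R$. The fields are a smooth nondegenerate coframe $e^a=e^a_\mu dx^\mu$ and a smooth connection $\hat\omega^{ab}=-\hat\omega^{ba}$ on $U$, with curvature $\hat R^{ab}=d\hat\omega^{ab}+\hat\omega^a{}_c\wedge\hat\omega^{cb}$. The Holst field equations are $$\hat\nabla B_{ab}=0,\qquad \hat R^{ab}\wedge\left(\epsilon_{abcd}e^c+\tfrac2\gamma e_{[a}\eta_{b]d}\right)=\tfrac\Lambda3\epsilon_{abcd}\,e^a\wedge e^b\wedge e^c,\qquad B_{ab}=\epsilon_{abcd}\,e^c\wedge e^d+\tfrac2\gamma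 e_a\wedge e_b .$$ The coframe is adapted: $e^0=N\,dt$ and $e^i=\epsilon^i_A(dx^A+\beta^A dt)$, where the lapse $N\neq0$ and the shift $\beta^A$ are otherwise free; equivalently $e_0=\vec n=\frac1N(\partial_t-\beta^A\partial_A)$ and the $e_i$ are tangent to the leaves. For Barbero parameter $0$ the Ashtekar–Barbero–Immirzi (ABI) variables are $\mathbb A^i=\frac12\epsilon^i{}_{jk}\hat\omega^{jk}$ and $k^i=\hat\omega^{0i}$. Put $\nabla a^i=da^i+\epsilon^i{}_{lm}\mathbb A^m\wedge a^l$, $\mathbb F^i_{\mu\nu}=\partial_\mu\mathbb A^i_\nu-\partial_\nu\mathbb A^i_\mu-\epsilon^i{}_{jk}\mathbb A^j_\mu\mathbb A^k_\nu$, $\mathbb K_i=\frac12\epsilon_{ijk}e^j\wedge e^k-\frac1\gamma e^0\wedge e_i$ and $\mathbb L_i=e^0\wedge e_i+\frac1{2\gamma}\epsilon_{ijk}e^j\wedge e^k$. The field equations in ABI variables are $$\begin{aligned} &(1)\ \nabla(\mathbb L^k+\gamma\mathbb K^k)=\epsilon^k{}_{lm}k^l\wedge(\mathbb K^m-\gamma\mathbb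 L^m),\qquad (2)\ \nabla(\mathbb K^k-\gamma\mathbb L^k)=-\epsilon^k{}_{lm}k^l\wedge(\mathbb L^m+\gamma\mathbb K^m),\\ &(3)\ \mathbb F_k\wedge e^k-\tfrac1\gamma\nabla k^k\wedge e_k+\tfrac12\epsilon_{ijk}k^i\wedge k^j\wedge e^k=\tfrac\Lambda6\epsilon_{ijk}e^i\wedge e^j\wedge e^k,\\ &(4)\ \left(\tfrac1\gamma\epsilon^h{}_{ij}\mathbb F^i+\epsilon^h{}_{ij}\nabla k^i-\tfrac1\gamma k^h\wedge k_j\right)\wedge e^j=-\left(\mathbb F^h-\tfrac1\gamma\nabla k^h+\tfrac12\epsilon^h{}_{ij}k^i\wedge k^j-\tfrac\Lambda2\epsilon^h{}_{ij}e^i\wedge e^j\right)\wedge e^0 . \end{aligned}$$ Their 3+1 projections are the tangent projections (pull-back to the leaves) and the normal projections (contraction with $\vec n$, then pull-back). Let $\tilde\omega^{ab}$ be the torsion-free spin connection of the coframe, $\tilde{\mathbb A},\tilde k$ its ABI variables, and $z=\mathbb A-\tilde{\mathbb A}$, $h=k-\tilde k$. Write $z_{AB}=z^i_A\epsilon_{iB}$,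 $h_{AB}=h^i_A\epsilon_{iB}$ for the tangent projections, and ${}^\perp z^i=\frac1N(z^i_0-\beta^Az^i_A)$, ${}^\perp h^i=\frac1N(h^i_0-\beta^Ah^i_A)$ for the normal ones. Let $\gamma_{AB}=\delta_{ij}\epsilon^i_A\epsilon^j_B$ be the metric of the leaves, with Levi-Civita derivative $D_A$ on spatial indices, Ricci tensor ${}^3\!R_{AB}$ and scalar curvature ${}^3\!R$. Let $E^A_i=\frac12\epsilon^{ABC}\epsilon_{ijk}\epsilon^j_B\epsilon^k_C$ be the densitised triad and $DE_k=\partial_AE^A_k+\epsilon_{klm}\mathbb A^m_AE^A_l$. Finally let $\delta_m=\partial_t-\mathcal L_\beta$ on spatial tensors, $\chi_{AB}=-\frac1{2N}\delta_m\gamma_{AB}$ and $\chi=\gamma^{AB}\chi_{AB}$. **Theorem.** (a) For fields as above with adapted coframe, the following are equivalent on $U$: 1. the Holst field equations; 2. the field equations (1)–(4) in ABI variables; 3. the vanishing of all tangent and normal projections of (1)–(4); 4. the following system of 37 equations: - 10 differential constraints: $DE_k=0$ (3), $D_A(\chi^A{}_C-\delta^A_C\chi)=0$ (3), ${}^3\!R+\chi^2-\chi_{AB}\chi^{AB}-2\Lambda=0$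 (1), $\mathbb F^i_{BC}E^C_i=0$ (3); - 21 algebraic constraints: $z_{(AB)}=0$ (6), ${}^\perp z^i=0$ (3), $h_{[AB]}=0$ (3), $h_{(AB)}=0$ (6), ${}^\perp h^i=0$ (3); - 6 evolution equations: $\delta_m\chi_{AB}=N\left({}^3\!R_{AB}+\chi\chi_{AB}-2\chi_{AC}\chi^C{}_B-\Lambda\gamma_{AB}\right)-D_AD_BN$; 5. $z=0$ and $h=0$, and $(N,\beta,\gamma_{AB},\chi_{AB})$ satisfies the standard ADM equations with cosmological constant $\Lambda$: the evolution equations for $\gamma_{AB}$ and $\chi_{AB}$, the Hamiltonian constraint and the momentum constraint $D_A\chi^A{}_B-D_B\chi=0$; 6. $\hat\omega=\tilde\omega$, and $g=\eta_{ab}e^a\otimes e^b$ satisfies $R_{\mu\nu}-\frac12Rg_{\mu\nu}+\Lambda g_{\mu\nu}=0$. Moreover (1) and (2) together are equivalent to $DE_k=0$ together with the 21 algebraic constraints, and also to $z=0$, $h=0$. (b) The system consists of $10+21+6=37$ equations. This is the number of components $(N,\beta^A,\epsilon^i_A,\mathbb A^i_\mu,k^i_\mu)$ of the fields in an adapted frame.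 Any smooth choice of these 37 functions on $U$ with $N$ and $\det(\epsilon^i_A)$ nowhere zero comes from exactly one pair $(e,\hat\omega)$ on $U$ with adapted coframe, and this pair is smooth. (c) Adapting the frame uses three boost parameters: for every smooth nondegenerate coframe on $U$ for which the leaves are spacelike there is exactly one $w:U\to\mathbb R^3$ such that the coframe transformed pointwise by the Lorentz boost $$\begin{pmatrix}\sqrt{1+|w|^2}&w^T\\ w&I+\frac{ww^T}{1+\sqrt{1+|w|^2}}\end{pmatrix}$$ is adapted, and $w$ is smooth. -/

import Mathlib

open scoped ContDiff

noncomputable section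

namespace HolstADM

/-! ## Coordinates, partial derivatives, Levi-Civita symbols -/

/-- Coordinates `(t, x¹, x², x³)` adapted to the foliation: the index `0` is `t`, the index
`A.succ` (for `A : Fin 3`) is the spatial coordinate `x^A`; the leaves are `t = const`. -/
abbrev Coord : Type := Fin 4 → ℝ

/-- The partial derivative `∂_μ f`. -/
def pd (μ : Fin 4) (f : Coord → ℝ) (x : Coord) : ℝ := fderiv ℝ f x (Pi.single μ 1)

/-- The spatial partial derivative `∂_A f`. -/
def pdS (A : Fin 3) (f : Coord → ℝ) (x : Coord) : ℝ := pd A.succ f x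

/-- The Levi-Civita symbol on three indices, `eps3 0 1 2 = 1`
(the Vandermonde product is totally skew). -/
def eps3 (i j k : Fin 3) : ℝ :=
  ((j : ℝ) - (i : ℝ)) * ((k : ℝ) - (i : ℝ)) * ((k : ℝ) - (j : ℝ)) / 2

/-- The Levi-Civita symbol on four indices, `eps4 0 1 2 3 = 1`. -/
def eps4 (a b c d : Fin 4) : ℝ :=
  ((b : ℝ) - (a : ℝ)) * ((c : ℝ) - (a : ℝ)) * ((d : ℝ) - (a : ℝ)) *
    ((c : ℝ) - (b : ℝ)) * ((d : ℝ) - (b : ℝ)) * ((d : ℝ) - (c : ℝ)) / 12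

/-- The Minkowski form `diag (-1, 1, 1, 1)`; it is its own inverse. -/
def eta (a b : Fin 4) : ℝ := if a = b then (if a = 0 then -1 else 1) else 0

/-! ## Differential forms in coordinates

A `p`-form is given by its (skew) components, `α = (1/p!) α_{μ…} dx^μ ∧ …`. -/

abbrev Form1 : Type := Fin 4 → Coord → ℝ
abbrev Form2 : Type := Fin 4 → Fin 4 → Coord → ℝ
abbrev Form3 : Type := Fin 4 → Fin 4 → Fin 4 → Coord → ℝ

def wedge11 (α β : Form1) : Form2 := fun μ ν x => α μ x * β ν x - α ν x * β μ x

def wedge12 (α : Form1) (F : Form2) : Form3 := fun μ ν ρ x =>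
  α μ x * F ν ρ x + α ν x * F ρ μ x + α ρ x * F μ ν x

def wedge21 (F : Form2) (α : Form1) : Form3 := fun μ ν ρ x =>
  F μ ν x * α ρ x + F ν ρ x * α μ x + F ρ μ x * α ν x

/-- Exterior derivative of a 1-form. -/
def d1 (α : Form1) : Form2 := fun μ ν x => pd μ (α ν) x - pd ν (α μ) x

/-- Exterior derivative of a 2-form. -/
def d2 (F : Form2) : Form3 := fun μ ν ρ x =>
  pd μ (F ν ρ) x + pd ν (F ρ μ) x + pd ρ (F μ ν) x

/-! ## Metric geometry in coordinates

`D : Fin n → …` are the coordinate derivatives: `pd` on spacetime, `pdS` on the leaves. -/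

section Metric

variable {n : ℕ} (D : Fin n → (Coord → ℝ) → Coord → ℝ) (g : Fin n → Fin n → Coord → ℝ)

/-- The inverse metric `g^{ab}`. -/
def metricInv (a b : Fin n) (x : Coord) : ℝ := (Matrix.of fun c d => g c d x)⁻¹ a b

/-- Christoffel symbols `Γ^a_{bc}`. -/
def christoffel (a b c : Fin n) (x : Coord) : ℝ :=
  (1 / 2) * ∑ d, metricInv g a d x * (D b (g d c) x + D c (g d b) x - D d (g b c) x)

/-- The Riemann tensor `R^a_{bcd}`. -/
def riemann (a b c d : Fin n) (x : Coord) : ℝ :=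
  D c (christoffel D g a b d) x - D d (christoffel D g a b c) x
    + ∑ f, (christoffel D g a c f x * christoffel D g f b d x
      - christoffel D g a d f x * christoffel D g f b c x)

/-- The Ricci tensor `R_{bd} = R^a_{bad}`. -/
def ricci (b d : Fin n) (x : Coord) : ℝ := ∑ a, riemann D g a b a d x

/-- The scalar curvature. -/
def scalarCurv (x : Coord) : ℝ := ∑ a, ∑ b, metricInv g a b x * ricci D g a b x

/-- The Hessian `D_a D_b f` of a function. -/
def hessian (f : Coord → ℝ) (a b : Fin n) (x : Coord) : ℝ :=
  D a (D b f) x - ∑ c, christoffel D g c a b x * D c f x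

/-- The covariant derivative `D_a v_b` of a covector field. -/
def covDeriv1 (v : Fin n → Coord → ℝ) (a b : Fin n) (x : Coord) : ℝ :=
  D a (v b) x - ∑ c, christoffel D g c a b x * v c x

/-- The divergence `D_a T^a_c` of a mixed tensor `T a c = T^a_c`. -/
def divMixed (T : Fin n → Fin n → Coord → ℝ) (c : Fin n) (x : Coord) : ℝ :=
  ∑ a, (D a (T a c) x + ∑ f, (christoffel D g a a f x * T f c x
    - christoffel D g f a c x * T a f x))

/-- Raising the first index, `T^a_b = g^{ac} T_{cb}`. -/
def raise (T : Fin n → Fin n → Coord → ℝ) (a b : Fin n) (x : Coord) : ℝ :=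
  ∑ c, metricInv g a c x * T c b x

/-- The trace `T^a_a`. -/
def tr (T : Fin n → Fin n → Coord → ℝ) (x : Coord) : ℝ := ∑ a, raise g T a a x

/-- `T_{ab} T^{ab}` for symmetric `T`, written `T^a_b T^b_a`. -/
def normSq (T : Fin n → Fin n → Coord → ℝ) (x : Coord) : ℝ :=
  ∑ a, ∑ b, raise g T a b x * raise g T b a x

/-- `T_{ac} T^c_b`. -/
def square (T : Fin n → Fin n → Coord → ℝ) (a b : Fin n) (x : Coord) : ℝ :=
  ∑ c, T a c x * raise g T c b x

end Metric

/-! ## The fields of the Holst model and their field equations -/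

/-- The fields of the Holst model in coordinates: a spin coframe `e a μ = e^a_μ` and a
`spin(3,1)`-connection `conn a b μ = ω^{ab}_μ` (both internal indices up). -/
structure Fields where
  e : Fin 4 → Form1
  conn : Fin 4 → Fin 4 → Form1
  skew : ∀ a b μ x, conn a b μ x = -conn b a μ x

namespace Fields

variable (γ lam : ℝ) (Φ : Fields) (U : Set Coord)

/-- The coframe and the connection are smooth on `U`. -/
def SmoothOn : Prop :=
  (∀ a μ, ContDiffOn ℝ ∞ (Φ.e a μ) U) ∧ (∀ a b μ, ContDiffOn ℝ ∞ (Φ.conn a b μ) U)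

/-- `e_a = η_{ab} e^b`. -/
def eLow (a : Fin 4) : Form1 := eta a a • Φ.e a

/-- The curvature `R^{ab} = dω^{ab} + ω^a_c ∧ ω^{cb}`. -/
def curvature (a b : Fin 4) : Form2 :=
  d1 (Φ.conn a b) + ∑ c, eta c c • wedge11 (Φ.conn a c) (Φ.conn c b)

/-- `B_{ab} = ε_{abcd} e^c ∧ e^d + (2/γ) e_a ∧ e_b`. -/
def B (a b : Fin 4) : Form2 :=
  (∑ c, ∑ d, eps4 a b c d • wedge11 (Φ.e c) (Φ.e d))
    + (2 / γ) • wedge11 (Φ.eLow a) (Φ.eLow b)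

/-- `∇B_{ab} = dB_{ab} - ω^c_a ∧ B_{cb} - ω^c_b ∧ B_{ac}`. -/
def nablaB (a b : Fin 4) : Form3 :=
  d2 (Φ.B γ a b) - ∑ c, (eta a a • wedge12 (Φ.conn c a) (Φ.B γ c b)
    + eta b b • wedge12 (Φ.conn c b) (Φ.B γ a c))

/-- The Holst field equations `∇B_{ab} = 0` and
`R^{ab} ∧ (ε_{abcd} e^c + (2/γ) e_{[a} η_{b]d}) = (Λ/3) ε_{abcd} e^a ∧ e^b ∧ e^c` on `U`. -/
def HolstEquations : Prop :=
  (∀ a b μ ν ρ, ∀ x ∈ U, Φ.nablaB γ a b μ ν ρ x = 0) ∧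
  (∀ d μ ν ρ, ∀ x ∈ U,
    (∑ a, ∑ b, wedge21 (Φ.curvature a b)
      ((∑ c, eps4 a b c d • Φ.e c)
        + (2 / γ) • ((1 / 2 : ℝ) • (eta b d • Φ.eLow a - eta a d • Φ.eLow b)))) μ ν ρ x
    = ((lam / 3) • ∑ a, ∑ b, ∑ c, eps4 a b c d •
        wedge21 (wedge11 (Φ.e a) (Φ.e b)) (Φ.e c)) μ ν ρ x)

end Fields

/-! ## Ashtekar-Barbero-Immirzi variables on spacetime -/

/-- The Barbero-Immirzi connection `A^i = ½ ε^i_{jk} ω^{jk} + b ω^{0i}` with Barbero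
parameter `b`. -/
def barberoImmirzi (b : ℝ) (conn : Fin 4 → Fin 4 → Form1) (i : Fin 3) : Form1 :=
  (1 / 2 : ℝ) • (∑ j, ∑ k, eps3 i j k • conn j.succ k.succ) + b • conn 0 i.succ

/-- The Immirzi tensor `k^i = ω^{0i}`. -/
def immirziTensor (conn : Fin 4 → Fin 4 → Form1) (i : Fin 3) : Form1 := conn 0 i.succ

/-- `∇a^i = da^i + ε^i_{lm} A^m ∧ a^l` on 1-forms. -/
def nabla1 (A a : Fin 3 → Form1) (i : Fin 3) : Form2 :=
  d1 (a i) + ∑ l, ∑ m, eps3 i l m • wedge11 (A m) (a l)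

/-- `∇a^i = da^i + ε^i_{lm} A^m ∧ a^l` on 2-forms. -/
def nabla2 (A : Fin 3 → Form1) (a : Fin 3 → Form2) (i : Fin 3) : Form3 :=
  d2 (a i) + ∑ l, ∑ m, eps3 i l m • wedge12 (A m) (a l)

/-- The curvature `F^i_{μν} = ∂_μ A^i_ν - ∂_ν A^i_μ - ε^i_{jk} A^j_μ A^k_ν`. -/
def curvF (A : Fin 3 → Form1) (i : Fin 3) : Form2 := fun μ ν x =>
  pd μ (A i ν) x - pd ν (A i μ) x - ∑ j, ∑ k, eps3 i j k * A j μ x * A k ν x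

namespace Fields

variable (γ lam : ℝ) (Φ : Fields) (U : Set Coord)

/-- The Barbero-Immirzi connection with Barbero parameter `0`. -/
def A : Fin 3 → Form1 := barberoImmirzi 0 Φ.conn

/-- The Immirzi tensor. -/
def k : Fin 3 → Form1 := immirziTensor Φ.conn

/-- The curvature of `A`. -/
def F : Fin 3 → Form2 := curvF Φ.A

/-- The spatial part `e^i` of the coframe. -/
def eS (i : Fin 3) : Form1 := Φ.e i.succ

/-- `K_i = ½ ε_{ijk} e^j ∧ e^k - (1/γ) e^0 ∧ e_i`. -/
def K (i : Fin 3) : Form2 :=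
  (1 / 2 : ℝ) • (∑ j, ∑ l, eps3 i j l • wedge11 (Φ.eS j) (Φ.eS l))
    - (1 / γ) • wedge11 (Φ.e 0) (Φ.eS i)

/-- `L_i = e^0 ∧ e_i + (1/(2γ)) ε_{ijk} e^j ∧ e^k`. -/
def L (i : Fin 3) : Form2 :=
  wedge11 (Φ.e 0) (Φ.eS i)
    + (1 / (2 * γ)) • (∑ j, ∑ l, eps3 i j l • wedge11 (Φ.eS j) (Φ.eS l))

/-- First field equation in ABI variables (left side minus right side):
`∇(L^k + γK^k) = ε^k_{lm} k^l ∧ (K^m - γL^m)`. -/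
def field1 (i : Fin 3) : Form3 :=
  nabla2 Φ.A (fun j => Φ.L γ j + γ • Φ.K γ j) i
    - ∑ l, ∑ m, eps3 i l m • wedge12 (Φ.k l) (Φ.K γ m - γ • Φ.L γ m)

/-- Second field equation: `∇(K^k - γL^k) = -ε^k_{lm} k^l ∧ (L^m + γK^m)`. -/
def field2 (i : Fin 3) : Form3 :=
  nabla2 Φ.A (fun j => Φ.K γ j - γ • Φ.L γ j) i
    + ∑ l, ∑ m, eps3 i l m • wedge12 (Φ.k l) (Φ.L γ m + γ • Φ.K γ m)

/-- Third field equation: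
`F_k ∧ e^k - (1/γ) ∇k^k ∧ e_k + ½ ε_{ijk} k^i ∧ k^j ∧ e^k = (Λ/6) ε_{ijk} e^i ∧ e^j ∧ e^k`. -/
def field3 : Form3 :=
  (∑ i, wedge21 (Φ.F i) (Φ.eS i))
    - (1 / γ) • (∑ i, wedge21 (nabla1 Φ.A Φ.k i) (Φ.eS i))
    + (1 / 2 : ℝ) • (∑ i, ∑ j, ∑ l, eps3 i j l • wedge21 (wedge11 (Φ.k i) (Φ.k j)) (Φ.eS l))
    - (lam / 6) •
      (∑ i, ∑ j, ∑ l, eps3 i j l • wedge21 (wedge11 (Φ.eS i) (Φ.eS j)) (Φ.eS l))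

/-- Fourth field equation:
`((1/γ) ε^h_{ij} F^i + ε^h_{ij} ∇k^i - (1/γ) k^h ∧ k_j) ∧ e^j
  = -(F^h - (1/γ) ∇k^h + ½ ε^h_{ij} k^i ∧ k^j - (Λ/2) ε^h_{ij} e^i ∧ e^j) ∧ e^0`. -/
def field4 (h : Fin 3) : Form3 :=
  (∑ j, wedge21
    ((1 / γ) • (∑ i, eps3 h i j • Φ.F i) + (∑ i, eps3 h i j • nabla1 Φ.A Φ.k i)
      - (1 / γ) • wedge11 (Φ.k h) (Φ.k j)) (Φ.eS j))
    + wedge21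
      (Φ.F h - (1 / γ) • nabla1 Φ.A Φ.k h
        + (1 / 2 : ℝ) • (∑ i, ∑ j, eps3 h i j • wedge11 (Φ.k i) (Φ.k j))
        - (lam / 2) • (∑ i, ∑ j, eps3 h i j • wedge11 (Φ.eS i) (Φ.eS j))) (Φ.e 0)

/-- The field equations in ABI variables, on `U`. -/
def ABIEquations : Prop :=
  ∀ x ∈ U, ∀ μ ν ρ,
    (∀ i, Φ.field1 γ i μ ν ρ x = 0) ∧ (∀ i, Φ.field2 γ i μ ν ρ x = 0) ∧
    Φ.field3 γ lam μ ν ρ x = 0 ∧ (∀ i, Φ.field4 γ lam i μ ν ρ x = 0)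

/-! ## The adapted frame and the 3+1 decomposition -/

/-- The coframe is nondegenerate and adapted to the foliation: `e^0` vanishes on the leaves,
i.e. `e_1, e_2, e_3` are tangent to the leaves and `e_0` is the unit normal. -/
def AdaptedOn (e : Fin 4 → Form1) (U : Set Coord) : Prop :=
  ∀ x ∈ U, (∀ A : Fin 3, e 0 A.succ x = 0) ∧ (Matrix.of fun a μ => e a μ x).det ≠ 0

/-- The (co)triad `ε^i_A`. -/
def triad (i A : Fin 3) (x : Coord) : ℝ := Φ.e i.succ A.succ x

/-- The inverse triad `ε_i^A`. -/
def triadInv (A i : Fin 3) (x : Coord) : ℝ := (Matrix.of fun j C => Φ.triad j C x)⁻¹ A i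

/-- The lapse: `e^0 = N dt`. -/
def lapse : Coord → ℝ := Φ.e 0 0

/-- The shift: `e^i = ε^i_A (dx^A + β^A dt)`, so that `∂_t = N e_0 + β^A ∂_A`. -/
def shift (A : Fin 3) (x : Coord) : ℝ := ∑ i, Φ.triadInv A i x * Φ.e i.succ 0 x

/-- The metric `γ_{AB} = δ_{ij} ε^i_A ε^j_B` of the leaves. -/
def leafMetric (A B : Fin 3) (x : Coord) : ℝ := ∑ i, Φ.triad i A x * Φ.triad i B x

/-- The spacetime metric `g_{μν} = e^a_μ η_{ab} e^b_ν`. -/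
def metric (μ ν : Fin 4) (x : Coord) : ℝ := ∑ a, ∑ b, eta a b * Φ.e a μ x * Φ.e b ν x

end Fields

/-- Normal projection `(α_0 - β^A α_A)/N` of a 1-form. -/
def normal1 (N : Coord → ℝ) (β : Fin 3 → Coord → ℝ) (α : Form1) (x : Coord) : ℝ :=
  (α 0 x - ∑ A : Fin 3, β A x * α A.succ x) / N x

/-- Tangent projection (pull-back to the leaves) of a 3-form. -/
def tangent3 (T : Form3) (A B C : Fin 3) (x : Coord) : ℝ := T A.succ B.succ C.succ x

/-- Normal projection (contraction with the unit normal, pulled back to the leaves) of a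
3-form. -/
def normal3 (N : Coord → ℝ) (β : Fin 3 → Coord → ℝ) (T : Form3) (B C : Fin 3) (x : Coord) : ℝ :=
  (T 0 B.succ C.succ x - ∑ A : Fin 3, β A x * T A.succ B.succ C.succ x) / N x

/-- The evolution operator `δ_m` (Lie derivative along `m = ∂_t - β`) on a covariant
2-tensor of the leaves. -/
def deltaM (β : Fin 3 → Coord → ℝ) (T : Fin 3 → Fin 3 → Coord → ℝ) (A B : Fin 3) (x : Coord) :
    ℝ :=
  pd 0 (T A B) x - ∑ C, (β C x * pdS C (T A B) x + T C B x * pdS A (β C) x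
    + T A C x * pdS B (β C) x)

namespace Fields

variable (γ lam : ℝ) (Φ : Fields) (U : Set Coord)

/-- The tangent and normal projections of the four field equations in ABI variables vanish
on `U`. -/
def ProjectedEquations : Prop :=
  ∀ x ∈ U,
    (∀ i A B C, tangent3 (Φ.field1 γ i) A B C x = 0) ∧
    (∀ i B C, normal3 Φ.lapse Φ.shift (Φ.field1 γ i) B C x = 0) ∧
    (∀ i A B C, tangent3 (Φ.field2 γ i) A B C x = 0) ∧
    (∀ i B C, normal3 Φ.lapse Φ.shift (Φ.field2 γ i) B C x = 0) ∧
    (∀ A B C, tangent3 (Φ.field3 γ lam) A B C x = 0) ∧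
    (∀ B C, normal3 Φ.lapse Φ.shift (Φ.field3 γ lam) B C x = 0) ∧
    (∀ i A B C, tangent3 (Φ.field4 γ lam i) A B C x = 0) ∧
    (∀ i B C, normal3 Φ.lapse Φ.shift (Φ.field4 γ lam i) B C x = 0)

/-! ### Levi-Civita values and the deviations `z`, `h` -/

/-- The frame `e_a^μ`. -/
def frame (a μ : Fin 4) (x : Coord) : ℝ := (Matrix.of fun b ν => Φ.e b ν x)⁻¹ μ a

/-- The spin connection of the frame,
`ω^{ab}_μ = e^a_α (Γ^α_{βμ} e^{bβ} + ∂_μ e^{bα})` with `e^{bα} = η^{bc} e_c^α`. -/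
def spinLC (a b μ : Fin 4) (x : Coord) : ℝ :=
  ∑ α, Φ.e a α x * ((∑ β, christoffel pd Φ.metric α β μ x * (eta b b * Φ.frame b β x))
    + pd μ (fun y => eta b b * Φ.frame b α y) x)

/-- `z^i`: the deviation of the Barbero-Immirzi connection from its Levi-Civita value. -/
def z (i : Fin 3) : Form1 := Φ.A i - barberoImmirzi 0 Φ.spinLC i

/-- `h^i`: the deviation of the Immirzi tensor from its Levi-Civita value. -/
def h (i : Fin 3) : Form1 := Φ.k i - immirziTensor Φ.spinLC i

/-- The tangent projection with its internal index converted, `a_{AB} = a^i_A ε_{iB}`. -/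
def tangent1 (a : Fin 3 → Form1) (A B : Fin 3) (x : Coord) : ℝ :=
  ∑ i, a i A.succ x * Φ.triad i B x

/-! ### Densitised triad, extrinsic curvature and the differential constraints -/

/-- The densitised triad `E_i = ½ ε_{ijk} ε^j ∧ ε^k` as a vector density
`E^A_i = ½ ε^{ABC} (E_i)_{BC} = det(ε) ε_i^A`. -/
def densTriad (A i : Fin 3) (x : Coord) : ℝ :=
  (1 / 2) * ∑ B, ∑ C, ∑ j, ∑ l, eps3 A B C * eps3 i j l * Φ.triad j B x * Φ.triad l C x

/-- `DE_k = D_A E^A_k = ∂_A E^A_k + ε_{klm} A^m_A E^A_l`. -/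
def gauss (i : Fin 3) (x : Coord) : ℝ :=
  ∑ A, (pdS A (Φ.densTriad A i) x
    + ∑ l, ∑ m, eps3 i l m * Φ.A m A.succ x * Φ.densTriad A l x)

/-- The extrinsic curvature `χ_{AB} = -(1/2N) δ_m γ_{AB}`. -/
def chi (A B : Fin 3) (x : Coord) : ℝ :=
  -(1 / (2 * Φ.lapse x)) * deltaM Φ.shift Φ.leafMetric A B x

/-- `D_A (χ^A_C - δ^A_C χ)`. -/
def divChi (C : Fin 3) (x : Coord) : ℝ :=
  divMixed pdS Φ.leafMetric
    (fun A B y => raise Φ.leafMetric Φ.chi A B y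
      - (if A = B then tr Φ.leafMetric Φ.chi y else 0)) C x

/-- `³R + χ² - χ_{AB} χ^{AB} - 2Λ`. -/
def hamiltonian (x : Coord) : ℝ :=
  scalarCurv pdS Φ.leafMetric x + tr Φ.leafMetric Φ.chi x ^ 2
    - normSq Φ.leafMetric Φ.chi x - 2 * lam

/-- `F^i_{BC} E^C_i`. -/
def momentum (B : Fin 3) (x : Coord) : ℝ :=
  ∑ C : Fin 3, ∑ i, Φ.F i B.succ C.succ x * Φ.densTriad C i x

/-- `δ_m χ_{AB} - N (³R_{AB} + χ χ_{AB} - 2 χ_{AC} χ^C_B - Λ γ_{AB}) + D_A D_B N`. -/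
def evolution (A B : Fin 3) (x : Coord) : ℝ :=
  deltaM Φ.shift Φ.chi A B x
    - Φ.lapse x * (ricci pdS Φ.leafMetric A B x + tr Φ.leafMetric Φ.chi x * Φ.chi A B x
      - 2 * square Φ.leafMetric Φ.chi A B x - lam * Φ.leafMetric A B x)
    + hessian pdS Φ.leafMetric Φ.lapse A B x

end Fields

/-! ## The system of 37 equations -/

/-- Independent components of a symmetric 2-tensor on the leaves. -/
abbrev SymIdx : Type := {p : Fin 3 × Fin 3 // p.1 ≤ p.2}

/-- Independent components of a skew 2-tensor on the leaves. -/
abbrev SkewIdx : Type := {p : Fin 3 × Fin 3 // p.1 < p.2}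

/-- Gauss, divergence of `χ`, Hamiltonian, momentum. -/
abbrev DiffIdx : Type := Fin 3 ⊕ Fin 3 ⊕ Unit ⊕ Fin 3

/-- `z_(AB)`, normal `z`, `h_[AB]`, `h_(AB)`, normal `h`. -/
abbrev AlgIdx : Type := SymIdx ⊕ Fin 3 ⊕ SkewIdx ⊕ SymIdx ⊕ Fin 3

abbrev EvolIdx : Type := SymIdx

/-- All equations of the system. -/
abbrev EqIdx : Type := DiffIdx ⊕ AlgIdx ⊕ EvolIdx

/-- Components of the fields in an adapted frame: `N`, `β^A`, `ε^i_A`, `A^i_μ`, `k^i_μ`. -/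
abbrev FieldIdx : Type :=
  Unit ⊕ Fin 3 ⊕ (Fin 3 × Fin 3) ⊕ (Fin 3 × Fin 4) ⊕ (Fin 3 × Fin 4)

namespace Fields

variable (γ lam : ℝ) (Φ : Fields) (U : Set Coord)

/-- The differential constraints (left sides). -/
def diffConstraint : DiffIdx → Coord → ℝ
  | .inl i => Φ.gauss i
  | .inr (.inl C) => Φ.divChi C
  | .inr (.inr (.inl _)) => Φ.hamiltonian lam
  | .inr (.inr (.inr B)) => Φ.momentum B

/-- The algebraic constraints (left sides). -/
def algConstraint : AlgIdx → Coord → ℝ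
  | .inl p => fun x => (Φ.tangent1 Φ.z p.1.1 p.1.2 x + Φ.tangent1 Φ.z p.1.2 p.1.1 x) / 2
  | .inr (.inl i) => normal1 Φ.lapse Φ.shift (Φ.z i)
  | .inr (.inr (.inl p)) => fun x =>
      (Φ.tangent1 Φ.h p.1.1 p.1.2 x - Φ.tangent1 Φ.h p.1.2 p.1.1 x) / 2
  | .inr (.inr (.inr (.inl p))) => fun x =>
      (Φ.tangent1 Φ.h p.1.1 p.1.2 x + Φ.tangent1 Φ.h p.1.2 p.1.1 x) / 2
  | .inr (.inr (.inr (.inr i))) => normal1 Φ.lapse Φ.shift (Φ.h i)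

/-- The evolution equations (left side minus right side). -/
def evolEquation (p : EvolIdx) : Coord → ℝ := Φ.evolution lam p.1.1 p.1.2

/-- The whole system. -/
def systemEq : EqIdx → Coord → ℝ
  | .inl i => Φ.diffConstraint lam i
  | .inr (.inl i) => Φ.algConstraint i
  | .inr (.inr p) => Φ.evolEquation lam p

/-- The system of equations holds on `U`. -/
def SystemHolds : Prop := ∀ i : EqIdx, ∀ x ∈ U, Φ.systemEq lam i x = 0

/-- The components of the fields in an adapted frame. -/
def component : FieldIdx → Coord → ℝ
  | .inl _ => Φ.lapse
  | .inr (.inl A) => Φ.shift A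
  | .inr (.inr (.inl p)) => Φ.triad p.1 p.2
  | .inr (.inr (.inr (.inl p))) => Φ.A p.1 p.2
  | .inr (.inr (.inr (.inr p))) => Φ.k p.1 p.2

/-- Both deviations vanish on `U`: the ABI connection and the Immirzi tensor take their
Levi-Civita values. -/
def DeviationsVanish : Prop :=
  ∀ i μ, ∀ x ∈ U, Φ.z i μ x = 0 ∧ Φ.h i μ x = 0

/-- The connection is the spin connection of the frame on `U`. -/
def IsLeviCivita : Prop := ∀ a b μ, ∀ x ∈ U, Φ.conn a b μ x = Φ.spinLC a b μ x

/-- Einstein's vacuum equations with cosmological constant, on `U`. -/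
def EinsteinEquations : Prop :=
  ∀ μ ν, ∀ x ∈ U,
    ricci pd Φ.metric μ ν x - 1 / 2 * scalarCurv pd Φ.metric x * Φ.metric μ ν x
      + lam * Φ.metric μ ν x = 0

end Fields

/-- The standard ADM form (vacuum, cosmological constant `lam`) for a lapse `N`, a shift `β`, a
spatial metric `q` and an extrinsic curvature `K`: the two evolution equations, the
Hamiltonian constraint and the momentum constraint. -/
def ADMEquations (lam : ℝ) (U : Set Coord) (N : Coord → ℝ) (β : Fin 3 → Coord → ℝ)
    (q K : Fin 3 → Fin 3 → Coord → ℝ) : Prop :=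
  ∀ x ∈ U,
    (∀ A B, pd 0 (q A B) x = -2 * N x * K A B x
      + covDeriv1 pdS q (fun C y => ∑ D, q C D y * β D y) A B x
      + covDeriv1 pdS q (fun C y => ∑ D, q C D y * β D y) B A x) ∧
    (∀ A B, pd 0 (K A B) x = -hessian pdS q N A B x
      + N x * (ricci pdS q A B x + tr q K x * K A B x - 2 * square q K A B x - lam * q A B x)
      + ∑ C, (β C x * pdS C (K A B) x + K C B x * pdS A (β C) x + K A C x * pdS B (β C) x)) ∧
    scalarCurv pdS q x + tr q K x ^ 2 - normSq q K x = 2 * lam ∧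
    (∀ B, divMixed pdS q (raise q K) B x - pdS B (tr q K) x = 0)

/-! ## Boosts -/

/-- The Lorentz boost with parameter `w` (spatial part of the boosted unit time vector). -/
def boost (w : Fin 3 → ℝ) : Matrix (Fin 4) (Fin 4) ℝ :=
  let c := Real.sqrt (1 + ∑ i, w i ^ 2)
  Matrix.of fun a b =>
    Fin.cases (Fin.cases c w b)
      (fun i => Fin.cases (w i) (fun j => (if i = j then 1 else 0) + w i * w j / (1 + c)) b) a

/-- The coframe boosted pointwise by `boost (w x)`. -/
def boostCoframe (w : Fin 3 → Coord → ℝ) (e : Fin 4 → Form1) : Fin 4 → Form1 :=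
  fun a μ x => ∑ b, boost (fun i => w i x) a b * e b μ x

end HolstADM

end

/-!
The first two field equations in ABI variables, like `∇B = 0`, only involve the torsion
`T^a = de^a + ω^a_c ∧ e^c`. Indeed `∇B_{ab}` is the image of `T^a ∧ e^b - T^b ∧ e^a` under
`V ↦ ε V + (2/γ) V` (`Fields.nablaB_eq`), which is invertible because `1 + γ² ≠ 0`, and in dimension
four the 3-forms `T^a ∧ e^b - T^b ∧ e^a` determine `T` (`eq_zero_of_wedge_symm`); the equations for
`K` and `L` are the same equations in another basis (`Fields.torsion_tfae`). A torsion-free metric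
connection is the spin connection of the coframe (`Fields.torsion_eq_zero_iff`), that is
`z = h = 0`. The Gauss constraint vanishes for the spin connection, so for a general connection it
is algebraic in `z` and equivalent to `z_{[AB]} = 0` (`Fields.gauss_eq_tangent1`); together with the
21 algebraic constraints it says `z = h = 0`.

Once the torsion vanishes, the Bianchi identity `R^a_b ∧ e^b = 0` removes the Holst term from the
second field equation. What is left, `ε_{abcd} (R^{ab} - (Λ/3) e^a ∧ e^b) ∧ e^c = 0`, is a linear
condition on the curvature components in the frame, equivalent to `Ric = Λ g`
(`eps4_curvature_iff`, `Fields.holst2_iff_einstein`). The third and fourth ABI equations are its time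
and space components, and the tangential Bianchi identity makes the vector constraint
`F^i_{BC} E^C_i = 0` automatic (`Fields.momentum_eq_zero`).

Finally `Ric = Λ g` is put into ADM form. In the frame dual to `N dt`, `dx^A + β^A dt` the
Levi-Civita connection is explicit (`admConn`): it is metric and torsion-free, and such a connection
is unique. Its curvature gives the Gauss, Codazzi and Ricci equations, hence the Hamiltonian
constraint, the momentum constraint and the evolution equation (`IsADM.einstein_iff`).

The geometry is carried out over a commutative `ℝ`-algebra with commuting derivations, where forms
and connections are plain matrices. The functions in the theorem are restricted to the algebra
`smoothAlg U` of smooth functions on `U`; `Rep F f` records that `F` restricts to `f`.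

For the boosts, write `e^0 = u_i e^i` on a leaf. The leaf is spacelike iff `|u| < 1`, and the boosted
coframe is adapted iff `√(1 + |w|²) u + w = 0`, that is `w = -u / √(1 - |u|²)`.
-/

set_option linter.unusedSimpArgs false

noncomputable section

namespace HolstADM

/-! ### The algebra of smooth functions on an open set -/

theorem pd_congr {U : Set Coord} (hU : IsOpen U) {f g : Coord → ℝ} (h : ∀ x ∈ U, f x = g x)
    (μ : Fin 4) {x : Coord} (hx : x ∈ U) : pd μ f x = pd μ g x := by
  unfold pd
  rw [Filter.EventuallyEq.fderiv_eq (Filter.eventuallyEq_of_mem (hU.mem_nhds hx) h)]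

theorem contDiffOn_pd {U : Set Coord} (hU : IsOpen U) {f : Coord → ℝ} (hf : ContDiffOn ℝ ∞ f U)
    (μ : Fin 4) : ContDiffOn ℝ ∞ (pd μ f) U :=
  (hf.fderiv_of_isOpen hU (m := ∞) (by simp)).clm_apply contDiffOn_const

theorem pd_comm {U : Set Coord} (hU : IsOpen U) {f : Coord → ℝ} (hf : ContDiffOn ℝ ∞ f U)
    (μ ν : Fin 4) {x : Coord} (hx : x ∈ U) : pd μ (pd ν f) x = pd ν (pd μ f) x := by
  have hc : ContDiffAt ℝ ∞ f x := hf.contDiffAt (hU.mem_nhds hx)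
  have hs : IsSymmSndFDerivAt ℝ f x := hc.isSymmSndFDerivAt (by
    rw [minSmoothness_of_isRCLikeNormedField]; exact WithTop.coe_le_coe.2 (le_top (a := (2 : ℕ∞))))
  have hd : DifferentiableAt ℝ (fderiv ℝ f) x :=
    ((hf.fderiv_of_isOpen hU (m := ∞) (by simp)).contDiffAt (hU.mem_nhds hx)).differentiableAt
      (by simp)
  have key : ∀ ρ σ : Fin 4, pd ρ (pd σ f) x
      = fderiv ℝ (fderiv ℝ f) x (Pi.single ρ 1) (Pi.single σ 1) := by
    intro ρ σ
    unfold pd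
    rw [fderiv_clm_apply hd (by fun_prop)]
    simp
  rw [key, key, hs.eq]

/-- The algebra of real functions on `U` that are smooth, as a subalgebra of `U → ℝ`. -/
def smoothAlg (U : Set Coord) : Subalgebra ℝ (U → ℝ) where
  carrier := {f | ∃ F : Coord → ℝ, ContDiffOn ℝ ∞ F U ∧ ∀ x : U, F x = f x}
  mul_mem' := by
    rintro f g ⟨F, hF, hf⟩ ⟨G, hG, hg⟩
    exact ⟨fun x => F x * G x, hF.mul hG, fun x => by simp [hf, hg]⟩
  add_mem' := by
    rintro f g ⟨F, hF, hf⟩ ⟨G, hG, hg⟩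
    exact ⟨fun x => F x + G x, hF.add hG, fun x => by simp [hf, hg]⟩
  algebraMap_mem' := fun r => ⟨fun _ => r, contDiffOn_const, fun _ => rfl⟩

/-- Evaluation of a smooth function at a point of `U`. -/
def ev {U : Set Coord} (x : U) : smoothAlg U →ₐ[ℝ] ℝ :=
  (Pi.evalAlgHom ℝ (fun _ : U => ℝ) x).comp (smoothAlg U).val

theorem smoothAlg_ext {U : Set Coord} {f g : smoothAlg U} (h : ∀ x, ev x f = ev x g) : f = g :=
  Subtype.ext (funext h)

/-- The element of `smoothAlg U` given by a function that is smooth on `U`. -/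
def toAlg {U : Set Coord} (F : Coord → ℝ) (hF : ContDiffOn ℝ ∞ F U) : smoothAlg U :=
  ⟨fun x => F x, F, hF, fun _ => rfl⟩

/-- `Rep F f`: the function `F` on all of `ℝ⁴` restricts to the smooth function `f` on `U`. -/
def Rep {U : Set Coord} (F : Coord → ℝ) (f : smoothAlg U) : Prop := ∀ x : U, F x = ev x f

theorem rep_toAlg {U : Set Coord} (F : Coord → ℝ) (hF : ContDiffOn ℝ ∞ F U) :
    Rep F (toAlg F hF) := fun _ => rfl

theorem exists_rep {U : Set Coord} (f : smoothAlg U) :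
    ∃ F : Coord → ℝ, ContDiffOn ℝ ∞ F U ∧ Rep F f := f.2

theorem Rep.contDiffOn {U : Set Coord} {F : Coord → ℝ} {f : smoothAlg U} (h : Rep F f) :
    ContDiffOn ℝ ∞ F U := by
  obtain ⟨G, hG, hf⟩ := exists_rep f
  exact hG.congr fun x hx => (h ⟨x, hx⟩).trans (hf ⟨x, hx⟩).symm

/-- The function underlying an element of `smoothAlg U`, extended by a choice outside `U`. -/
def rep {U : Set Coord} (f : smoothAlg U) : Coord → ℝ := (exists_rep f).choose

theorem rep_contDiffOn {U : Set Coord} (f : smoothAlg U) : ContDiffOn ℝ ∞ (rep f) U :=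
  (exists_rep f).choose_spec.1

theorem rep_rep {U : Set Coord} (f : smoothAlg U) : Rep (rep f) f :=
  (exists_rep f).choose_spec.2

theorem differentiableAt_rep {U : Set Coord} (hU : IsOpen U) (f : smoothAlg U) (x : U) :
    DifferentiableAt ℝ (rep f) x :=
  ((rep_contDiffOn f).contDiffAt (hU.mem_nhds x.2)).differentiableAt (by simp)

/-- The partial derivative `∂_μ` as a derivation of `smoothAlg U`. -/
def der {U : Set Coord} (hU : IsOpen U) (μ : Fin 4) :
    Derivation ℝ (smoothAlg U) (smoothAlg U) :=
  Derivation.mk'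
    { toFun := fun f => toAlg (pd μ (rep f)) (contDiffOn_pd hU (rep_contDiffOn f) μ)
      map_add' := by
        intro f g
        refine smoothAlg_ext fun x => ?_
        have h := pd_congr hU (f := rep (f + g)) (g := fun y => rep f y + rep g y)
          (fun y hy => by
            rw [rep_rep _ ⟨y, hy⟩, rep_rep _ ⟨y, hy⟩, rep_rep _ ⟨y, hy⟩, map_add]) μ x.2
        change pd μ (rep (f + g)) x = pd μ (rep f) x + pd μ (rep g) x
        rw [h]
        unfold pd
        rw [fderiv_fun_add (differentiableAt_rep hU f x) (differentiableAt_rep hU g x)]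
        rfl
      map_smul' := by
        intro r f
        refine smoothAlg_ext fun x => ?_
        have h := pd_congr hU (f := rep (r • f)) (g := fun y => r * rep f y)
          (fun y hy => by
            rw [rep_rep _ ⟨y, hy⟩, rep_rep _ ⟨y, hy⟩, map_smul, smul_eq_mul]) μ x.2
        change pd μ (rep (r • f)) x = r * pd μ (rep f) x
        rw [h]
        unfold pd
        rw [fderiv_const_mul (differentiableAt_rep hU f x)]
        rfl }
    (by
      intro f g
      refine smoothAlg_ext fun x => ?_
      have h := pd_congr hU (f := rep (f * g)) (g := fun y => rep f y * rep g y)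
        (fun y hy => by
          rw [rep_rep _ ⟨y, hy⟩, rep_rep _ ⟨y, hy⟩, rep_rep _ ⟨y, hy⟩, map_mul]) μ x.2
      change pd μ (rep (f * g)) x = ev x f * pd μ (rep g) x + ev x g * pd μ (rep f) x
      rw [h, ← rep_rep f x, ← rep_rep g x]
      unfold pd
      rw [fderiv_fun_mul (differentiableAt_rep hU f x) (differentiableAt_rep hU g x)]
      rfl)

theorem Rep.pd {U : Set Coord} {F : Coord → ℝ} {f : smoothAlg U} (h : Rep F f) (hU : IsOpen U)
    (μ : Fin 4) : Rep (pd μ F) (der hU μ f) := fun x =>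
  pd_congr hU (fun y hy => (h ⟨y, hy⟩).trans (rep_rep f ⟨y, hy⟩).symm) μ x.2

theorem der_comm {U : Set Coord} (hU : IsOpen U) (μ ν : Fin 4) (f : smoothAlg U) :
    der hU μ (der hU ν f) = der hU ν (der hU μ f) := by
  refine smoothAlg_ext fun x => ?_
  rw [← ((rep_rep f).pd hU ν).pd hU μ x, ← ((rep_rep f).pd hU μ).pd hU ν x]
  exact pd_comm hU (rep_contDiffOn f) μ ν x.2

theorem smoothAlg_isUnit {U : Set Coord} (f : smoothAlg U) (h : ∀ x, ev x f ≠ 0) : IsUnit f := by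
  have hr : ContDiffOn ℝ ∞ (fun x => (rep f x)⁻¹) U :=
    (rep_contDiffOn f).inv fun x hx => by rw [rep_rep f ⟨x, hx⟩]; exact h _
  refine IsUnit.of_mul_eq_one (toAlg _ hr) (smoothAlg_ext fun x => ?_)
  rw [map_mul, map_one, ← rep_toAlg _ hr x]
  simp only [rep_rep f x, mul_inv_cancel₀ (h x)]

/-! ### Connections and curvature over a ring with derivations -/

section Algebraic

variable {R : Type*} [CommRing R] [Algebra ℝ R]

theorem map_derivation_mul {l m n : Type*} [Fintype m] (D : Derivation ℝ R R) (M : Matrix l m R)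
    (N : Matrix m n R) : (M * N).map D = M.map D * N + M * N.map D := by
  ext i j
  simp only [Matrix.map_apply, Matrix.mul_apply, Matrix.add_apply, map_sum, Derivation.leibniz,
    smul_eq_mul, ← Finset.sum_add_distrib]
  exact Finset.sum_congr rfl fun k _ => by ring

theorem map_derivation_add {l m : Type*} (D : Derivation ℝ R R) (M N : Matrix l m R) :
    (M + N).map D = M.map D + N.map D := Matrix.map_add _ (map_add D) _ _

theorem map_derivation_sub {l m : Type*} (D : Derivation ℝ R R) (M N : Matrix l m R) :
    (M - N).map D = M.map D - N.map D := Matrix.map_sub _ (map_sub D) _ _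

theorem map_derivation_transpose {l m : Type*} (D : Derivation ℝ R R) (M : Matrix l m R) :
    M.transpose.map D = (M.map D).transpose := rfl

theorem map_derivation_one {m : Type*} [DecidableEq m] (D : Derivation ℝ R R) :
    (1 : Matrix m m R).map D = 0 := by
  ext i j
  by_cases h : i = j <;> simp [h]

/-- The derivation `D` applied to `M * N = 1`. -/
theorem map_derivation_inverse {m : Type*} [Fintype m] [DecidableEq m] (D : Derivation ℝ R R)
    {M N : Matrix m m R} (h : M * N = 1) : M * N.map D = -(M.map D * N) := by
  have := map_derivation_mul D M N
  rw [h, map_derivation_one] at this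
  exact eq_neg_of_add_eq_zero_right this.symm

section Frame

variable {ι m : Type*} [Fintype m] (D : ι → Derivation ℝ R R)

/-- The curvature `∂_μ w_ν - ∂_ν w_μ + [w_μ, w_ν]` of the connection with matrices `w_μ`. -/
def curv (w : ι → Matrix m m R) (μ ν : ι) : Matrix m m R :=
  (w ν).map (D μ) - (w μ).map (D ν) + w μ * w ν - w ν * w μ

theorem curv_swap (w : ι → Matrix m m R) (μ ν : ι) : curv D w μ ν = -curv D w ν μ := by
  unfold curv; abel

theorem map_derivation_comm {D : ι → Derivation ℝ R R}
    (hD : ∀ μ ν f, D μ (D ν f) = D ν (D μ f)) {l k : Type*} (M : Matrix l k R) (μ ν : ι) :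
    (M.map (D ν)).map (D μ) = (M.map (D μ)).map (D ν) := by
  ext i j; exact hD _ _ _

/-- Curvature is covariant under the change of frame `θ`: the hypothesis says that `w` is the
connection `Γ` expressed in the frame `θ`. -/
theorem curv_frame {D : ι → Derivation ℝ R R} (hD : ∀ μ ν f, D μ (D ν f) = D ν (D μ f))
    {θ : Matrix m m R} {Γ w : ι → Matrix m m R} (h : ∀ μ, θ.map (D μ) = θ * Γ μ - w μ * θ)
    (μ ν : ι) : curv D w μ ν * θ = θ * curv D Γ μ ν := by
  have key := map_derivation_comm hD θ μ ν
  rw [h, h] at key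
  simp only [map_derivation_sub, map_derivation_mul, h] at key
  unfold curv
  simp only [add_mul, sub_mul, mul_add, mul_sub, mul_assoc] at key ⊢
  rw [← sub_eq_zero] at key ⊢
  rw [← neg_eq_zero, ← key]
  abel

/-- The curvature of a metric connection is skew. -/
theorem curv_skew {D : ι → Derivation ℝ R R} (hD : ∀ μ ν f, D μ (D ν f) = D ν (D μ f))
    {G : Matrix m m R} {w : ι → Matrix m m R}
    (h : ∀ μ, G.map (D μ) = (w μ).transpose * G + G * w μ) (μ ν : ι) :
    (curv D w μ ν).transpose * G + G * curv D w μ ν = 0 := by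
  have key := map_derivation_comm hD G μ ν
  rw [h, h] at key
  simp only [map_derivation_add, map_derivation_mul, map_derivation_transpose, h] at key
  unfold curv
  simp only [Matrix.transpose_add, Matrix.transpose_sub, Matrix.transpose_mul, add_mul, sub_mul,
    mul_add, mul_sub, mul_assoc] at key ⊢
  rw [← sub_eq_zero] at key
  rw [← key]
  abel

end Frame

variable {n : ℕ} (D : Fin n → Derivation ℝ R R) (g gi : Matrix (Fin n) (Fin n) R)

/-- The Christoffel matrices: `chr D g gi c a b = Γ^a_{bc}`, with `gi` the inverse metric. -/
def chr (c : Fin n) : Matrix (Fin n) (Fin n) R :=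
  Matrix.of fun a b => (1 / 2 : ℝ) • ∑ d, gi a d * (D b (g d c) + D c (g d b) - D d (g b c))

/-- The Ricci tensor. -/
def ric (b d : Fin n) : R := ∑ a, curv D (chr D g gi) a d a b

variable {D g gi}

theorem chr_symm (hg : g.transpose = g) (a b c : Fin n) : chr D g gi c a b = chr D g gi b a c := by
  have hs : ∀ i j, g i j = g j i := fun i j => congrFun (congrFun hg j) i
  simp only [chr, Matrix.of_apply]
  congr 1
  refine Finset.sum_congr rfl fun d _ => ?_
  rw [hs b c]; ring

/-- The Levi-Civita connection preserves the metric. -/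
theorem chr_metric (hg : g.transpose = g) (hgi : g * gi = 1) (c : Fin n) :
    g.map (D c) = (chr D g gi c).transpose * g + g * chr D g gi c := by
  have hs : ∀ i j, g i j = g j i := fun i j => congrFun (congrFun hg j) i
  -- the Christoffel symbols of the first kind
  have low : ∀ d b, (g * chr D g gi c) d b
      = (1 / 2 : ℝ) • (D b (g d c) + D c (g d b) - D d (g b c)) := by
    intro d b
    have : chr D g gi c = (1 / 2 : ℝ) • (gi * Matrix.of fun d b =>
        (D b (g d c) + D c (g d b) - D d (g b c))) := by
      ext a b; simp [chr, Matrix.mul_apply]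
    rw [this, Matrix.mul_smul, ← mul_assoc, hgi, one_mul]; rfl
  ext a b
  have h1 : ((chr D g gi c).transpose * g) a b = (g * chr D g gi c) b a := by
    rw [← Matrix.transpose_apply (g * chr D g gi c), Matrix.transpose_mul, hg]
  rw [Matrix.add_apply, h1, low, low, Matrix.map_apply, hs b a, hs a c, hs b c]
  algebra

/-- The Levi-Civita connection is the only symmetric metric connection. -/
theorem eq_chr (hg : g.transpose = g) (hgi : gi * g = 1) {C : Fin n → Matrix (Fin n) (Fin n) R}
    (hC : ∀ a b c, C c a b = C b a c) (hm : ∀ c, g.map (D c) = (C c).transpose * g + g * C c)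
    (c : Fin n) : C c = chr D g gi c := by
  have hs : ∀ i j, g i j = g j i := fun i j => congrFun (congrFun hg j) i
  have hK : ∀ d b c, (g * C c) d b = (g * C b) d c := fun d b c => by
    simp only [Matrix.mul_apply, hC _ b c]
  have hd : ∀ a b c, D c (g a b) = (g * C c) b a + (g * C c) a b := by
    intro a b c
    have h1 : ((C c).transpose * g) a b = (g * C c) b a := by
      rw [← Matrix.transpose_apply (g * C c), Matrix.transpose_mul, hg]
    rw [← h1, ← Matrix.add_apply, ← hm]; rfl
  have : C c = gi * (g * C c) := by rw [← mul_assoc, hgi, one_mul]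
  rw [this]
  ext a b
  simp only [chr, Matrix.of_apply, Finset.smul_sum]
  rw [Matrix.mul_apply]
  refine Finset.sum_congr rfl fun d _ => ?_
  rw [hd, hd, hd, hK c d b, hK d c b, hK b d c]
  algebra

/-- First Bianchi identity for a symmetric connection. -/
theorem bianchi_chr {C : Fin n → Matrix (Fin n) (Fin n) R} (hC : ∀ a b c, C c a b = C b a c)
    (a b c d : Fin n) : curv D C c d a b + curv D C d b a c + curv D C b c a d = 0 := by
  simp only [curv, Matrix.add_apply, Matrix.sub_apply, Matrix.map_apply, Matrix.mul_apply,
    hC a c b, hC a d b, hC a d c, hC _ c b, hC _ d b, hC _ d c]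
  abel

/-- The Ricci tensor is symmetric. -/
theorem ric_symm (hD : ∀ μ ν f, D μ (D ν f) = D ν (D μ f)) (hg : g.transpose = g)
    (hgi : g * gi = 1) (b d : Fin n) : ric D g gi b d = ric D g gi d b := by
  have hsk := curv_skew hD (chr_metric (D := D) hg hgi)
  have hgi' : gi * g = 1 := mul_eq_one_comm.1 hgi
  -- the curvature, being skew, has no trace
  have htr : (∑ a, curv D (chr D g gi) d b a a) = 0 := by
    change Matrix.trace _ = 0
    have h1 : Matrix.trace (gi * ((curv D (chr D g gi) d b).transpose * g
        + g * curv D (chr D g gi) d b)) = 0 := by rw [hsk]; simp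
    rw [mul_add, Matrix.trace_add, ← mul_assoc gi g, hgi', one_mul, Matrix.trace_mul_comm,
      mul_assoc, hgi, mul_one, Matrix.trace_transpose] at h1
    have h2 : (1 / 2 : ℝ) • (Matrix.trace (curv D (chr D g gi) d b)
      + Matrix.trace (curv D (chr D g gi) d b)) = 0 := by rw [h1, smul_zero]
    rw [← h2]; algebra
  have hb := Finset.sum_congr rfl fun a (_ : a ∈ Finset.univ) =>
    bianchi_chr (D := D) (C := chr D g gi) (chr_symm hg) a b a d
  rw [Finset.sum_add_distrib, Finset.sum_add_distrib, htr, Finset.sum_const_zero] at hb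
  have h3 : ∑ a, curv D (chr D g gi) b a a d = - ric D g gi d b := by
    rw [ric, ← Finset.sum_neg_distrib]
    exact Finset.sum_congr rfl fun a _ => by rw [curv_swap]; rfl
  rw [h3] at hb
  rw [← sub_eq_zero, ← hb, ric]; ring

variable {θ G : Matrix (Fin n) (Fin n) R} {w : Fin n → Matrix (Fin n) (Fin n) R}

/-- A connection that is torsion-free and metric in the frame `θ` is the Levi-Civita connection
of `g = θᵀ G θ`, expressed in that frame. -/
theorem frame_levi_civita {F : Matrix (Fin n) (Fin n) R} (hF : F * θ = 1)
    (hG : G.transpose = G) (hgi : gi * (θ.transpose * G * θ) = 1)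
    (ht : ∀ a μ ν, (θ.map (D μ) + w μ * θ) a ν = (θ.map (D ν) + w ν * θ) a μ)
    (hm : ∀ μ, G.map (D μ) = (w μ).transpose * G + G * w μ) (μ : Fin n) :
    θ.map (D μ) = θ * chr D (θ.transpose * G * θ) gi μ - w μ * θ := by
  have hF' : θ * F = 1 := mul_eq_one_comm.1 hF
  have hC : ∀ μ, θ * (F * (θ.map (D μ) + w μ * θ)) = θ.map (D μ) + w μ * θ := fun μ => by
    rw [← mul_assoc, hF', one_mul]
  rw [← eq_chr (C := fun μ => F * (θ.map (D μ) + w μ * θ)) _ hgi _ _ μ]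
  · simp only [hC]; abel
  · simp only [Matrix.transpose_mul, Matrix.transpose_transpose, hG, mul_assoc]
  · intro a b c
    rw [Matrix.mul_apply, Matrix.mul_apply]
    exact Finset.sum_congr rfl fun d _ => by rw [ht _ b c]
  · intro c
    have h1 : θ.transpose * G * θ * (F * (θ.map (D c) + w c * θ))
        = θ.transpose * G * (θ.map (D c) + w c * θ) := by
      rw [mul_assoc _ θ, hC]
    have h2 : (F * (θ.map (D c) + w c * θ)).transpose * (θ.transpose * G * θ)
        = (θ.map (D c) + w c * θ).transpose * G * θ := by
      rw [← mul_assoc, ← mul_assoc, ← Matrix.transpose_mul, hC]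
    rw [h1, h2]
    simp only [map_derivation_mul, map_derivation_transpose, hm, Matrix.transpose_add,
      Matrix.transpose_mul, add_mul, mul_add, mul_assoc]
    abel

/-- The Levi-Civita connection in the frame `θ` is metric. -/
theorem frame_metric {F : Matrix (Fin n) (Fin n) R} (hF : θ * F = 1)
    (hG : G.transpose = G) (hgi : θ.transpose * G * θ * gi = 1)
    (h : ∀ μ, θ.map (D μ) = θ * chr D (θ.transpose * G * θ) gi μ - w μ * θ) (μ : Fin n) :
    G.map (D μ) = (w μ).transpose * G + G * w μ := by
  have hs : (θ.transpose * G * θ).transpose = θ.transpose * G * θ := by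
    simp only [Matrix.transpose_mul, Matrix.transpose_transpose, hG, mul_assoc]
  have h1 := chr_metric (D := D) hs hgi μ
  have h0 := h μ
  generalize chr D (θ.transpose * G * θ) gi μ = Γ at h0 h1
  simp only [map_derivation_mul, map_derivation_transpose, h0, Matrix.transpose_sub,
    Matrix.transpose_mul, mul_add, mul_assoc, sub_mul, mul_sub] at h1
  have h2 : θ.transpose * (G.map (D μ) - ((w μ).transpose * G + G * w μ)) * θ = 0 := by
    rw [← sub_eq_zero] at h1
    rw [← h1]
    simp only [add_mul, mul_add, mul_assoc, sub_mul, mul_sub]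
    abel
  have h3 : F.transpose * (θ.transpose * (G.map (D μ) - ((w μ).transpose * G + G * w μ)) * θ) * F
      = 0 := by rw [h2]; simp
  rw [mul_assoc, mul_assoc, mul_assoc, hF, mul_one, ← mul_assoc, ← Matrix.transpose_mul, hF,
    Matrix.transpose_one, one_mul] at h3
  exact sub_eq_zero.1 h3

/-- The Levi-Civita connection in the frame `θ` is torsion-free. -/
theorem frame_torsion_free {g : Matrix (Fin n) (Fin n) R} (hg : g.transpose = g)
    (h : ∀ μ, θ.map (D μ) = θ * chr D g gi μ - w μ * θ) (a μ ν : Fin n) :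
    (θ.map (D μ) + w μ * θ) a ν = (θ.map (D ν) + w ν * θ) a μ := by
  rw [h, h, sub_add_cancel, sub_add_cancel, Matrix.mul_apply, Matrix.mul_apply]
  exact Finset.sum_congr rfl fun b _ => by rw [chr_symm hg]

/-- The Ricci tensor from the curvature in the frame `θ` with inverse `F`. -/
theorem ric_frame {F : Matrix (Fin n) (Fin n) R} (hF : F * θ = 1)
    (hD : ∀ μ ν f, D μ (D ν f) = D ν (D μ f))
    (h : ∀ μ, θ.map (D μ) = θ * chr D g gi μ - w μ * θ) (b d : Fin n) :
    ric D g gi b d = ∑ α, ∑ a, ∑ c, F α a * curv D w α d a c * θ c b := by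
  refine Finset.sum_congr rfl fun α _ => ?_
  have : curv D (chr D g gi) α d = F * (curv D w α d * θ) := by
    rw [curv_frame hD h, ← mul_assoc, hF, one_mul]
  rw [this]
  simp only [Matrix.mul_apply, Finset.mul_sum, mul_assoc]

/-- First Bianchi identity for the Levi-Civita connection in a frame: `Ω^a_b ∧ θ^b = 0`. -/
theorem bianchi_frame (hg : g.transpose = g) (hD : ∀ μ ν f, D μ (D ν f) = D ν (D μ f))
    (h : ∀ μ, θ.map (D μ) = θ * chr D g gi μ - w μ * θ) (a μ ν ρ : Fin n) :
    ∑ b, (curv D w μ ν a b * θ b ρ + curv D w ν ρ a b * θ b μ + curv D w ρ μ a b * θ b ν) = 0 := by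
  simp only [Finset.sum_add_distrib, ← Matrix.mul_apply, curv_frame hD h]
  simp only [Matrix.mul_apply, ← Finset.sum_add_distrib]
  refine Finset.sum_eq_zero fun b _ => ?_
  rw [← mul_add, ← mul_add, bianchi_chr (chr_symm hg), mul_zero]

end Algebraic

/-! ### The 3+1 decomposition of the Ricci tensor -/

section ThreePlusOne

theorem sum_univ_succ4 {M : Type*} [AddCommMonoid M] (f : Fin 4 → M) :
    ∑ a, f a = f 0 + ∑ A : Fin 3, f A.succ := Fin.sum_univ_succ f

/-- A `4 × 4` matrix from its `1 + 3` blocks. -/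
def blk {R : Type*} (a : R) (r c : Fin 3 → R) (M : Matrix (Fin 3) (Fin 3) R) :
    Matrix (Fin 4) (Fin 4) R :=
  Matrix.of fun i j => Fin.cases (Fin.cases a r j) (fun A => Fin.cases (c A) (M A) j) i

section
variable {R : Type*} (a : R) (r c : Fin 3 → R) (M : Matrix (Fin 3) (Fin 3) R) (A B : Fin 3)
theorem blk_zero_zero : blk a r c M 0 0 = a := rfl
theorem blk_zero_succ : blk a r c M 0 B.succ = r B := rfl
theorem blk_succ_zero : blk a r c M A.succ 0 = c A := rfl
theorem blk_succ_succ : blk a r c M A.succ B.succ = M A B := rfl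
end

variable {R : Type*} [CommRing R] [Algebra ℝ R] (D : Fin 4 → Derivation ℝ R R)
  (N : R) (β : Fin 3 → R) (q qi χ u : Matrix (Fin 3) (Fin 3) R)

/-- The spatial derivations. -/
def spatial (A : Fin 3) : Derivation ℝ R R := D A.succ

/-- The coframe `N dt`, `dx^A + β^A dt`. -/
def admCoframe : Matrix (Fin 4) (Fin 4) R := blk N 0 β 1

/-- The frame `(∂_t - β) / N`, `∂_A`, with `M = 1 / N`. -/
def admFrame (M : R) : Matrix (Fin 4) (Fin 4) R := blk M 0 (fun A => -(M * β A)) 1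

/-- The metric `diag (-1, q)` in the ADM frame. -/
def admGram : Matrix (Fin 4) (Fin 4) R := blk (-1) 0 0 q

/-- The Levi-Civita connection in the ADM frame; `u` is `χ` with its first index raised. -/
def admConn (μ : Fin 4) : Matrix (Fin 4) (Fin 4) R :=
  Fin.cases
    (blk 0 (fun A => D A.succ N - ∑ C, β C * χ A C)
      (fun A => ∑ B, qi A B * (D B.succ N - ∑ C, β C * χ B C))
      (Matrix.of fun A B => -N * u A B + D B.succ (β A)
        + ∑ C, chr (spatial D) q qi C A B * β C))
    (fun C => blk 0 (fun B => -χ B C) (fun A => -(u A C)) (chr (spatial D) q qi C)) μ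

/-- The Hessian `D_A D_B N`. -/
def hess (A B : Fin 3) : R :=
  D A.succ (D B.succ N) - ∑ C, chr (spatial D) q qi B C A * D C.succ N

/-- The divergence `D_A T^A_C`. -/
def diverg (T : Matrix (Fin 3) (Fin 3) R) (C : Fin 3) : R :=
  ∑ A, (D A.succ (T A C) + ∑ E, (chr (spatial D) q qi E A A * T E C
    - chr (spatial D) q qi C E A * T A E))

/-- The derivative `δ_m = ∂_t - L_β` of a covariant tensor. -/
def delM (T : Matrix (Fin 3) (Fin 3) R) (A B : Fin 3) : R :=
  D 0 (T A B) - ∑ C, (β C * D C.succ (T A B) + T C B * D A.succ (β C) + T A C * D B.succ (β C))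

variable {D N β q qi χ u}

theorem admFrame_mul {M : R} (hM : N * M = 1) : admFrame β M * admCoframe N β = 1 := by
  ext a b
  refine Fin.cases ?_ (fun A => ?_) a <;> refine Fin.cases ?_ (fun B => ?_) b <;>
  simp [Matrix.mul_apply, sum_univ_succ4, admFrame, admCoframe, blk_zero_zero, blk_zero_succ,
    blk_succ_zero, blk_succ_succ, Matrix.one_apply, Fin.succ_ne_zero, (Fin.succ_ne_zero _).symm]
  · rw [mul_comm]; exact hM
  · linear_combination (-β A) * hM

/-- The connection `admConn` is torsion-free. -/
theorem adm_torsion_free (hχs : χ.transpose = χ) (hqs : q.transpose = q)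
    (a μ ν : Fin 4) :
    ((admCoframe N β).map (D μ) + admConn D N β q qi χ u μ * admCoframe N β) a ν
      = ((admCoframe N β).map (D ν) + admConn D N β q qi χ u ν * admCoframe N β) a μ := by
  have hs : ∀ i j, χ i j = χ j i := fun i j => congrFun (congrFun hχs j) i
  have hΓ := chr_symm (D := spatial D) (gi := qi) hqs
  have key : ∀ a (B C : Fin 3),
    ((admCoframe N β).map (D B.succ) + admConn D N β q qi χ u B.succ * admCoframe N β) a C.succ
      = ((admCoframe N β).map (D C.succ)
        + admConn D N β q qi χ u C.succ * admCoframe N β) a B.succ := by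
    intro a B C
    refine Fin.cases ?_ (fun A => ?_) a <;>
    simp [Matrix.mul_apply, sum_univ_succ4, admConn, admCoframe, blk_zero_zero, blk_zero_succ,
      blk_succ_zero, blk_succ_succ, Matrix.one_apply, apply_ite]
    · exact hs _ _
    · exact hΓ _ _ _
  have key2 : ∀ a (B : Fin 3),
    ((admCoframe N β).map (D 0) + admConn D N β q qi χ u 0 * admCoframe N β) a B.succ
      = ((admCoframe N β).map (D B.succ) + admConn D N β q qi χ u B.succ * admCoframe N β) a 0 := by
    intro a B
    refine Fin.cases ?_ (fun A => ?_) a <;>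
    simp [Matrix.mul_apply, sum_univ_succ4, admConn, admCoframe, blk_zero_zero, blk_zero_succ,
      blk_succ_zero, blk_succ_succ, Matrix.one_apply, apply_ite]
    · simp only [hs B, mul_comm]; ring
    · simp only [hΓ A B _]; ring
  refine Fin.cases ?_ (fun B => ?_) μ <;> refine Fin.cases ?_ (fun C => ?_) ν
  · rfl
  · exact key2 a C
  · exact (key2 a B).symm
  · exact key a B C

/-- The connection `admConn` is metric. -/
theorem adm_metric (hχs : χ.transpose = χ) (hqs : q.transpose = q) (hqi : q * qi = 1)
    (hu : q * u = χ)
    (hχ : ∀ A B, delM D β q A B = -2 * N * χ A B) (μ : Fin 4) :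
    (admGram q).map (D μ) = (admConn D N β q qi χ u μ).transpose * admGram q
      + admGram q * admConn D N β q qi χ u μ := by
  have hq : ∀ i j, q i j = q j i := fun i j => congrFun (congrFun hqs j) i
  have hqi' : ∀ (v : Fin 3 → R) A, ∑ B, q A B * ∑ C, qi B C * v C = v A := by
    intro v A
    have := congrFun (congrArg (fun M => M.mulVec v) hqi) A
    rw [← Matrix.mulVec_mulVec, Matrix.one_mulVec] at this
    exact this
  have hqχ : ∀ A B, ∑ C, q A C * u C B = χ A B := fun A B => by
    rw [← Matrix.mul_apply, hu]
  have hΓ := fun C => chr_metric (D := spatial D) hqs hqi C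
  have hΓ' : ∀ A B C, D C.succ (q A B) = ∑ E, chr (spatial D) q qi C E A * q E B
      + ∑ E, q A E * chr (spatial D) q qi C E B := fun A B C => by
    have := congrFun (congrFun (hΓ C) A) B
    rwa [Matrix.add_apply, Matrix.mul_apply, Matrix.mul_apply] at this
  have hcomm : ∀ (v : Fin 3 → R) B, ∑ A, v A * q A B = ∑ A, q B A * v A := fun v B =>
    Finset.sum_congr rfl fun A _ => by rw [hq A B, mul_comm]
  ext a b
  refine Fin.cases ?_ (fun C => ?_) μ <;> refine Fin.cases ?_ (fun A => ?_) a <;>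
    refine Fin.cases ?_ (fun B => ?_) b <;>
  simp [Matrix.mul_apply, sum_univ_succ4, admConn, admGram, blk_zero_zero, blk_zero_succ,
    blk_succ_zero, blk_succ_succ, -neg_mul]
  · rw [hcomm, hqi' (fun B => D B.succ N - ∑ C, β C * χ B C)]; ring
  · rw [hqi' (fun B => D B.succ N - ∑ C, β C * χ B C)]; ring
  · have h1 := hχ A B
    have h2 := hqχ A B
    have h3 := hqχ B A
    have h4 : χ A B = χ B A := congrFun (congrFun hχs B) A
    have h5 := hΓ' A B
    simp only [delM, Fin.sum_univ_three, h5] at h1 h2 h3 ⊢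
    rw [hq B 0, hq B 1, hq B 2] at h3
    linear_combination h1 + N * h2 + N * h3 - N * h4
  · have h3 := hqχ B C
    rw [← hcomm (fun A => u A C)] at h3
    simp only [neg_mul, Finset.sum_neg_distrib, h3]; ring
  · simp [hqχ]
  · exact hΓ' A B C

/-- The curvature of the leaves and the extrinsic curvature (Gauss). -/
theorem admConn_curv_gauss (A B C E : Fin 3) :
    curv D (admConn D N β q qi χ u) C.succ E.succ A.succ B.succ
      = curv (spatial D) (chr (spatial D) q qi) C E A B + u A C * χ B E - u A E * χ B C := by
  simp only [curv, Matrix.mul_apply, sum_univ_succ4, Matrix.add_apply, Matrix.sub_apply,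
    Matrix.map_apply]
  simp only [admConn, blk_zero_zero, blk_zero_succ, blk_succ_zero, blk_succ_succ, Fin.cases_succ,
    spatial]
  ring

/-- The Codazzi equation. -/
theorem admConn_curv_codazzi (A C E : Fin 3) :
    curv D (admConn D N β q qi χ u) C.succ E.succ A.succ 0
      = -(D C.succ (u A E) + ∑ B, chr (spatial D) q qi C A B * u B E)
        + (D E.succ (u A C) + ∑ B, chr (spatial D) q qi E A B * u B C) := by
  simp only [curv, Matrix.mul_apply, sum_univ_succ4, Matrix.add_apply, Matrix.sub_apply,
    Matrix.map_apply]
  simp only [admConn, blk_zero_zero, blk_zero_succ, blk_succ_zero, blk_succ_succ, Fin.cases_succ,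
    spatial, map_neg, mul_neg, Finset.sum_neg_distrib]
  ring

/-- The contraction with `N n = ∂_t - β` (Ricci equation). -/
theorem admConn_curv_normal (hqs : q.transpose = q) (B E : Fin 3) :
    curv D (admConn D N β q qi χ u) 0 E.succ 0 B.succ
      - ∑ C, β C * curv D (admConn D N β q qi χ u) C.succ E.succ 0 B.succ
      = -delM D β χ B E - hess D N q qi E B - N * ∑ A, χ A E * u A B := by
  simp only [curv, Matrix.mul_apply, sum_univ_succ4, Matrix.add_apply, Matrix.sub_apply,
    Matrix.map_apply]
  simp only [admConn, blk_zero_zero, blk_zero_succ, blk_succ_zero, blk_succ_succ, Fin.cases_succ,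
    Fin.cases_zero, Matrix.of_apply, delM, hess, map_neg, map_sub, map_sum, Derivation.leibniz,
    smul_eq_mul, chr_symm (D := spatial D) (gi := qi) hqs _ E B]
  simp only [Fin.sum_univ_three]
  ring

end ThreePlusOne

section ThreePlusOneRicci

variable {R : Type*} [CommRing R] [Algebra ℝ R] {D : Fin 4 → Derivation ℝ R R}
  {N M : R} {β : Fin 3 → R} {q qi χ u : Matrix (Fin 3) (Fin 3) R}

/-- The spacetime metric with lapse `N`, shift `β` and leaf metric `q`. -/
def admMetric (N : R) (β : Fin 3 → R) (q : Matrix (Fin 3) (Fin 3) R) : Matrix (Fin 4) (Fin 4) R :=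
  (admCoframe N β).transpose * admGram q * admCoframe N β

/-- The standing hypotheses on the ADM variables: `M = 1/N`, `qi` is the inverse of `q`, `χ` is the
extrinsic curvature and `u` is `χ` with its first index raised. -/
structure IsADM (D : Fin 4 → Derivation ℝ R R) (N M : R) (β : Fin 3 → R)
    (q qi χ u : Matrix (Fin 3) (Fin 3) R) : Prop where
  comm : ∀ μ ν f, D μ (D ν f) = D ν (D μ f)
  inv : N * M = 1
  symm : q.transpose = q
  mul_inv : q * qi = 1
  symm_chi : χ.transpose = χ
  raise : u = qi * χ
  evol : ∀ A B, delM D β q A B = -2 * N * χ A B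

theorem admGram_symm (h : q.transpose = q) : (admGram q).transpose = admGram q := by
  have hq : ∀ i j, q j i = q i j := fun i j => congrFun (congrFun h i) j
  ext a b
  refine Fin.cases ?_ (fun A => ?_) a <;> refine Fin.cases ?_ (fun B => ?_) b <;>
    simp [admGram, blk_zero_zero, blk_zero_succ, blk_succ_zero, blk_succ_succ, hq]

theorem admMetric_symm (h : q.transpose = q) : (admMetric N β q).transpose = admMetric N β q := by
  simp only [admMetric, Matrix.transpose_mul, Matrix.transpose_transpose, admGram_symm h, mul_assoc]

namespace IsADM

variable (h : IsADM D N M β q qi χ u) {gi : Matrix (Fin 4) (Fin 4) R}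
  (hgi : admMetric N β q * gi = 1)

include h

theorem lower : q * u = χ := by rw [h.raise, ← mul_assoc, h.mul_inv, one_mul]

include hgi

theorem levi_civita (μ : Fin 4) :
    (admCoframe N β).map (D μ) = admCoframe N β * chr D (admMetric N β q) gi μ
      - admConn D N β q qi χ u μ * admCoframe N β :=
  frame_levi_civita (admFrame_mul h.inv) (admGram_symm h.symm) (mul_eq_one_comm.1 hgi)
    (adm_torsion_free h.symm_chi h.symm)
    (adm_metric h.symm_chi h.symm h.mul_inv h.lower h.evol) μ

end IsADM

/-- The Ricci tensor in the ADM frame. -/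
def frameRicci (D : Fin 4 → Derivation ℝ R R) (N M : R) (β : Fin 3 → R)
    (q qi χ u : Matrix (Fin 3) (Fin 3) R) : Matrix (Fin 4) (Fin 4) R :=
  (Matrix.of fun c d => ∑ α, ∑ a, admFrame β M α a * curv D (admConn D N β q qi χ u) α d a c)
    * admFrame β M

namespace IsADM

variable (h : IsADM D N M β q qi χ u) {gi : Matrix (Fin 4) (Fin 4) R}
  (hgi : admMetric N β q * gi = 1)

include h

theorem ric_eq (hgi : admMetric N β q * gi = 1) :
    Matrix.of (ric D (admMetric N β q) gi)
      = (admCoframe N β).transpose * frameRicci D N M β q qi χ u * admCoframe N β := by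
  rw [frameRicci, mul_assoc, mul_assoc, admFrame_mul h.inv, mul_one]
  ext b d
  rw [Matrix.of_apply, ric_frame (admFrame_mul h.inv) h.comm (h.levi_civita hgi), Matrix.mul_apply]
  simp only [Matrix.transpose_apply, Matrix.of_apply, Finset.mul_sum]
  conv_rhs => rw [Finset.sum_comm]
  refine Finset.sum_congr rfl fun α _ => ?_
  conv_rhs => rw [Finset.sum_comm]
  exact Finset.sum_congr rfl fun a _ => Finset.sum_congr rfl fun c _ => by ring

theorem frameRicci_symm (hgi : admMetric N β q * gi = 1) :
    (frameRicci D N M β q qi χ u).transpose = frameRicci D N M β q qi χ u := by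
  have h1 : admCoframe N β * admFrame β M = 1 := mul_eq_one_comm.1 (admFrame_mul h.inv)
  have h2 : frameRicci D N M β q qi χ u
      = (admFrame β M).transpose * Matrix.of (ric D (admMetric N β q) gi) * admFrame β M := by
    rw [h.ric_eq hgi]
    rw [← mul_assoc, mul_assoc _ _ (admFrame β M), h1, mul_one, ← mul_assoc,
      ← Matrix.transpose_mul, h1, Matrix.transpose_one, one_mul]
  have h3 : (Matrix.of (ric D (admMetric N β q) gi)).transpose
      = Matrix.of (ric D (admMetric N β q) gi) := by
    ext a b
    exact ric_symm h.comm (admMetric_symm h.symm) hgi b a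
  rw [h2, Matrix.transpose_mul, Matrix.transpose_mul, h3, Matrix.transpose_transpose, mul_assoc]

theorem einstein_iff_frame (hgi : admMetric N β q * gi = 1) (l : R) :
    (∀ b d, ric D (admMetric N β q) gi b d = l * admMetric N β q b d) ↔
      frameRicci D N M β q qi χ u = l • admGram q := by
  have h1 : admCoframe N β * admFrame β M = 1 := mul_eq_one_comm.1 (admFrame_mul h.inv)
  have h2 : (∀ b d, ric D (admMetric N β q) gi b d = l * admMetric N β q b d) ↔
      Matrix.of (ric D (admMetric N β q) gi) = l • admMetric N β q :=
    ⟨fun h => by ext b d; exact h b d, fun h b d => congrFun (congrFun h b) d⟩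
  rw [h2, h.ric_eq hgi]
  constructor
  · intro h3
    have h4 := congrArg (fun X => (admFrame β M).transpose * X * admFrame β M) h3
    simp only [admMetric, Matrix.mul_smul, Matrix.smul_mul, ← mul_assoc, ← Matrix.transpose_mul,
      h1] at h4
    simpa only [Matrix.transpose_one, one_mul, mul_assoc, h1, mul_one] using h4
  · intro h3
    rw [h3, admMetric, Matrix.mul_smul, Matrix.smul_mul]

theorem curv_raise (μ ν : Fin 4) :
    curv D (admConn D N β q qi χ u) μ ν 0 0 = 0 ∧
    ∀ A : Fin 3, curv D (admConn D N β q qi χ u) μ ν A.succ 0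
      = ∑ B : Fin 3, qi A B * curv D (admConn D N β q qi χ u) μ ν 0 B.succ := by
  have hs := curv_skew h.comm (adm_metric (N := N) h.symm_chi h.symm h.mul_inv h.lower h.evol) μ ν
  generalize curv D (admConn D N β q qi χ u) μ ν = Ω at hs
  have he : ∀ a b, (Ω.transpose * admGram q + admGram q * Ω) a b = 0 := fun a b => by rw [hs]; rfl
  constructor
  · have h0 := he 0 0
    simp only [Matrix.add_apply, Matrix.mul_apply, sum_univ_succ4, admGram, blk_zero_zero,
      blk_zero_succ, blk_succ_zero, Matrix.transpose_apply, Pi.zero_apply, mul_zero, zero_mul,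
      Finset.sum_const_zero] at h0
    have h1 : Ω 0 0 = -((1 / 2 : ℝ) • (Ω 0 0 * -1 + 0 + (-1 * Ω 0 0 + 0))) := by algebra
    rw [h1, h0, smul_zero, neg_zero]
  · intro A
    have hB : ∀ B : Fin 3, Ω 0 B.succ = ∑ C : Fin 3, q B C * Ω C.succ 0 := fun B => by
      have h0 := he B.succ 0
      simp only [Matrix.add_apply, Matrix.mul_apply, sum_univ_succ4, admGram, blk_zero_zero,
        blk_zero_succ, blk_succ_zero, blk_succ_succ, Matrix.transpose_apply, Pi.zero_apply,
        mul_zero, zero_mul, Finset.sum_const_zero] at h0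
      linear_combination -h0
    have h2 := congrFun (congrArg (fun M => M.mulVec fun C : Fin 3 => Ω C.succ 0)
      (mul_eq_one_comm.1 h.mul_inv)) A
    rw [← Matrix.mulVec_mulVec, Matrix.one_mulVec] at h2
    simp only [hB]
    exact h2.symm

theorem frameRicci_succ_succ (B E : Fin 3) :
    frameRicci D N M β q qi χ u B.succ E.succ
      = M * (-delM D β χ B E - hess D N q qi E B - N * ∑ A, χ A E * u A B)
        + ric (spatial D) q qi B E + (∑ A, u A A) * χ B E - ∑ A, u A E * χ B A := by
  rw [← admConn_curv_normal (N := N) h.symm B E]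
  simp only [frameRicci, Matrix.mul_apply, sum_univ_succ4, admFrame, blk_zero_zero, blk_zero_succ,
    blk_succ_zero, blk_succ_succ, Matrix.of_apply, Pi.zero_apply, Matrix.one_apply]
  simp only [zero_mul, Finset.sum_const_zero, add_zero, zero_add, mul_zero, ite_mul, mul_ite,
    one_mul, mul_one, Finset.sum_ite_eq, Finset.sum_ite_eq', Finset.mem_univ, if_true,
    Finset.sum_add_distrib, admConn_curv_gauss, Finset.sum_sub_distrib, ric, Finset.sum_mul,
    mul_sub, Finset.mul_sum]
  simp only [Fin.sum_univ_three]
  ring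

theorem frameRicci_zero_succ (E : Fin 3) :
    frameRicci D N M β q qi χ u 0 E.succ
      = -(diverg D q qi u E - D E.succ (∑ A, u A A)) := by
  simp only [frameRicci, Matrix.mul_apply, sum_univ_succ4, admFrame, blk_zero_zero, blk_zero_succ,
    blk_succ_zero, blk_succ_succ, Matrix.of_apply, Pi.zero_apply, Matrix.one_apply]
  simp only [zero_mul, Finset.sum_const_zero, add_zero, zero_add, mul_zero, ite_mul, mul_ite,
    one_mul, mul_one, Finset.sum_ite_eq, Finset.sum_ite_eq', Finset.mem_univ, if_true,
    Finset.sum_add_distrib, admConn_curv_codazzi, (h.curv_raise _ _).1, diverg, map_sum]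
  have hd : ∀ x y, chr (spatial D) q qi y x x = chr (spatial D) q qi x x y := fun x y =>
    chr_symm h.symm x x y
  simp only [hd]
  simp only [Fin.sum_univ_three]
  ring

theorem frameRicci_zero_zero :
    frameRicci D N M β q qi χ u 0 0
      = -(M * ∑ A, ∑ B, qi A B *
        (-delM D β χ B A - hess D N q qi A B - N * ∑ C, χ C A * u C B)) := by
  simp only [← admConn_curv_normal (N := N) h.symm]
  simp only [frameRicci, Matrix.mul_apply, sum_univ_succ4, admFrame, blk_zero_zero, blk_zero_succ,
    blk_succ_zero, blk_succ_succ, Matrix.of_apply, Pi.zero_apply, Matrix.one_apply]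
  simp only [zero_mul, Finset.sum_const_zero, add_zero, zero_add, mul_zero, ite_mul, mul_ite,
    one_mul, mul_one, Finset.sum_ite_eq, Finset.sum_ite_eq', Finset.mem_univ, if_true,
    Finset.sum_add_distrib, (h.curv_raise _ _).1, (h.curv_raise _ _).2]
  have key : ∀ x B : Fin 3, curv D (admConn D N β q qi χ u) 0 x.succ 0 B.succ
        - ∑ C, β C * curv D (admConn D N β q qi χ u) C.succ x.succ 0 B.succ
      = -(curv D (admConn D N β q qi χ u) x.succ 0 0 B.succ
        - ∑ C, β C * curv D (admConn D N β q qi χ u) x.succ C.succ 0 B.succ) := fun x B => by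
    simp only [fun μ => curv_swap D (admConn D N β q qi χ u) μ x.succ, Matrix.neg_apply, mul_neg,
      Finset.sum_neg_distrib]
    ring
  simp only [key]
  simp only [Fin.sum_univ_three]
  ring

/-- The square `χ_{AC} χ^C_B` is symmetric. -/
theorem square_symm (A B : Fin 3) : ∑ C, χ C B * u C A = ∑ C, χ A C * u C B := by
  have hqis : qi.transpose = qi := by
    have h1 := congrArg Matrix.transpose (mul_eq_one_comm.1 h.mul_inv)
    rw [Matrix.transpose_mul, h.symm, Matrix.transpose_one] at h1
    rw [← one_mul qi.transpose, ← mul_eq_one_comm.1 h.mul_inv, mul_assoc, h1, mul_one]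
  have h1 : (χ.transpose * u).transpose = χ * u := by
    rw [Matrix.transpose_mul, Matrix.transpose_transpose, h.raise, Matrix.transpose_mul, hqis,
      h.symm_chi, mul_assoc]
  exact congrFun (congrFun h1 A) B

theorem hess_symm (A B : Fin 3) : hess D N q qi A B = hess D N q qi B A := by
  simp only [hess, h.comm A.succ, chr_symm (D := spatial D) h.symm _ A B]

/-- Einstein's equations `R_{μν} = l g_{μν}` split into the momentum constraint (the component
normal-tangent), the Hamiltonian constraint (twice the normal component of the Einstein tensor)
and the evolution equation of the extrinsic curvature (the tangent components). -/
theorem einstein_iff (hgi : admMetric N β q * gi = 1) (l : R) :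
    (∀ b d, ric D (admMetric N β q) gi b d = l * admMetric N β q b d) ↔
      (∀ E, diverg D q qi u E - D E.succ (∑ A, u A A) = 0) ∧
      ((∑ A, ∑ B, qi A B * ric (spatial D) q qi A B) + (∑ A, u A A) ^ 2
        - (∑ A, ∑ B, u A B * u B A) = 2 * l) ∧
      (∀ A B, delM D β χ A B = N * (ric (spatial D) q qi A B + (∑ C, u C C) * χ A B
        - 2 * (∑ C, χ A C * u C B) - l * q A B) - hess D N q qi A B) := by
  have hcs : ∀ μ ν f, spatial D μ (spatial D ν f) = spatial D ν (spatial D μ f) :=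
    fun μ ν f => h.comm _ _ f
  have hqi' : qi * q = 1 := mul_eq_one_comm.1 h.mul_inv
  have htrq : ∑ A, ∑ B, qi A B * q B A = 3 := by
    have h1 := congrArg Matrix.trace hqi'
    simpa [Matrix.trace, Matrix.diag, Matrix.mul_apply] using h1
  have htrχ : ∑ A, ∑ B, qi A B * χ B A = ∑ A, u A A := by
    rw [h.raise]; simp only [Matrix.mul_apply]
  have hSS : ∀ A B, frameRicci D N M β q qi χ u A.succ B.succ
      = -(M * (delM D β χ A B + hess D N q qi A B)) + ric (spatial D) q qi A B
        + (∑ C, u C C) * χ A B - 2 * ∑ C, χ A C * u C B := fun A B => by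
    rw [h.frameRicci_succ_succ, h.square_symm, h.hess_symm B A,
      Finset.sum_congr rfl fun C _ => mul_comm (u C B) (χ A C)]
    linear_combination -(∑ C, χ A C * u C B) * h.inv
  have hnorm : ∑ A, ∑ B, qi A B * ∑ C, χ B C * u C A = ∑ A, ∑ B, u A B * u B A := by
    refine Finset.sum_congr rfl fun A _ => ?_
    simp only [Finset.mul_sum]
    rw [Finset.sum_comm]
    refine Finset.sum_congr rfl fun C _ => ?_
    have hu : u A C = ∑ B, qi A B * χ B C := by rw [h.raise, Matrix.mul_apply]
    rw [hu, Finset.sum_mul]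
    exact Finset.sum_congr rfl fun B _ => by ring
  have h00 : frameRicci D N M β q qi χ u 0 0 = ((∑ A, ∑ B, qi A B * ric (spatial D) q qi A B)
      + (∑ A, u A A) ^ 2 - (∑ A, ∑ B, u A B * u B A))
        - ∑ A, ∑ B, qi A B * frameRicci D N M β q qi χ u B.succ A.succ := by
    have h1 : ∑ A, ∑ B, qi A B * frameRicci D N M β q qi χ u B.succ A.succ
        = (M * ∑ A, ∑ B, qi A B *
          (-delM D β χ B A - hess D N q qi A B - N * ∑ C, χ C A * u C B))
        + ((∑ A, ∑ B, qi A B * ric (spatial D) q qi A B)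
          + (∑ A, u A A) * (∑ A, ∑ B, qi A B * χ B A)
          - ∑ A, ∑ B, qi A B * ∑ C, χ B C * u C A) := by
      simp only [Finset.mul_sum _ _ M, Finset.mul_sum _ _ (∑ A, u A A), ← Finset.sum_add_distrib,
        ← Finset.sum_sub_distrib]
      refine Finset.sum_congr rfl fun A _ => Finset.sum_congr rfl fun B _ => ?_
      rw [h.frameRicci_succ_succ, ric_symm hcs h.symm h.mul_inv B A,
        Finset.sum_congr rfl fun C _ => mul_comm (u C A) (χ B C)]
      ring
    rw [h.frameRicci_zero_zero, h1, htrχ, hnorm]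
    ring
  rw [h.einstein_iff_frame hgi]
  constructor
  · intro he
    have he' : ∀ a b, frameRicci D N M β q qi χ u a b = l * admGram q a b := fun a b => by
      rw [he]; rfl
    refine ⟨fun E => ?_, ?_, fun A B => ?_⟩
    · have h1 := he' 0 E.succ
      rw [h.frameRicci_zero_succ, admGram, blk_zero_succ, Pi.zero_apply, mul_zero] at h1
      exact neg_eq_zero.1 h1
    · simp only [he', admGram, blk_zero_zero, blk_succ_succ] at h00
      have h1 : ∑ A, ∑ B, qi A B * (l * q B A) = l * 3 := by
        rw [← htrq]
        simp only [Finset.mul_sum]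
        exact Finset.sum_congr rfl fun A _ => Finset.sum_congr rfl fun B _ => by ring
      rw [h1] at h00
      linear_combination -h00
    · have h1 := he' A.succ B.succ
      rw [hSS, admGram, blk_succ_succ] at h1
      linear_combination -N * h1 - (delM D β χ A B + hess D N q qi A B) * h.inv
  · rintro ⟨hm, hH, hev⟩
    have e0S : ∀ E : Fin 3, frameRicci D N M β q qi χ u 0 E.succ = 0 := fun E => by
      rw [h.frameRicci_zero_succ, hm, neg_zero]
    have eSS : ∀ A B : Fin 3, frameRicci D N M β q qi χ u A.succ B.succ = l * q A B := fun A B => by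
      rw [hSS, hev]
      linear_combination -(ric (spatial D) q qi A B + (∑ C, u C C) * χ A B
        - 2 * (∑ C, χ A C * u C B) - l * q A B) * h.inv
    ext a b
    refine Fin.cases ?_ (fun A => ?_) a <;> refine Fin.cases ?_ (fun B => ?_) b
    · simp only [eSS] at h00
      have h1 : ∑ A, ∑ B, qi A B * (l * q B A) = l * 3 := by
        rw [← htrq]
        simp only [Finset.mul_sum]
        exact Finset.sum_congr rfl fun A _ => Finset.sum_congr rfl fun B _ => by ring
      rw [h00, hH, h1, Matrix.smul_apply, smul_eq_mul, admGram, blk_zero_zero]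
      ring
    · rw [e0S, Matrix.smul_apply, admGram, blk_zero_succ, Pi.zero_apply, smul_zero]
    · have h1 := congrFun (congrFun (h.frameRicci_symm hgi) A.succ) 0
      rw [Matrix.transpose_apply] at h1
      rw [← h1, e0S, Matrix.smul_apply, admGram, blk_succ_zero, Pi.zero_apply, smul_zero]
    · rw [eSS]; rfl

end IsADM

end ThreePlusOneRicci

/-! ### Coordinate expressions as elements of the algebra of smooth functions -/

section Transfer

variable {U : Set Coord} {n : ℕ} {dd : Fin n → (Coord → ℝ) → Coord → ℝ}
  {D : Fin n → Derivation ℝ (smoothAlg U) (smoothAlg U)}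
  {G : Fin n → Fin n → Coord → ℝ} {g gi : Matrix (Fin n) (Fin n) (smoothAlg U)}

theorem rep_iff_forall {ι : Type*} {F : ι → Coord → ℝ} {f : ι → smoothAlg U}
    (h : ∀ i, Rep (F i) (f i)) : (∀ i, f i = 0) ↔ ∀ i, ∀ x ∈ U, F i x = 0 :=
  ⟨fun hf i x hx => by rw [h i ⟨x, hx⟩, hf i, map_zero],
   fun hF i => smoothAlg_ext fun x => by rw [map_zero, ← h i x]; exact hF i x x.2⟩

theorem rep_eq_zero_iff {F : Coord → ℝ} {f : smoothAlg U} (h : Rep F f) :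
    f = 0 ↔ ∀ x ∈ U, F x = 0 :=
  ⟨fun hf x hx => by rw [h ⟨x, hx⟩, hf, map_zero],
   fun hF => smoothAlg_ext fun x => by rw [map_zero, ← h x]; exact hF x x.2⟩

theorem Rep.unique {F : Coord → ℝ} {f f' : smoothAlg U} (h : Rep F f) (h' : Rep F f') : f = f' :=
  smoothAlg_ext fun x => by rw [← h x, ← h' x]

theorem Rep.add {F F' : Coord → ℝ} {f f' : smoothAlg U} (h : Rep F f) (h' : Rep F' f') :
    Rep (fun x => F x + F' x) (f + f') := fun x => by rw [map_add, ← h x, ← h' x]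

theorem Rep.sub {F F' : Coord → ℝ} {f f' : smoothAlg U} (h : Rep F f) (h' : Rep F' f') :
    Rep (fun x => F x - F' x) (f - f') := fun x => by rw [map_sub, ← h x, ← h' x]

theorem Rep.mul {F F' : Coord → ℝ} {f f' : smoothAlg U} (h : Rep F f) (h' : Rep F' f') :
    Rep (fun x => F x * F' x) (f * f') := fun x => by rw [map_mul, ← h x, ← h' x]

theorem Rep.const_mul {F : Coord → ℝ} {f : smoothAlg U} (c : ℝ) (h : Rep F f) :
    Rep (fun x => c * F x) (c • f) := fun x => by rw [map_smul, ← h x, smul_eq_mul]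

theorem Rep.sum {ι : Type*} {s : Finset ι} {F : ι → Coord → ℝ} {f : ι → smoothAlg U}
    (h : ∀ i, Rep (F i) (f i)) : Rep (fun x => ∑ i ∈ s, F i x) (∑ i ∈ s, f i) := fun x => by
  rw [map_sum]; exact Finset.sum_congr rfl fun i _ => h i x

theorem rep_matrixInv {F : Coord → Matrix (Fin n) (Fin n) ℝ}
    (h : ∀ a b, Rep (fun x => F x a b) (g a b)) (hgi : g * gi = 1) (a b : Fin n) :
    Rep (fun x => (F x)⁻¹ a b) (gi a b) := fun x => by
  have h1 : g.map (ev x) * gi.map (ev x) = 1 := by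
    rw [← Matrix.map_mul, hgi]
    exact Matrix.map_one _ (map_zero _) (map_one _)
  have h2 : F x = g.map (ev x) := by ext a b; exact h a b x
  change (F x)⁻¹ a b = gi.map (ev x) a b
  rw [h2, Matrix.inv_eq_right_inv h1]

variable (hdd : ∀ i F f, Rep F f → Rep (dd i F) (D i f)) (hG : ∀ a b, Rep (G a b) (g a b))
  (hgi : g * gi = 1)

include hG hgi

theorem rep_metricInv (a b : Fin n) : Rep (metricInv G a b) (gi a b) :=
  rep_matrixInv (F := fun x => Matrix.of fun c d => G c d x) hG hgi a b

include hdd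

theorem rep_christoffel (a b c : Fin n) :
    Rep (christoffel dd G a b c) (chr D g gi c a b) := by
  exact Rep.const_mul _ (Rep.sum fun d => (rep_metricInv hG hgi a d).mul
    (((hdd b _ _ (hG d c)).add (hdd c _ _ (hG d b))).sub (hdd d _ _ (hG b c))))

theorem rep_riemann (hg : g.transpose = g) (a b c d : Fin n) :
    Rep (riemann dd G a b c d) (curv D (chr D g gi) c d a b) := by
  have hc := rep_christoffel hdd hG hgi
  have h1 : curv D (chr D g gi) c d a b = D c (chr D g gi d a b) - D d (chr D g gi c a b)
      + ∑ f, (chr D g gi f a c * chr D g gi d f b - chr D g gi f a d * chr D g gi c f b) := by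
    simp only [curv, fun f => chr_symm (D := D) (gi := gi) hg a c f,
      fun f => chr_symm (D := D) (gi := gi) hg a d f, Matrix.add_apply, Matrix.sub_apply,
      Matrix.map_apply, Matrix.mul_apply,
      Finset.sum_sub_distrib]
    ring
  rw [h1]
  exact ((hdd c _ _ (hc a b d)).sub (hdd d _ _ (hc a b c))).add
    (Rep.sum (s := Finset.univ) fun f : Fin n =>
      ((hc a c f).mul (hc f b d)).sub ((hc a d f).mul (hc f b c)))

theorem rep_ricci (hg : g.transpose = g) (b d : Fin n) : Rep (ricci dd G b d) (ric D g gi b d) :=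
  Rep.sum fun a => rep_riemann hdd hG hgi hg a b a d

theorem rep_scalarCurv (hg : g.transpose = g) :
    Rep (scalarCurv dd G) (∑ a, ∑ b, gi a b * ric D g gi a b) :=
  Rep.sum fun a => Rep.sum fun b => (rep_metricInv hG hgi a b).mul (rep_ricci hdd hG hgi hg a b)

theorem rep_hessian {F : Coord → ℝ} {f : smoothAlg U} (hF : Rep F f) (a b : Fin n) :
    Rep (hessian dd G F a b) (D a (D b f) - ∑ c, chr D g gi b c a * D c f) :=
  (hdd a _ _ (hdd b _ _ hF)).sub (Rep.sum fun c =>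
    (rep_christoffel hdd hG hgi c a b).mul (hdd c _ _ hF))

theorem rep_covDeriv1 {F : Fin n → Coord → ℝ} {f : Fin n → smoothAlg U} (hF : ∀ a, Rep (F a) (f a))
    (a b : Fin n) :
    Rep (covDeriv1 dd G F a b) (D a (f b) - ∑ c, chr D g gi b c a * f c) :=
  (hdd a _ _ (hF b)).sub (Rep.sum fun c =>
    (rep_christoffel hdd hG hgi c a b).mul (hF c))

variable {T : Fin n → Fin n → Coord → ℝ} {t : Matrix (Fin n) (Fin n) (smoothAlg U)}
  (hT : ∀ a b, Rep (T a b) (t a b))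

include hT

theorem rep_divMixed (c : Fin n) :
    Rep (divMixed dd G T c) (∑ a, (D a (t a c) + ∑ f, (chr D g gi f a a * t f c
      - chr D g gi c f a * t a f))) :=
  Rep.sum fun a => (hdd a _ _ (hT a c)).add (Rep.sum fun f =>
    ((rep_christoffel hdd hG hgi a a f).mul (hT f c)).sub
      ((rep_christoffel hdd hG hgi f a c).mul (hT a f)))

omit hdd

theorem rep_raise (a b : Fin n) : Rep (raise G T a b) ((gi * t) a b) := by
  rw [Matrix.mul_apply]
  exact Rep.sum fun c => (rep_metricInv hG hgi a c).mul (hT c b)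

theorem rep_tr : Rep (tr G T) (∑ a, (gi * t) a a) :=
  Rep.sum fun a => rep_raise hG hgi hT a a

theorem rep_normSq : Rep (normSq G T) (∑ a, ∑ b, (gi * t) a b * (gi * t) b a) :=
  Rep.sum fun a => Rep.sum fun b => (rep_raise hG hgi hT a b).mul (rep_raise hG hgi hT b a)

theorem rep_square (a b : Fin n) : Rep (square G T a b) (∑ c, t a c * (gi * t) c b) :=
  Rep.sum fun c => (hT a c).mul (rep_raise hG hgi hT c b)

end Transfer

theorem rep_deltaM {U : Set Coord} (hU : IsOpen U) {b : Fin 3 → Coord → ℝ}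
    {T : Fin 3 → Fin 3 → Coord → ℝ} {β : Fin 3 → smoothAlg U}
    {t : Matrix (Fin 3) (Fin 3) (smoothAlg U)} (hb : ∀ A, Rep (b A) (β A))
    (hT : ∀ A B, Rep (T A B) (t A B)) (A B : Fin 3) :
    Rep (deltaM b T A B) (delM (der hU) β t A B) :=
  ((hT A B).pd hU 0).sub (Rep.sum fun C => (((hb C).mul ((hT A B).pd hU C.succ)).add
    ((hT C B).mul ((hb C).pd hU A.succ))).add ((hT A C).mul ((hb C).pd hU B.succ)))

/-! ### Adapted coframes over a ring with derivations -/

section AdaptedAlg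

variable {R : Type*} [CommRing R] [Algebra ℝ R] (D : Fin 4 → Derivation ℝ R R)
  (E : Matrix (Fin 4) (Fin 4) R)

/-- The Minkowski form as a matrix. -/
def etaM (R : Type*) [CommRing R] : Matrix (Fin 4) (Fin 4) R := blk (-1) 0 0 1

/-- The triad of an adapted coframe. -/
def triadM : Matrix (Fin 3) (Fin 3) R := Matrix.of fun i A => E i.succ A.succ

/-- The shift of an adapted coframe. -/
def shiftM (A : Fin 3) : R := ∑ i, (triadM E)⁻¹ A i * E i.succ 0

/-- The leaf metric of an adapted coframe. -/
def leafM : Matrix (Fin 3) (Fin 3) R := (triadM E).transpose * triadM E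

/-- The inverse leaf metric of an adapted coframe. -/
def leafInvM : Matrix (Fin 3) (Fin 3) R := (triadM E)⁻¹ * (triadM E)⁻¹.transpose

/-- The extrinsic curvature of the leaves of an adapted coframe. -/
def chiM : Matrix (Fin 3) (Fin 3) R := Matrix.of fun A B =>
  (-(1 / 2) : ℝ) • (Ring.inverse (E 0 0) * delM D (shiftM E) (leafM E) A B)

/-- The coframe is invertible and its `e^0` is a multiple of `dt`. -/
structure IsAdapted : Prop where
  zero : ∀ A : Fin 3, E 0 A.succ = 0
  det : IsUnit E.det

variable {D E}

namespace IsAdapted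

theorem det_eq (hz : ∀ A : Fin 3, E 0 A.succ = 0) : E.det = E 0 0 * (triadM E).det := by
  rw [Matrix.det_succ_row_zero, sum_univ_succ4]
  simp only [hz, mul_zero, zero_mul, Finset.sum_const_zero, add_zero]
  simp only [Fin.val_zero, pow_zero, one_mul]
  congr 1

variable (h : IsAdapted E)
include h

theorem isUnit_lapse : IsUnit (E 0 0) := by
  have := h.det; rw [det_eq h.zero] at this; exact isUnit_of_mul_isUnit_left this

theorem isUnit_triad : IsUnit (triadM E).det := by
  have := h.det; rw [det_eq h.zero] at this; exact isUnit_of_mul_isUnit_right this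

theorem triad_mul_inv : triadM E * (triadM E)⁻¹ = 1 := Matrix.mul_nonsing_inv _ h.isUnit_triad

theorem inv_mul_triad : (triadM E)⁻¹ * triadM E = 1 := Matrix.nonsing_inv_mul _ h.isUnit_triad

theorem triad_shift (i : Fin 3) : ∑ A, E i.succ A.succ * shiftM E A = E i.succ 0 := by
  have h2 := congrFun (congrArg (fun M => M.mulVec fun i : Fin 3 => E i.succ 0) h.triad_mul_inv) i
  rw [← Matrix.mulVec_mulVec, Matrix.one_mulVec] at h2
  exact h2

theorem eq_mul : E = blk 1 0 0 (triadM E) * admCoframe (E 0 0) (shiftM E) := by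
  ext a b
  refine Fin.cases ?_ (fun A => ?_) a <;> refine Fin.cases ?_ (fun B => ?_) b <;>
  simp only [Matrix.mul_apply, sum_univ_succ4, admCoframe, blk_zero_zero, blk_zero_succ,
    blk_succ_zero, blk_succ_succ, Matrix.one_apply, h.zero, Pi.zero_apply, mul_zero, zero_mul,
    Finset.sum_const_zero, add_zero, zero_add, one_mul]
  · exact (h.triad_shift A).symm
  · simp [triadM]

theorem leaf_mul_inv : leafM E * leafInvM E = 1 := by
  rw [leafM, leafInvM, mul_assoc, ← mul_assoc (triadM E), h.triad_mul_inv, one_mul,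
    ← Matrix.transpose_mul, h.inv_mul_triad, Matrix.transpose_one]

theorem metric_eq : E.transpose * etaM R * E
    = admMetric (E 0 0) (shiftM E) (leafM E) := by
  have h1 : (blk 1 0 0 (triadM E)).transpose * etaM R * blk 1 0 0 (triadM E)
      = admGram (leafM E) := by
    ext a b
    refine Fin.cases ?_ (fun A => ?_) a <;> refine Fin.cases ?_ (fun B => ?_) b <;>
    simp [Matrix.mul_apply, sum_univ_succ4, admGram, etaM, blk_zero_zero, blk_zero_succ,
      blk_succ_zero, blk_succ_succ, Matrix.one_apply, leafM]
  have h2 := h.eq_mul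
  generalize triadM E = t at h1 h2
  rw [admMetric, ← h1]
  conv_lhs => rw [h2]
  simp only [Matrix.transpose_mul, mul_assoc]

theorem isADM (hD : ∀ μ ν f, D μ (D ν f) = D ν (D μ f)) :
    IsADM D (E 0 0) (Ring.inverse (E 0 0)) (shiftM E) (leafM E) (leafInvM E) (chiM D E)
      (leafInvM E * chiM D E) where
  comm := hD
  inv := Ring.mul_inverse_cancel _ h.isUnit_lapse
  symm := by rw [leafM, Matrix.transpose_mul, Matrix.transpose_transpose]
  mul_inv := h.leaf_mul_inv
  symm_chi := by
    have hq : ∀ i j, leafM E i j = leafM E j i := fun i j => by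
      simp only [leafM, Matrix.mul_apply, Matrix.transpose_apply, mul_comm]
    ext A B
    simp only [chiM, Matrix.transpose_apply, Matrix.of_apply, delM, hq B A, hq B, hq _ A]
    congr 4
    funext C
    ring
  raise := rfl
  evol := fun A B => by
    have h1 := Ring.mul_inverse_cancel _ h.isUnit_lapse
    rw [chiM, Matrix.of_apply]
    generalize delM D (shiftM E) (leafM E) A B = X
    calc X = (E 0 0 * Ring.inverse (E 0 0)) * X := by rw [h1, one_mul]
      _ = _ := by algebra

end IsAdapted

end AdaptedAlg

namespace Fields

variable {U : Set Coord} {Φ : Fields}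

/-- The coframe as a matrix over the smooth functions on `U`. -/
def coframe (hs : Φ.SmoothOn U) : Matrix (Fin 4) (Fin 4) (smoothAlg U) :=
  Matrix.of fun a μ => toAlg (Φ.e a μ) (hs.1 a μ)

theorem rep_e (hs : Φ.SmoothOn U) (a μ : Fin 4) : Rep (Φ.e a μ) (Φ.coframe hs a μ) :=
  rep_toAlg _ (hs.1 a μ)

theorem isUnit_coframe_det (hs : Φ.SmoothOn U)
    (h : ∀ x ∈ U, (Matrix.of fun a μ => Φ.e a μ x).det ≠ 0) : IsUnit (Φ.coframe hs).det := by
  refine smoothAlg_isUnit _ fun x => ?_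
  have h1 := (ev x).map_det (Φ.coframe hs)
  rw [h1]
  exact h x x.2

theorem isAdapted (hs : Φ.SmoothOn U) (ha : AdaptedOn Φ.e U) : IsAdapted (Φ.coframe hs) where
  zero := fun A => (rep_eq_zero_iff (rep_e hs 0 A.succ)).2 fun x hx => (ha x hx).1 A
  det := isUnit_coframe_det hs fun x hx => (ha x hx).2

theorem rep_metric (hs : Φ.SmoothOn U) (μ ν : Fin 4) :
    Rep (Φ.metric μ ν) (((Φ.coframe hs).transpose * etaM (smoothAlg U) * Φ.coframe hs) μ ν) := by
  have h1 : ((Φ.coframe hs).transpose * etaM (smoothAlg U) * Φ.coframe hs) μ ν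
      = ∑ a, ∑ b, (eta a b • Φ.coframe hs a μ) * Φ.coframe hs b ν := by
    simp only [Matrix.mul_apply, Finset.sum_mul, Matrix.transpose_apply]
    rw [Finset.sum_comm]
    refine Finset.sum_congr rfl fun a _ => Finset.sum_congr rfl fun b _ => ?_
    have : etaM (smoothAlg U) a b = eta a b • 1 := by
      refine Fin.cases ?_ (fun A => ?_) a <;> refine Fin.cases ?_ (fun B => ?_) b <;>
        simp [etaM, eta, blk_zero_zero, blk_zero_succ, blk_succ_zero, blk_succ_succ,
          Fin.succ_ne_zero, (Fin.succ_ne_zero _).symm, Matrix.one_apply]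
    rw [this]; algebra
  rw [h1]
  exact Rep.sum fun a => Rep.sum fun b => ((rep_e hs a μ).const_mul _).mul (rep_e hs b ν)

variable (hs : Φ.SmoothOn U)

theorem rep_lapse : Rep Φ.lapse (Φ.coframe hs 0 0) := rep_e hs 0 0

theorem rep_leafMetric (A B : Fin 3) : Rep (Φ.leafMetric A B) (leafM (Φ.coframe hs) A B) := by
  rw [leafM, Matrix.mul_apply]
  exact Rep.sum fun i : Fin 3 => (rep_e hs i.succ A.succ).mul (rep_e hs i.succ B.succ)

variable (ha : AdaptedOn Φ.e U)
include ha

theorem rep_triadInv (A i : Fin 3) : Rep (Φ.triadInv A i) ((triadM (Φ.coframe hs))⁻¹ A i) :=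
  rep_matrixInv (F := fun x => Matrix.of fun j C => Φ.triad j C x)
    (fun j C => rep_e hs j.succ C.succ) (isAdapted hs ha).triad_mul_inv A i

theorem rep_shift (A : Fin 3) : Rep (Φ.shift A) (shiftM (Φ.coframe hs) A) :=
  Rep.sum fun i => (rep_triadInv hs ha A i).mul (rep_e hs i.succ 0)

theorem rep_chi (hU : IsOpen U) (A B : Fin 3) :
    Rep (Φ.chi A B) (chiM (der hU) (Φ.coframe hs) A B) := fun x => by
  have h1 := rep_deltaM hU (rep_shift hs ha) (rep_leafMetric hs) A B x
  have h2 : ev x (Ring.inverse (Φ.coframe hs 0 0)) = (Φ.lapse x)⁻¹ := by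
    have := congrArg (ev x) (Ring.mul_inverse_cancel _ (isAdapted hs ha).isUnit_lapse)
    rw [map_mul, map_one, ← rep_lapse hs x] at this
    exact (inv_eq_of_mul_eq_one_right this).symm
  rw [chi, chiM, Matrix.of_apply, map_smul, map_mul, h1, h2, smul_eq_mul]
  generalize ev x _ = y
  rw [one_div, mul_inv]; ring

end Fields

/-! ### Einstein's equations and the ADM equations -/

section
variable {R : Type*} [CommRing R] [Algebra ℝ R] {D : Fin 4 → Derivation ℝ R R}
  {E : Matrix (Fin 4) (Fin 4) R}

theorem etaM_mul_self : etaM R * etaM R = 1 := by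
  ext a b
  refine Fin.cases ?_ (fun A => ?_) a <;> refine Fin.cases ?_ (fun B => ?_) b <;>
  simp [Matrix.mul_apply, sum_univ_succ4, etaM, blk_zero_zero, blk_zero_succ,
    blk_succ_zero, blk_succ_succ, Matrix.one_apply, Fin.succ_ne_zero, (Fin.succ_ne_zero _).symm]

theorem etaM_transpose : (etaM R).transpose = etaM R := by
  ext a b
  refine Fin.cases ?_ (fun A => ?_) a <;> refine Fin.cases ?_ (fun B => ?_) b <;>
  simp [etaM, blk_zero_zero, blk_zero_succ, blk_succ_zero, blk_succ_succ, Matrix.one_apply,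
    eq_comm]

/-- The spacetime metric of a coframe. -/
def metricM (E : Matrix (Fin 4) (Fin 4) R) : Matrix (Fin 4) (Fin 4) R :=
  E.transpose * etaM R * E

/-- The inverse spacetime metric of a coframe. -/
def metricInvM (E : Matrix (Fin 4) (Fin 4) R) : Matrix (Fin 4) (Fin 4) R :=
  E⁻¹ * etaM R * E⁻¹.transpose

theorem metricM_symm : (metricM E).transpose = metricM E := by
  simp only [metricM, Matrix.transpose_mul, Matrix.transpose_transpose, etaM_transpose, mul_assoc]

theorem metricM_mul_inv (h : IsUnit E.det) : metricM E * metricInvM E = 1 := by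
  calc metricM E * metricInvM E
      = E.transpose * etaM R * (E * E⁻¹) * etaM R * E⁻¹.transpose := by
        simp only [metricM, metricInvM, mul_assoc]
    _ = 1 := by
        rw [Matrix.mul_nonsing_inv _ h, mul_one, mul_assoc _ (etaM R) (etaM R), etaM_mul_self,
          mul_one, ← Matrix.transpose_mul, Matrix.nonsing_inv_mul _ h, Matrix.transpose_one]

end

namespace Fields

variable {U : Set Coord} {Φ : Fields} (hU : IsOpen U) (hs : Φ.SmoothOn U) (lam : ℝ)

theorem einsteinEquations_iff_ric (hE : IsUnit (Φ.coframe hs).det) :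
    Φ.EinsteinEquations lam U ↔ ∀ b d, ric (der hU) (metricM (Φ.coframe hs))
      (metricInvM (Φ.coframe hs)) b d
        = algebraMap ℝ _ lam * metricM (Φ.coframe hs) b d := by
  have hg := metricM_mul_inv hE
  have hG : ∀ μ ν, Rep (Φ.metric μ ν) (metricM (Φ.coframe hs) μ ν) := rep_metric hs
  have hdd : ∀ i F (f : smoothAlg U), Rep F f → Rep (pd i F) (der hU i f) :=
    fun i F f h => h.pd hU i
  have hric := rep_ricci hdd hG hg metricM_symm
  have hsc := rep_scalarCurv hdd hG hg metricM_symm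
  have htr : ∑ a, ∑ b, metricInvM (Φ.coframe hs) a b * metricM (Φ.coframe hs) a b = 4 := by
    have h1 := congrArg Matrix.trace (mul_eq_one_comm.1 hg)
    rw [← metricM_symm] at h1
    simpa [Matrix.trace, Matrix.diag, Matrix.mul_apply] using h1
  generalize metricM (Φ.coframe hs) = g at *
  generalize metricInvM (Φ.coframe hs) = gi at *
  generalize ric (der hU) g gi = r at *
  have key : Φ.EinsteinEquations lam U ↔ ∀ b d,
      r b d - (1 / 2 : ℝ) • (∑ a, ∑ b, gi a b * r a b) * g b d + lam • g b d = 0 :=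
    forall_congr' fun b => forall_congr' fun d => (rep_eq_zero_iff
      (((hric b d).sub ((hsc.const_mul (1 / 2)).mul (hG b d))).add ((hG b d).const_mul lam))).symm
  have hc : ∀ c : smoothAlg U, (∀ a b, r a b = c * g a b) →
      ∑ a, ∑ b, gi a b * r a b = c * 4 := fun c h => by
    rw [← htr, Finset.mul_sum]
    refine Finset.sum_congr rfl fun a _ => ?_
    rw [Finset.mul_sum]
    exact Finset.sum_congr rfl fun b _ => by rw [h]; ring
  have h4 : ∀ x : smoothAlg U, (1 / 2 : ℝ) • x * 4 = 2 * x := fun x => by algebra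
  rw [key]
  constructor
  · intro h
    generalize ∑ a, ∑ b, gi a b * r a b = s at h hc
    have h3 : ∀ a b, r a b = ((1 / 2 : ℝ) • s - algebraMap ℝ _ lam) * g a b := fun a b => by
      rw [← sub_eq_zero, ← h a b]; algebra
    -- the trace of Einstein's equations: the scalar curvature is `4Λ`
    have h1 := hc _ h3
    rw [sub_mul, h4] at h1
    have h2 : s = algebraMap ℝ _ lam * 4 := by linear_combination -h1
    intro b d
    rw [h3, h2]
    algebra
  · intro h b d
    rw [hc _ h, h]
    algebra

end Fields

section
variable {R : Type*} [CommRing R] [Algebra ℝ R] (D : Fin 4 → Derivation ℝ R R)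
  (E : Matrix (Fin 4) (Fin 4) R) (l : R)

/-- The extrinsic curvature `χ^A_B`. -/
def chiMixed : Matrix (Fin 3) (Fin 3) R := leafInvM E * chiM D E

/-- The momentum constraint `D_A χ^A_C - D_C χ`. -/
def momentumM (C : Fin 3) : R :=
  diverg D (leafM E) (leafInvM E) (chiMixed D E) C - D C.succ (∑ A, chiMixed D E A A)

/-- The Hamiltonian constraint. -/
def hamiltonianM : R :=
  (∑ A, ∑ B, leafInvM E A B * ric (spatial D) (leafM E) (leafInvM E) A B)
    + (∑ A, chiMixed D E A A) ^ 2 - (∑ A, ∑ B, chiMixed D E A B * chiMixed D E B A) - 2 * l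

/-- The evolution equation of the extrinsic curvature. -/
def evolutionM (A B : Fin 3) : R :=
  delM D (shiftM E) (chiM D E) A B
    - E 0 0 * (ric (spatial D) (leafM E) (leafInvM E) A B
      + (∑ C, chiMixed D E C C) * chiM D E A B
      - 2 * (∑ C, chiM D E A C * chiMixed D E C B) - l * leafM E A B)
    + hess D (E 0 0) (leafM E) (leafInvM E) A B

variable {D E}

/-- The divergence of `T^A_C - δ^A_C s`. -/
theorem diverg_sub_smul_one (q qi T : Matrix (Fin 3) (Fin 3) R) (s : R) (C : Fin 3) :
    diverg D q qi (T - s • 1) C = diverg D q qi T C - D C.succ s := by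
  have h1 : ∀ A B : Fin 3, D B.succ ((T - s • 1) A C)
      = D B.succ (T A C) - if A = C then D B.succ s else 0 := fun A B => by
    rw [Matrix.sub_apply, Matrix.smul_apply, Matrix.one_apply]
    by_cases h : A = C <;> simp [h]
  simp only [diverg, h1]
  simp only [Matrix.sub_apply, Matrix.smul_apply, Matrix.one_apply, smul_eq_mul, mul_ite, mul_one,
    mul_zero, mul_sub, Finset.sum_sub_distrib, Finset.sum_add_distrib, Finset.sum_ite_eq,
    Finset.sum_ite_eq', Finset.mem_univ, if_true]
  ring

/-- The Lie derivative of the metric along `β` is the symmetrised covariant derivative of `β`. -/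
theorem lie_metric {q qi : Matrix (Fin 3) (Fin 3) R} (hq : q.transpose = q) (hqi : q * qi = 1)
    (β : Fin 3 → R) (A B : Fin 3) :
    (D A.succ (∑ E, q B E * β E) - ∑ C, chr (spatial D) q qi B C A * ∑ E, q C E * β E)
      + (D B.succ (∑ E, q A E * β E) - ∑ C, chr (spatial D) q qi A C B * ∑ E, q C E * β E)
      = ∑ C, (β C * D C.succ (q A B) + q C B * D A.succ (β C) + q A C * D B.succ (β C)) := by
  have hs : ∀ i j, q i j = q j i := fun i j => congrFun (congrFun hq j) i
  have hΓ : ∀ A B C, D C.succ (q A B) = ∑ E, chr (spatial D) q qi C E A * q E B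
      + ∑ E, q A E * chr (spatial D) q qi C E B := fun A B C => by
    have := congrFun (congrFun (chr_metric (D := spatial D) hq hqi C) A) B
    rwa [Matrix.add_apply, Matrix.mul_apply, Matrix.mul_apply] at this
  have hc := chr_symm (D := spatial D) (gi := qi) hq
  have hA : ∀ E, D A.succ (q B E) = ∑ F, chr (spatial D) q qi B F A * q F E
      + ∑ F, q B F * chr (spatial D) q qi E F A := fun E => by
    rw [hΓ]; simp only [hc _ B A, fun F => hc F E A]
  have hB : ∀ E, D B.succ (q A E) = ∑ F, chr (spatial D) q qi B F A * q F E
      + ∑ F, q A F * chr (spatial D) q qi E F B := fun E => by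
    rw [hΓ]; simp only [fun F => hc F E B]
  simp only [map_sum, Derivation.leibniz, smul_eq_mul, hA, hB, hΓ A B, hc _ B A]
  simp only [Fin.sum_univ_three, hs 0 B, hs 1 B, hs 2 B, hs 0 A, hs 1 A, hs 2 A, hs 1 0, hs 2 0,
    hs 2 1]
  ring

theorem ric_metricM_iff (h : IsAdapted E) (hD : ∀ μ ν f, D μ (D ν f) = D ν (D μ f)) :
    (∀ b d, ric D (metricM E) (metricInvM E) b d = l * metricM E b d) ↔
      (∀ C, momentumM D E C = 0) ∧ hamiltonianM D E l = 0 ∧ ∀ A B, evolutionM D E l A B = 0 := by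
  have hm : metricM E = admMetric (E 0 0) (shiftM E) (leafM E) := h.metric_eq
  have hg := metricM_mul_inv h.det
  rw [hm] at hg ⊢
  rw [(h.isADM hD).einstein_iff hg]
  refine and_congr Iff.rfl (and_congr ?_ (forall_congr' fun A => forall_congr' fun B => ?_))
  · rw [hamiltonianM, sub_eq_zero]; rfl
  · rw [evolutionM, ← sub_eq_zero (a := delM _ _ _ _ _)]
    refine Eq.congr_left ?_
    simp only [chiMixed]
    ring

theorem evolutionM_symm (h : IsAdapted E) (hD : ∀ μ ν f, D μ (D ν f) = D ν (D μ f)) (A B : Fin 3) :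
    evolutionM D E l A B = evolutionM D E l B A := by
  have hA := h.isADM hD
  have hχ : ∀ i j, chiM D E i j = chiM D E j i := fun i j => congrFun (congrFun hA.symm_chi j) i
  have hq : leafM E A B = leafM E B A := congrFun (congrFun hA.symm B) A
  have hsq := hA.square_symm A B
  simp only [hχ _ B] at hsq
  have hric := ric_symm (D := spatial D) (fun μ ν f => hD _ _ f) hA.symm hA.mul_inv A B
  rw [evolutionM, evolutionM, hric, hA.hess_symm A B, hχ A B, hq, chiMixed, hsq]
  congr 2
  simp only [delM, hχ A B, hχ A, hχ _ B]
  congr 2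
  funext C
  ring

end

namespace Fields

variable {U : Set Coord} {Φ : Fields} (hU : IsOpen U) (hs : Φ.SmoothOn U) (lam : ℝ)
  (ha : AdaptedOn Φ.e U)

include ha

theorem rep_divChi (C : Fin 3) : Rep (Φ.divChi C) (momentumM (der hU) (Φ.coframe hs) C) := by
  have hdd : ∀ (i : Fin 3) F (f : smoothAlg U), Rep F f → Rep (pdS i F) (spatial (der hU) i f) :=
    fun i F f h => h.pd hU i.succ
  have hA := isAdapted hs ha
  have hr := rep_raise (rep_leafMetric hs) hA.leaf_mul_inv (rep_chi hs ha hU)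
  have ht := rep_tr (rep_leafMetric hs) hA.leaf_mul_inv (rep_chi hs ha hU)
  have hT : ∀ A B, Rep (fun y => raise Φ.leafMetric Φ.chi A B y
      - (if A = B then tr Φ.leafMetric Φ.chi y else 0))
      ((chiMixed (der hU) (Φ.coframe hs)
        - (∑ A, chiMixed (der hU) (Φ.coframe hs) A A) • 1) A B) := fun A B => by
    rw [Matrix.sub_apply, Matrix.smul_apply, Matrix.one_apply]
    refine (hr A B).sub fun x => ?_
    by_cases hAB : A = B
    · simp only [hAB, if_true, smul_eq_mul, mul_one]; exact ht x
    · simp [hAB]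
  have h1 := rep_divMixed hdd (rep_leafMetric hs) hA.leaf_mul_inv hT C
  rw [momentumM, ← diverg_sub_smul_one]
  exact h1

theorem rep_hamiltonian : Rep (Φ.hamiltonian lam)
    (hamiltonianM (der hU) (Φ.coframe hs) (algebraMap ℝ _ lam)) := by
  have hdd : ∀ (i : Fin 3) F (f : smoothAlg U), Rep F f → Rep (pdS i F) (spatial (der hU) i f) :=
    fun i F f h => h.pd hU i.succ
  have hA := isAdapted hs ha
  have ht := rep_tr (rep_leafMetric hs) hA.leaf_mul_inv (rep_chi hs ha hU)
  have hn := rep_normSq (rep_leafMetric hs) hA.leaf_mul_inv (rep_chi hs ha hU)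
  have hsc := rep_scalarCurv hdd (rep_leafMetric hs) hA.leaf_mul_inv (hA.isADM (der_comm hU)).symm
  intro x
  rw [hamiltonian, hsc x, ht x, hn x, hamiltonianM, map_sub, map_sub, map_add, map_pow, map_mul,
    AlgHom.commutes, map_ofNat]
  rfl

theorem rep_evolution (A B : Fin 3) : Rep (Φ.evolution lam A B)
    (evolutionM (der hU) (Φ.coframe hs) (algebraMap ℝ _ lam) A B) := by
  have hdd : ∀ (i : Fin 3) F (f : smoothAlg U), Rep F f → Rep (pdS i F) (spatial (der hU) i f) :=
    fun i F f h => h.pd hU i.succ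
  have hA := isAdapted hs ha
  have hχ := rep_chi hs ha hU
  have ht := rep_tr (rep_leafMetric hs) hA.leaf_mul_inv hχ
  have hsq := rep_square (rep_leafMetric hs) hA.leaf_mul_inv hχ A B
  have hr := rep_ricci hdd (rep_leafMetric hs) hA.leaf_mul_inv (hA.isADM (der_comm hU)).symm A B
  have hh : Rep (hessian pdS Φ.leafMetric Φ.lapse A B) (hess (der hU) (Φ.coframe hs 0 0)
    (leafM (Φ.coframe hs)) (leafInvM (Φ.coframe hs)) A B) :=
    rep_hessian hdd (rep_leafMetric hs) hA.leaf_mul_inv (rep_lapse hs) A B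
  have hd := rep_deltaM hU (rep_shift hs ha) hχ A B
  intro x
  rw [evolution, hd x, hh x, hsq x, ht x, hr x, hχ A B x, rep_leafMetric hs A B x, rep_lapse hs x,
    evolutionM, map_add, map_sub, map_mul, map_sub, map_sub, map_add, map_mul, map_mul, map_mul,
    AlgHom.commutes, map_ofNat]
  rfl

include hU hs

/-- Einstein's equations are the momentum constraint, the Hamiltonian constraint and the evolution
equation of the extrinsic curvature. -/
theorem einsteinEquations_iff_adm : Φ.EinsteinEquations lam U ↔
    (∀ C, ∀ x ∈ U, Φ.divChi C x = 0) ∧ (∀ x ∈ U, Φ.hamiltonian lam x = 0) ∧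
      ∀ A B, ∀ x ∈ U, Φ.evolution lam A B x = 0 := by
  have hA := isAdapted hs ha
  rw [einsteinEquations_iff_ric hU hs lam hA.det, ric_metricM_iff _ hA (der_comm hU),
    rep_iff_forall (rep_divChi hU hs ha), rep_eq_zero_iff (rep_hamiltonian hU hs lam ha)]
  exact and_congr Iff.rfl (and_congr Iff.rfl (forall_congr' fun A => forall_congr' fun B =>
    rep_eq_zero_iff (rep_evolution hU hs lam ha A B)))

theorem evolution_symm (A B : Fin 3) : ∀ x ∈ U, Φ.evolution lam A B x = Φ.evolution lam B A x := by
  intro x hx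
  rw [rep_evolution hU hs lam ha A B ⟨x, hx⟩, rep_evolution hU hs lam ha B A ⟨x, hx⟩,
    evolutionM_symm _ (isAdapted hs ha) (der_comm hU)]

theorem admEquations_iff : ADMEquations lam U Φ.lapse Φ.shift Φ.leafMetric Φ.chi ↔
    (∀ C, ∀ x ∈ U, Φ.divChi C x = 0) ∧ (∀ x ∈ U, Φ.hamiltonian lam x = 0) ∧
      ∀ A B, ∀ x ∈ U, Φ.evolution lam A B x = 0 := by
  have hdd : ∀ (i : Fin 3) F (f : smoothAlg U), Rep F f → Rep (pdS i F) (spatial (der hU) i f) :=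
    fun i F f h => h.pd hU i.succ
  have hA := isAdapted hs ha
  have hADM := hA.isADM (der_comm hU)
  have hχ := rep_chi hs ha hU
  have hβ := rep_shift hs ha
  have hq := rep_leafMetric hs
  have hr := rep_raise hq hA.leaf_mul_inv hχ
  have ht := rep_tr hq hA.leaf_mul_inv hχ
  -- the evolution equation of the leaf metric is the definition of `χ`
  have hmet : ∀ x ∈ U, ∀ A B, pd 0 (Φ.leafMetric A B) x = -2 * Φ.lapse x * Φ.chi A B x
      + covDeriv1 pdS Φ.leafMetric (fun C y => ∑ D, Φ.leafMetric C D y * Φ.shift D y) A B x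
      + covDeriv1 pdS Φ.leafMetric (fun C y => ∑ D, Φ.leafMetric C D y * Φ.shift D y) B A x := by
    intro x hx A B
    have hlow : ∀ C, Rep (fun y => ∑ D, Φ.leafMetric C D y * Φ.shift D y)
        (∑ D, leafM (Φ.coframe hs) C D * shiftM (Φ.coframe hs) D) := fun C =>
      Rep.sum fun D => (hq C D).mul (hβ D)
    have hc := rep_covDeriv1 hdd hq hA.leaf_mul_inv hlow
    have h1 := lie_metric (D := der hU) hADM.symm hA.leaf_mul_inv (shiftM (Φ.coframe hs)) A B
    have h2 := hADM.evol A B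
    rw [delM, ← h1] at h2
    have h3 := congrArg (ev ⟨x, hx⟩) (sub_eq_iff_eq_add.1 h2)
    rw [map_add, map_add, map_mul, map_mul, map_neg, map_ofNat] at h3
    rw [(hq A B).pd hU 0 ⟨x, hx⟩, hc A B ⟨x, hx⟩, hc B A ⟨x, hx⟩, hχ A B ⟨x, hx⟩,
      rep_lapse hs ⟨x, hx⟩, h3, add_assoc]
    rfl
  have hdiv : ∀ C, ∀ x ∈ U, divMixed pdS Φ.leafMetric (raise Φ.leafMetric Φ.chi) C x
      - pdS C (tr Φ.leafMetric Φ.chi) x = Φ.divChi C x := by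
    intro C x hx
    rw [rep_divChi hU hs ha C ⟨x, hx⟩, momentumM, map_sub,
      rep_divMixed hdd hq hA.leaf_mul_inv hr C ⟨x, hx⟩, hdd C _ _ ht ⟨x, hx⟩]
    rfl
  have hev : ∀ A B x, (pd 0 (Φ.chi A B) x = -hessian pdS Φ.leafMetric Φ.lapse A B x
      + Φ.lapse x * (ricci pdS Φ.leafMetric A B x + tr Φ.leafMetric Φ.chi x * Φ.chi A B x
        - 2 * square Φ.leafMetric Φ.chi A B x - lam * Φ.leafMetric A B x)
      + ∑ C, (Φ.shift C x * pdS C (Φ.chi A B) x + Φ.chi C B x * pdS A (Φ.shift C) x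
        + Φ.chi A C x * pdS B (Φ.shift C) x)) ↔ Φ.evolution lam A B x = 0 := by
    intro A B x
    rw [evolution, deltaM]
    constructor <;> intro h <;> linear_combination h
  constructor
  · intro h
    refine ⟨fun C x hx => ?_, fun x hx => ?_, fun A B x hx => ?_⟩
    · rw [← hdiv C x hx]; exact (h x hx).2.2.2 C
    · rw [hamiltonian, (h x hx).2.2.1, sub_self]
    · exact (hev A B x).1 ((h x hx).2.1 A B)
  · rintro ⟨h1, h2, h3⟩ x hx
    refine ⟨hmet x hx, fun A B => (hev A B x).2 (h3 A B x hx), ?_, fun C => ?_⟩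
    · exact sub_eq_zero.1 (h2 x hx)
    · rw [hdiv C x hx]; exact h1 C x hx

end Fields

/-! ### Values of the Levi-Civita symbols -/

theorem eps3_values :
    eps3 0 1 2 = 1 ∧ eps3 0 2 1 = -1 ∧ eps3 1 0 2 = -1 ∧ eps3 1 2 0 = 1 ∧ eps3 2 0 1 = 1 ∧
    eps3 2 1 0 = -1 := by
  norm_num [eps3]

theorem eps4_values :
    eps4 0 1 2 3 = 1 ∧ eps4 0 1 3 2 = -1 ∧ eps4 0 2 1 3 = -1 ∧ eps4 0 2 3 1 = 1 ∧
    eps4 0 3 1 2 = 1 ∧ eps4 0 3 2 1 = -1 ∧ eps4 1 0 2 3 = -1 ∧ eps4 1 0 3 2 = 1 ∧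
    eps4 1 2 0 3 = 1 ∧ eps4 1 2 3 0 = -1 ∧ eps4 1 3 0 2 = -1 ∧ eps4 1 3 2 0 = 1 ∧
    eps4 2 0 1 3 = 1 ∧ eps4 2 0 3 1 = -1 ∧ eps4 2 1 0 3 = -1 ∧ eps4 2 1 3 0 = 1 ∧
    eps4 2 3 0 1 = 1 ∧ eps4 2 3 1 0 = -1 ∧ eps4 3 0 1 2 = -1 ∧ eps4 3 0 2 1 = 1 ∧
    eps4 3 1 0 2 = 1 ∧ eps4 3 1 2 0 = -1 ∧ eps4 3 2 0 1 = -1 ∧ eps4 3 2 1 0 = 1 := by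
  norm_num [eps4]

section
variable (a b : Fin 3)
theorem eps3_self₁₂ : eps3 a a b = 0 := by simp [eps3]
theorem eps3_self₁₃ : eps3 a b a = 0 := by simp [eps3]
theorem eps3_self₂₃ : eps3 b a a = 0 := by simp [eps3]
end

section
variable (a b c : Fin 4)
theorem eps4_self₁₂ : eps4 a a b c = 0 := by simp [eps4]
theorem eps4_self₁₃ : eps4 a b a c = 0 := by simp [eps4]
theorem eps4_self₁₄ : eps4 a b c a = 0 := by simp [eps4]
theorem eps4_self₂₃ : eps4 b a a c = 0 := by simp [eps4]
theorem eps4_self₂₄ : eps4 b a c a = 0 := by simp [eps4]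
theorem eps4_self₃₄ : eps4 b c a a = 0 := by simp [eps4]
end

/-! ### Torsion and the first Holst equation -/

/-- A skew vector-valued 2-form `T` with `T_a ∧ e_b = T_b ∧ e_a` for an invertible coframe
vanishes. -/
theorem eq_zero_of_wedge_symm {T : Fin 4 → Fin 4 → Fin 4 → ℝ} {e f : Fin 4 → Fin 4 → ℝ}
    (hT : ∀ a μ ν, T a μ ν = -T a ν μ)
    (hef : ∀ a b, ∑ μ, e a μ * f μ b = if a = b then 1 else 0)
    (hfe : ∀ μ ν, ∑ a, f μ a * e a ν = if μ = ν then 1 else 0)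
    (h : ∀ a b μ ν ρ, T a μ ν * e b ρ + T a ν ρ * e b μ + T a ρ μ * e b ν
      = T b μ ν * e a ρ + T b ν ρ * e a μ + T b ρ μ * e a ν) (a μ ν : Fin 4) : T a μ ν = 0 := by
  set t : Fin 4 → ℝ := fun ν => ∑ ρ, ∑ b, T b ν ρ * f ρ b with ht
  -- contract the hypothesis with `f^ρ_b`
  have key : ∀ a μ ν, T a μ ν = t ν * e a μ - t μ * e a ν := by
    intro a μ ν
    have h1 : ∑ ρ, ∑ b, (T a μ ν * e b ρ + T a ν ρ * e b μ + T a ρ μ * e b ν) * f ρ b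
        = ∑ ρ, ∑ b, (T b μ ν * e a ρ + T b ν ρ * e a μ + T b ρ μ * e a ν) * f ρ b :=
      Finset.sum_congr rfl fun ρ _ => Finset.sum_congr rfl fun b _ => by rw [h]
    have a1 : ∑ ρ, ∑ b, T a μ ν * e b ρ * f ρ b = T a μ ν * 4 := by
      rw [Finset.sum_congr rfl fun ρ _ => show ∑ b, T a μ ν * e b ρ * f ρ b = T a μ ν from by
        rw [Finset.sum_congr rfl fun b _ => show T a μ ν * e b ρ * f ρ b
          = T a μ ν * (f ρ b * e b ρ) by ring, ← Finset.mul_sum, hfe]; simp]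
      simp [mul_comm]
    have a2 : ∀ μ ν, ∑ ρ, ∑ b, T a ν ρ * e b μ * f ρ b = T a ν μ := by
      intro μ ν
      rw [Finset.sum_congr rfl fun ρ _ => show ∑ b, T a ν ρ * e b μ * f ρ b
          = T a ν ρ * if ρ = μ then 1 else 0 from by
        rw [Finset.sum_congr rfl fun b _ => show T a ν ρ * e b μ * f ρ b
          = T a ν ρ * (f ρ b * e b μ) by ring, ← Finset.mul_sum, hfe]]
      simp
    have a3 : ∑ ρ, ∑ b, T b μ ν * e a ρ * f ρ b = T a μ ν := by
      rw [Finset.sum_comm]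
      rw [Finset.sum_congr rfl fun b _ => show ∑ ρ, T b μ ν * e a ρ * f ρ b
          = T b μ ν * if a = b then 1 else 0 from by
        rw [Finset.sum_congr rfl fun ρ _ => show T b μ ν * e a ρ * f ρ b
          = T b μ ν * (e a ρ * f ρ b) by ring, ← Finset.mul_sum, hef]]
      simp
    have a4 : ∀ μ ν, ∑ ρ, ∑ b, T b ν ρ * e a μ * f ρ b = t ν * e a μ := by
      intro μ ν
      simp only [ht, Finset.sum_mul]
      exact Finset.sum_congr rfl fun ρ _ => Finset.sum_congr rfl fun b _ => by ring
    have a5 : ∑ ρ, ∑ b, T a ρ μ * e b ν * f ρ b = -T a μ ν := by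
      rw [← a2 ν μ, ← Finset.sum_neg_distrib]
      refine Finset.sum_congr rfl fun ρ _ => ?_
      rw [← Finset.sum_neg_distrib]
      exact Finset.sum_congr rfl fun b _ => by rw [hT a ρ μ]; ring
    have a6 : ∑ ρ, ∑ b, T b ρ μ * e a ν * f ρ b = -(t μ * e a ν) := by
      rw [← a4 ν μ, ← Finset.sum_neg_distrib]
      refine Finset.sum_congr rfl fun ρ _ => ?_
      rw [← Finset.sum_neg_distrib]
      exact Finset.sum_congr rfl fun b _ => by rw [hT b ρ μ]; ring
    simp only [add_mul, Finset.sum_add_distrib] at h1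
    rw [a1, a2, a3, a4, a5, a6, hT a ν μ] at h1
    linear_combination h1
  -- contract once more: `t = -3 t`
  have ht0 : ∀ μ, t μ = 0 := by
    intro μ
    have h1 : t μ = ∑ ρ, ∑ b, (t ρ * e b μ - t μ * e b ρ) * f ρ b :=
      Finset.sum_congr rfl fun ρ _ => Finset.sum_congr rfl fun b _ => by rw [key b μ ρ]
    have b1 : ∑ ρ, ∑ b, t ρ * e b μ * f ρ b = t μ := by
      rw [Finset.sum_congr rfl fun ρ _ => show ∑ b, t ρ * e b μ * f ρ b
          = t ρ * if ρ = μ then 1 else 0 from by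
        rw [Finset.sum_congr rfl fun b _ => show t ρ * e b μ * f ρ b
          = t ρ * (f ρ b * e b μ) by ring, ← Finset.mul_sum, hfe]]
      simp
    have b2 : ∑ ρ, ∑ b, t μ * e b ρ * f ρ b = t μ * 4 := by
      rw [Finset.sum_congr rfl fun ρ _ => show ∑ b, t μ * e b ρ * f ρ b = t μ from by
        rw [Finset.sum_congr rfl fun b _ => show t μ * e b ρ * f ρ b
          = t μ * (f ρ b * e b ρ) by ring, ← Finset.mul_sum, hfe]; simp]
      simp [mul_comm]
    simp only [sub_mul, Finset.sum_sub_distrib] at h1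
    rw [b1, b2] at h1
    linarith
  rw [key, ht0, ht0]; ring

namespace Fields

variable (γ : ℝ) (Φ : Fields)

/-- The torsion `T^a = de^a + ω^a_c ∧ e^c`. -/
def torsion (a : Fin 4) : Form2 :=
  d1 (Φ.e a) + ∑ c, eta c c • wedge11 (Φ.conn a c) (Φ.e c)

theorem torsion_skew (a μ ν : Fin 4) (x : Coord) : Φ.torsion a μ ν x = -Φ.torsion a ν μ x := by
  simp only [torsion, d1, wedge11, Pi.add_apply, Finset.sum_apply, Pi.smul_apply, smul_eq_mul,
    Fin.sum_univ_four]
  ring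

/-- The skew part `T^a ∧ e^b - T^b ∧ e^a`. -/
def torsionWedge (a b : Fin 4) : Form3 :=
  wedge21 (Φ.torsion a) (Φ.e b) - wedge21 (Φ.torsion b) (Φ.e a)

variable {U : Set Coord} {Φ}

theorem rep_B (hs : Φ.SmoothOn U) (a b μ ν : Fin 4) : Rep (Φ.B γ a b μ ν)
    ((∑ c, ∑ d, eps4 a b c d • (Φ.coframe hs c μ * Φ.coframe hs d ν
        - Φ.coframe hs c ν * Φ.coframe hs d μ))
      + (2 / γ) • ((eta a a • Φ.coframe hs a μ) * (eta b b • Φ.coframe hs b ν)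
        - (eta a a • Φ.coframe hs a ν) * (eta b b • Φ.coframe hs b μ))) := by
  intro x
  simp only [B, eLow, wedge11, Pi.add_apply, Finset.sum_apply, Pi.smul_apply, smul_eq_mul,
    map_add, map_sum, map_smul, map_sub, map_mul, rep_e hs _ _ x]

theorem pd_B (hU : IsOpen U) (hs : Φ.SmoothOn U) (a b μ ν ρ : Fin 4) {x : Coord} (hx : x ∈ U) :
    pd ρ (Φ.B γ a b μ ν) x =
      (∑ c, ∑ d, eps4 a b c d * (pd ρ (Φ.e c μ) x * Φ.e d ν x + Φ.e c μ x * pd ρ (Φ.e d ν) x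
        - pd ρ (Φ.e c ν) x * Φ.e d μ x - Φ.e c ν x * pd ρ (Φ.e d μ) x))
      + (2 / γ) * (eta a a * eta b b * (pd ρ (Φ.e a μ) x * Φ.e b ν x
        + Φ.e a μ x * pd ρ (Φ.e b ν) x
        - pd ρ (Φ.e a ν) x * Φ.e b μ x - Φ.e a ν x * pd ρ (Φ.e b μ) x)) := by
  rw [(rep_B γ hs a b μ ν).pd hU ρ ⟨x, hx⟩]
  have h1 : ∀ a μ, ev ⟨x, hx⟩ (Φ.coframe hs a μ) = Φ.e a μ x := fun a μ => (rep_e hs a μ _).symm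
  have h2 : ∀ a μ, ev ⟨x, hx⟩ (der hU ρ (Φ.coframe hs a μ)) = pd ρ (Φ.e a μ) x := fun a μ =>
    ((rep_e hs a μ).pd hU ρ _).symm
  simp only [map_add, map_sum, Derivation.map_smul, map_sub, Derivation.leibniz, smul_eq_mul,
    map_mul, map_smul, h1, h2]
  congr 1
  · exact Finset.sum_congr rfl fun c _ => Finset.sum_congr rfl fun d _ => by ring
  · ring

theorem B_skew (a b μ ν : Fin 4) (x : Coord) : Φ.B γ a b μ ν x = -Φ.B γ b a μ ν x := by
  have he : ∀ c d, eps4 a b c d = -eps4 b a c d := fun c d => by simp only [eps4]; ring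
  simp only [B, eLow, wedge11, Pi.add_apply, Finset.sum_apply, Pi.smul_apply, smul_eq_mul, he,
    neg_mul, Finset.sum_neg_distrib]
  ring

theorem pd_B_skew (a b μ ν ρ : Fin 4) (x : Coord) :
    pd ρ (Φ.B γ a b μ ν) x = -pd ρ (Φ.B γ b a μ ν) x := by
  have : Φ.B γ a b μ ν = -Φ.B γ b a μ ν := funext fun x => B_skew γ a b μ ν x
  rw [this, pd, fderiv_neg]
  rfl

set_option maxHeartbeats 1000000 in
theorem nablaB_eq_of_lt (hU : IsOpen U) (hs : Φ.SmoothOn U) {a b : Fin 4} (hab : a < b)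
    (μ ν ρ : Fin 4) {x : Coord} (hx : x ∈ U) : Φ.nablaB γ a b μ ν ρ x
      = (∑ c, ∑ d, eps4 a b c d * Φ.torsionWedge c d μ ν ρ x)
        + (2 / γ) * (eta a a * eta b b * Φ.torsionWedge a b μ ν ρ x) := by
  have hd : ∀ a μ, Φ.conn a a μ x = 0 := fun a μ => by linarith [Φ.skew a a μ x]
  simp only [nablaB, d2, wedge12, Pi.add_apply, Pi.sub_apply, Finset.sum_apply, Pi.smul_apply,
    smul_eq_mul, pd_B γ hU hs _ _ _ _ _ hx, torsionWedge, torsion, wedge21, d1]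
  simp only [B, eLow, wedge11, Pi.add_apply, Pi.sub_apply, Finset.sum_apply, Pi.smul_apply,
    smul_eq_mul]
  generalize 2 / γ = c
  generalize Φ.e = e
  have h10 := fun μ => Φ.skew 1 0 μ x
  have h20 := fun μ => Φ.skew 2 0 μ x
  have h30 := fun μ => Φ.skew 3 0 μ x
  have h21 := fun μ => Φ.skew 2 1 μ x
  have h31 := fun μ => Φ.skew 3 1 μ x
  have h32 := fun μ => Φ.skew 3 2 μ x
  generalize Φ.conn = w at *
  fin_cases a <;> fin_cases b <;>
    first
    | exact absurd hab (by decide)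
    | simp [Fin.sum_univ_four, eps4_values, eps4_self₁₂, eps4_self₁₃, eps4_self₁₄, eps4_self₂₃,
        eps4_self₂₄, eps4_self₃₄, eta, hd, h10, h20, h30, h21, h31, h32]
      ring

theorem nablaB_skew (a b μ ν ρ : Fin 4) (x : Coord) :
    Φ.nablaB γ a b μ ν ρ x = -Φ.nablaB γ b a μ ν ρ x := by
  simp only [nablaB, d2, wedge12, Pi.add_apply, Pi.sub_apply, Finset.sum_apply, Pi.smul_apply,
    smul_eq_mul, pd_B_skew γ a b, fun c μ ν => B_skew (Φ := Φ) γ a c μ ν x,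
    fun c μ ν => B_skew (Φ := Φ) γ c b μ ν x, Fin.sum_univ_four]
  ring

/-- The covariant derivative of `B` is a combination of the skew parts of `T ∧ e`. -/
theorem nablaB_eq (hU : IsOpen U) (hs : Φ.SmoothOn U) (a b μ ν ρ : Fin 4) {x : Coord}
    (hx : x ∈ U) : Φ.nablaB γ a b μ ν ρ x
      = (∑ c, ∑ d, eps4 a b c d * Φ.torsionWedge c d μ ν ρ x)
        + (2 / γ) * (eta a a * eta b b * Φ.torsionWedge a b μ ν ρ x) := by
  rcases lt_trichotomy a b with hab | rfl | hab
  · exact nablaB_eq_of_lt γ hU hs hab μ ν ρ hx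
  · have h1 := nablaB_skew (Φ := Φ) γ a a μ ν ρ x
    simp [eps4_self₁₂, torsionWedge]
    linarith
  · rw [nablaB_skew, nablaB_eq_of_lt γ hU hs hab μ ν ρ hx, neg_add, ← Finset.sum_neg_distrib]
    congr 1
    · refine Finset.sum_congr rfl fun c _ => ?_
      rw [← Finset.sum_neg_distrib]
      exact Finset.sum_congr rfl fun d _ => by simp only [eps4]; ring
    · simp only [torsionWedge, Pi.sub_apply]; ring

/-- The map `V ↦ ε V + (2/γ) V` on skew `V` is invertible, as `1 + γ² ≠ 0` for real `γ`. -/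
theorem torsionWedge_eq_zero (hγ : γ ≠ 0) (hU : IsOpen U) (hs : Φ.SmoothOn U) {x : Coord}
    (hx : x ∈ U) {μ ν ρ : Fin 4} (h0 : ∀ i : Fin 3, Φ.nablaB γ 0 i.succ μ ν ρ x = 0)
    (h1 : ∀ i : Fin 3, ∑ j : Fin 3, ∑ k : Fin 3, eps3 i j k * Φ.nablaB γ j.succ k.succ μ ν ρ x = 0)
    (a b : Fin 4) : Φ.torsionWedge a b μ ν ρ x = 0 := by
  have hsk : ∀ a b, Φ.torsionWedge a b μ ν ρ x = -Φ.torsionWedge b a μ ν ρ x := fun a b => by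
    simp [torsionWedge]
  have hd : ∀ a, Φ.torsionWedge a a μ ν ρ x = 0 := fun a => by simp [torsionWedge]
  simp only [nablaB_eq γ hU hs _ _ _ _ _ hx] at h0 h1
  generalize Φ.torsionWedge = V at *
  have hpos : 1 + γ ^ 2 ≠ 0 := by positivity
  have hc : γ * (2 / γ) = 2 := by field_simp
  have key : ∀ p q : ℝ, q + q + -(2 / γ * p) = 0 → p + p + 2 / γ * q = 0 → p = 0 ∧ q = 0 := by
    intro p q h h'
    have h2 : γ * q - p = 0 := by linear_combination (γ / 2) * h + (p / 2) * hc
    have h3 : γ * p + q = 0 := by linear_combination (γ / 2) * h' - (q / 2) * hc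
    constructor
    · exact (mul_eq_zero.1 (by linear_combination γ * h3 - h2 :
        (1 + γ ^ 2) * p = 0)).resolve_left hpos
    · exact (mul_eq_zero.1 (by linear_combination γ * h2 + h3 :
        (1 + γ ^ 2) * q = 0)).resolve_left hpos
  have e0 := h0 0
  have e1 := h0 1
  have e2 := h0 2
  have f0 := h1 0
  have f1 := h1 1
  have f2 := h1 2
  simp [Fin.sum_univ_four, Fin.sum_univ_three, eps3_values, eps3_self₁₂, eps3_self₁₃, eps3_self₂₃,
    eps4_values, eps4_self₁₂, eps4_self₁₃, eps4_self₁₄, eps4_self₂₃, eps4_self₂₄, eps4_self₃₄, eta,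
    hd, hsk 1 0, hsk 2 0, hsk 3 0, hsk 2 1, hsk 3 1, hsk 3 2] at e0 e1 e2 f0 f1 f2
  obtain ⟨z1, z23⟩ := key _ _ e0 (by linear_combination f0 / 2)
  obtain ⟨z2, z31⟩ := key (V 0 2 μ ν ρ x) (-V 1 3 μ ν ρ x) e1 (by linear_combination f1 / 2)
  obtain ⟨z3, z12⟩ := key _ _ e2 (by linear_combination f2 / 2)
  have z13 : V 1 3 μ ν ρ x = 0 := neg_eq_zero.1 z31
  fin_cases a <;> fin_cases b <;>
    simp [hd, hsk 1 0, hsk 2 0, hsk 3 0, hsk 2 1, hsk 3 1, hsk 3 2, z1, z2, z3, z12, z13, z23]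

/-- The torsion of a nondegenerate coframe is determined by the skew parts `T^a ∧ e^b - T^b ∧ e^a`. -/
theorem torsion_eq_zero_of_wedge (hdet : ∀ x ∈ U, (Matrix.of fun a μ => Φ.e a μ x).det ≠ 0)
    {x : Coord} (hx : x ∈ U) (h : ∀ a b μ ν ρ, Φ.torsionWedge a b μ ν ρ x = 0) (a μ ν : Fin 4) :
    Φ.torsion a μ ν x = 0 := by
  have hu := Ne.isUnit (hdet x hx)
  have h1 := Matrix.mul_nonsing_inv _ hu
  have h2 := Matrix.nonsing_inv_mul _ hu
  refine eq_zero_of_wedge_symm (T := fun a μ ν => Φ.torsion a μ ν x) (e := fun a μ => Φ.e a μ x)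
    (f := fun μ a => (Matrix.of fun a μ => Φ.e a μ x : Matrix (Fin 4) (Fin 4) ℝ)⁻¹ μ a)
    (fun a μ ν => Φ.torsion_skew a μ ν x)
    (fun a b => ?_) (fun μ ν => ?_) (fun a b μ ν ρ => ?_) a μ ν
  · have := congrFun (congrFun h1 a) b
    rw [Matrix.mul_apply, Matrix.one_apply] at this
    exact this
  · have := congrFun (congrFun h2 μ) ν
    rw [Matrix.mul_apply, Matrix.one_apply] at this
    exact this
  · exact sub_eq_zero.1 (h a b μ ν ρ)

/-- `K_i` is a boost component of `B`. -/
theorem K_eq (i : Fin 3) : Φ.K γ i = (1 / 2 : ℝ) • Φ.B γ 0 i.succ := by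
  funext μ ν x
  fin_cases i <;>
    simp [K, B, eLow, eS, wedge11, Fin.sum_univ_four, Fin.sum_univ_three, eps3_values, eps3_self₁₂,
      eps3_self₁₃, eps3_self₂₃, eps4_values, eps4_self₁₂, eps4_self₁₃, eps4_self₁₄, eps4_self₂₃,
      eps4_self₂₄, eps4_self₃₄, eta] <;> ring

/-- `L_i` is the dual of a rotation component of `B`. -/
theorem L_eq (i : Fin 3) :
    Φ.L γ i = (1 / 4 : ℝ) • ∑ j : Fin 3, ∑ k : Fin 3, eps3 i j k • Φ.B γ j.succ k.succ := by
  funext μ ν x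
  fin_cases i <;>
    simp [L, B, eLow, eS, wedge11, Fin.sum_univ_four, Fin.sum_univ_three, eps3_values, eps3_self₁₂,
      eps3_self₁₃, eps3_self₂₃, eps4_values, eps4_self₁₂, eps4_self₁₃, eps4_self₁₄, eps4_self₂₃,
      eps4_self₂₄, eps4_self₃₄, eta] <;> ring

end Fields

namespace Fields

variable (γ : ℝ) {U : Set Coord} {Φ : Fields}

theorem pd_L (hU : IsOpen U) (hs : Φ.SmoothOn U) (i : Fin 3) (c : ℝ) (μ ν ρ : Fin 4)
    {x : Coord} (hx : x ∈ U) : pd ρ ((Φ.L γ i + c • Φ.K γ i) μ ν) x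
      = (1 / 4) * (∑ j : Fin 3, ∑ k : Fin 3, eps3 i j k * pd ρ (Φ.B γ j.succ k.succ μ ν) x)
        + c * (1 / 2 * pd ρ (Φ.B γ 0 i.succ μ ν) x) := by
  obtain ⟨r, hr⟩ : ∃ r : Fin 4 → Fin 4 → smoothAlg U, ∀ a b, Rep (Φ.B γ a b μ ν) (r a b) :=
    ⟨_, fun a b => rep_B γ hs a b μ ν⟩
  have h1 : Rep ((Φ.L γ i + c • Φ.K γ i) μ ν)
      ((1 / 4 : ℝ) • (∑ j : Fin 3, ∑ k : Fin 3, eps3 i j k • r j.succ k.succ)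
        + c • ((1 / 2 : ℝ) • r 0 i.succ)) := fun y => by
    simp only [L_eq, K_eq, Pi.add_apply, Finset.sum_apply, Pi.smul_apply, smul_eq_mul, map_add,
      map_sum, map_smul, hr _ _ y]
  rw [h1.pd hU ρ ⟨x, hx⟩]
  simp only [map_add, map_sum, Derivation.map_smul, map_smul, smul_eq_mul, (hr _ _).pd hU ρ ⟨x, hx⟩]

theorem pd_K (hU : IsOpen U) (hs : Φ.SmoothOn U) (i : Fin 3) (c : ℝ) (μ ν ρ : Fin 4)
    {x : Coord} (hx : x ∈ U) : pd ρ ((Φ.K γ i - c • Φ.L γ i) μ ν) x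
      = 1 / 2 * pd ρ (Φ.B γ 0 i.succ μ ν) x
        - c * ((1 / 4) * (∑ j : Fin 3, ∑ k : Fin 3,
          eps3 i j k * pd ρ (Φ.B γ j.succ k.succ μ ν) x)) := by
  obtain ⟨r, hr⟩ : ∃ r : Fin 4 → Fin 4 → smoothAlg U, ∀ a b, Rep (Φ.B γ a b μ ν) (r a b) :=
    ⟨_, fun a b => rep_B γ hs a b μ ν⟩
  have h1 : Rep ((Φ.K γ i - c • Φ.L γ i) μ ν)
      ((1 / 2 : ℝ) • r 0 i.succ
        - c • ((1 / 4 : ℝ) • (∑ j : Fin 3, ∑ k : Fin 3, eps3 i j k • r j.succ k.succ))) :=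
    fun y => by
    simp only [L_eq, K_eq, Pi.sub_apply, Finset.sum_apply, Pi.smul_apply, smul_eq_mul, map_sub,
      map_sum, map_smul, hr _ _ y]
  rw [h1.pd hU ρ ⟨x, hx⟩]
  simp only [map_sub, map_sum, Derivation.map_smul, map_smul, smul_eq_mul, (hr _ _).pd hU ρ ⟨x, hx⟩]

/-- The first ABI equation is a combination of the rotation and boost components of `∇B`. -/
theorem field1_eq (hU : IsOpen U) (hs : Φ.SmoothOn U) (i : Fin 3) (μ ν ρ : Fin 4) {x : Coord}
    (hx : x ∈ U) : Φ.field1 γ i μ ν ρ x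
      = (1 / 4) * (∑ j : Fin 3, ∑ k : Fin 3, eps3 i j k * Φ.nablaB γ j.succ k.succ μ ν ρ x)
        + γ / 2 * Φ.nablaB γ 0 i.succ μ ν ρ x := by
  have hp := fun μ ν ρ i => pd_L γ hU hs i γ μ ν ρ hx
  simp only [Pi.add_apply, Pi.smul_apply] at hp
  simp only [field1, nabla2, d2, wedge12, Pi.add_apply, Pi.sub_apply, Finset.sum_apply,
    Pi.smul_apply, smul_eq_mul, hp]
  simp only [nablaB, d2, wedge12, L_eq, K_eq, A, barberoImmirzi, k, immirziTensor, Pi.add_apply,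
    Pi.sub_apply, Finset.sum_apply, Pi.smul_apply, smul_eq_mul]
  have hd : ∀ a μ, Φ.conn a a μ x = 0 := fun a μ => by linarith [Φ.skew a a μ x]
  have h10 := fun μ => Φ.skew 1 0 μ x
  have h20 := fun μ => Φ.skew 2 0 μ x
  have h30 := fun μ => Φ.skew 3 0 μ x
  have h21 := fun μ => Φ.skew 2 1 μ x
  have h31 := fun μ => Φ.skew 3 1 μ x
  have h32 := fun μ => Φ.skew 3 2 μ x
  have b := fun a b μ ν => B_skew (Φ := Φ) γ a b μ ν x
  have b' := fun a b μ ν ρ => pd_B_skew (Φ := Φ) γ a b μ ν ρ x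
  have bd : ∀ a μ ν, Φ.B γ a a μ ν x = 0 := fun a μ ν => by linarith [b a a μ ν]
  have bd' : ∀ a μ ν ρ, pd ρ (Φ.B γ a a μ ν) x = 0 := fun a μ ν ρ => by linarith [b' a a μ ν ρ]
  generalize Φ.B γ = B at *
  generalize Φ.conn = w at *
  fin_cases i <;>
    simp [Fin.sum_univ_four, Fin.sum_univ_three, eps3_values, eps3_self₁₂,
      eps3_self₁₃, eps3_self₂₃, eta, hd, h10, h20, h30, h21, h31, h32, b 1 0, b 2 0, b 3 0,
      b 2 1, b 3 1, b 3 2, b' 1 0, b' 2 0, b' 3 0, b' 2 1, b' 3 1, b' 3 2, bd, bd'] <;> ring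

/-- The second ABI equation is the complementary combination of these components. -/
theorem field2_eq (hU : IsOpen U) (hs : Φ.SmoothOn U) (i : Fin 3) (μ ν ρ : Fin 4) {x : Coord}
    (hx : x ∈ U) : Φ.field2 γ i μ ν ρ x
      = 1 / 2 * Φ.nablaB γ 0 i.succ μ ν ρ x
        - γ / 4 * (∑ j : Fin 3, ∑ k : Fin 3, eps3 i j k * Φ.nablaB γ j.succ k.succ μ ν ρ x) := by
  have hp := fun μ ν ρ i => pd_K γ hU hs i γ μ ν ρ hx
  simp only [Pi.sub_apply, Pi.smul_apply] at hp
  simp only [field2, nabla2, d2, wedge12, Pi.add_apply, Pi.sub_apply, Finset.sum_apply,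
    Pi.smul_apply, smul_eq_mul, hp]
  simp only [nablaB, d2, wedge12, L_eq, K_eq, A, barberoImmirzi, k, immirziTensor, Pi.add_apply,
    Pi.sub_apply, Finset.sum_apply, Pi.smul_apply, smul_eq_mul]
  have hd : ∀ a μ, Φ.conn a a μ x = 0 := fun a μ => by linarith [Φ.skew a a μ x]
  have h10 := fun μ => Φ.skew 1 0 μ x
  have h20 := fun μ => Φ.skew 2 0 μ x
  have h30 := fun μ => Φ.skew 3 0 μ x
  have h21 := fun μ => Φ.skew 2 1 μ x
  have h31 := fun μ => Φ.skew 3 1 μ x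
  have h32 := fun μ => Φ.skew 3 2 μ x
  have b := fun a b μ ν => B_skew (Φ := Φ) γ a b μ ν x
  have b' := fun a b μ ν ρ => pd_B_skew (Φ := Φ) γ a b μ ν ρ x
  have bd : ∀ a μ ν, Φ.B γ a a μ ν x = 0 := fun a μ ν => by linarith [b a a μ ν]
  have bd' : ∀ a μ ν ρ, pd ρ (Φ.B γ a a μ ν) x = 0 := fun a μ ν ρ => by linarith [b' a a μ ν ρ]
  generalize Φ.B γ = B at *
  generalize Φ.conn = w at *
  fin_cases i <;>
    simp [Fin.sum_univ_four, Fin.sum_univ_three, eps3_values, eps3_self₁₂,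
      eps3_self₁₃, eps3_self₂₃, eta, hd, h10, h20, h30, h21, h31, h32, b 1 0, b 2 0, b 3 0,
      b 2 1, b 3 1, b 3 2, b' 1 0, b' 2 0, b' 3 0, b' 2 1, b' 3 1, b' 3 2, bd, bd'] <;> ring

/-- The first Holst equation and the first two field equations in ABI variables all say that the
torsion vanishes. -/
theorem torsion_tfae (hγ : γ ≠ 0) (hU : IsOpen U) (hs : Φ.SmoothOn U)
    (hdet : ∀ x ∈ U, (Matrix.of fun a μ => Φ.e a μ x).det ≠ 0) :
    List.TFAE [∀ a b μ ν ρ, ∀ x ∈ U, Φ.nablaB γ a b μ ν ρ x = 0,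
      ∀ i μ ν ρ, ∀ x ∈ U, Φ.field1 γ i μ ν ρ x = 0 ∧ Φ.field2 γ i μ ν ρ x = 0,
      ∀ a μ ν, ∀ x ∈ U, Φ.torsion a μ ν x = 0] := by
  tfae_have 1 → 2 := fun h i μ ν ρ x hx => by
    rw [field1_eq γ hU hs i μ ν ρ hx, field2_eq γ hU hs i μ ν ρ hx]
    simp only [h _ _ μ ν ρ x hx, mul_zero, Finset.sum_const_zero, add_zero, sub_zero, and_self]
  tfae_have 2 → 3 := fun h a μ ν x hx => by
    refine torsion_eq_zero_of_wedge hdet hx (fun a b μ ν ρ => ?_) a μ ν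
    have hpos : 1 + γ ^ 2 ≠ 0 := by positivity
    have key : ∀ i, Φ.nablaB γ 0 (Fin.succ i) μ ν ρ x = 0 ∧ ∑ j : Fin 3, ∑ k : Fin 3,
        eps3 i j k * Φ.nablaB γ j.succ k.succ μ ν ρ x = 0 := fun i => by
      obtain ⟨h1, h2⟩ := h i μ ν ρ x hx
      rw [field1_eq γ hU hs i μ ν ρ hx] at h1
      rw [field2_eq γ hU hs i μ ν ρ hx] at h2
      constructor
      · refine (mul_eq_zero.1 (?_ : (1 + γ ^ 2) * _ = 0)).resolve_left hpos
        linear_combination 2 * γ * h1 + 2 * h2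
      · refine (mul_eq_zero.1 (?_ : (1 + γ ^ 2) * _ = 0)).resolve_left hpos
        linear_combination 4 * h1 - 4 * γ * h2
    exact torsionWedge_eq_zero γ hγ hU hs hx (fun i => (key i).1) (fun i => (key i).2) a b
  tfae_have 3 → 1 := fun h a b μ ν ρ x hx => by
    rw [nablaB_eq γ hU hs a b μ ν ρ hx]
    have h0 : ∀ a b, Φ.torsionWedge a b μ ν ρ x = 0 := fun a b => by
      simp only [torsionWedge, wedge21, Pi.sub_apply, h _ _ _ x hx, zero_mul, add_zero, sub_zero]
    simp only [h0, mul_zero, Finset.sum_const_zero, add_zero]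
  tfae_finish

end Fields

/-! ### The Levi-Civita connection of a coframe -/

section
variable {R : Type*} [CommRing R] [Algebra ℝ R] (D : Fin 4 → Derivation ℝ R R)
  (E : Matrix (Fin 4) (Fin 4) R)

/-- The Levi-Civita connection `ω^a_b` in the coframe `E`. -/
def leviM (μ : Fin 4) : Matrix (Fin 4) (Fin 4) R :=
  E * (chr D (metricM E) (metricInvM E) μ * E⁻¹ + E⁻¹.map (D μ))

theorem leviM_spec (h : IsUnit E.det) (μ : Fin 4) :
    E.map (D μ) = E * chr D (metricM E) (metricInvM E) μ - leviM D E μ * E := by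
  have h1 := Matrix.nonsing_inv_mul _ h
  have h2 := Matrix.mul_nonsing_inv _ h
  have h3 := map_derivation_inverse (D μ) h1
  have h4 : E⁻¹.map (D μ) * E = -(E⁻¹ * E.map (D μ)) := by rw [h3, neg_neg]
  rw [leviM, mul_assoc, add_mul, mul_assoc, h1, mul_one, h4, mul_add, mul_neg, ← mul_assoc, h2,
    one_mul]
  abel

theorem etaM_map (μ : Fin 4) : (etaM R).map (D μ) = 0 := by
  ext a b
  refine Fin.cases ?_ (fun A => ?_) a <;> refine Fin.cases ?_ (fun B => ?_) b <;>
  simp [etaM, blk_zero_zero, blk_zero_succ, blk_succ_zero, blk_succ_succ, Matrix.one_apply,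
    apply_ite]

theorem etaM_eq : etaM R = Matrix.of fun a b => eta a b • (1 : R) := by
  ext a b
  refine Fin.cases ?_ (fun A => ?_) a <;> refine Fin.cases ?_ (fun B => ?_) b <;>
    simp [etaM, eta, blk_zero_zero, blk_zero_succ, blk_succ_zero, blk_succ_succ,
      Fin.succ_ne_zero, (Fin.succ_ne_zero _).symm, Matrix.one_apply]

theorem eta_ne {a b : Fin 4} (h : a ≠ b) : eta a b = 0 := by simp [eta, h]

theorem eta_mul_self (a : Fin 4) : eta a a * eta a a = 1 := by
  by_cases h : a = 0 <;> simp [eta, h]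

/-- The Minkowski form is preserved iff the connection with both indices up is skew. -/
theorem metric_etaM_iff (w : Matrix (Fin 4) (Fin 4) R) :
    w.transpose * etaM R + etaM R * w = 0 ↔ ∀ a b, eta b b • w a b = -(eta a a • w b a) := by
  have h1 : ∀ a b, (w.transpose * etaM R + etaM R * w) a b = eta b b • w b a + eta a a • w a b := by
    intro a b
    rw [Matrix.add_apply, Matrix.mul_apply, Matrix.mul_apply, etaM_eq,
      Finset.sum_eq_single b, Finset.sum_eq_single a]
    · simp
    · intro c _ hc; simp [eta_ne hc.symm]
    · simp
    · intro c _ hc; simp [eta_ne hc]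
    · simp
  have h2 : ∀ a, eta a a = 1 ∨ eta a a = -1 := fun a => mul_self_eq_one_iff.1 (eta_mul_self a)
  have h3 : ∀ a b, (eta b b • w b a + eta a a • w a b = 0) ↔
      eta b b • w a b = -(eta a a • w b a) := by
    intro a b
    rw [← add_eq_zero_iff_eq_neg]
    rcases h2 a with ha | ha <;> rcases h2 b with hb | hb <;> rw [ha, hb]
    · rw [add_comm]
    · rw [← neg_eq_zero]; simp [add_comm]
    · rw [← neg_eq_zero]; simp [add_comm]
    · rw [add_comm]
  simp only [← h3, ← h1]
  exact ⟨fun h a b => by rw [h]; rfl, fun h => Matrix.ext h⟩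

variable {D E} in
theorem leviM_metric (h : IsUnit E.det) (μ : Fin 4) :
    (leviM D E μ).transpose * etaM R + etaM R * leviM D E μ = 0 := by
  rw [← frame_metric (gi := metricInvM E) (Matrix.mul_nonsing_inv _ h) etaM_transpose
    (metricM_mul_inv h) (leviM_spec D E h), etaM_map]

end

namespace Fields

variable {U : Set Coord} {Φ : Fields} (hU : IsOpen U) (hs : Φ.SmoothOn U)

/-- The connection `ω^a_b` over the smooth functions on `U`. -/
def connM (hs : Φ.SmoothOn U) (μ : Fin 4) : Matrix (Fin 4) (Fin 4) (smoothAlg U) :=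
  Matrix.of fun a b => eta b b • toAlg (Φ.conn a b μ) (hs.2 a b μ)

theorem rep_conn (a b μ : Fin 4) : Rep (Φ.conn a b μ) (eta b b • Φ.connM hs μ a b) := by
  rw [connM, Matrix.of_apply, smul_smul, eta_mul_self, one_smul]
  exact rep_toAlg _ (hs.2 a b μ)

theorem rep_torsion (a μ ν : Fin 4) : Rep (Φ.torsion a μ ν)
    (((Φ.coframe hs).map (der hU μ) + Φ.connM hs μ * Φ.coframe hs) a ν
      - ((Φ.coframe hs).map (der hU ν) + Φ.connM hs ν * Φ.coframe hs) a μ) := by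
  intro x
  have h1 : ∀ a b μ, ev x (Φ.connM hs μ a b) = eta b b * Φ.conn a b μ x := fun a b μ => by
    rw [connM, Matrix.of_apply, map_smul, ← rep_toAlg _ (hs.2 a b μ) x, smul_eq_mul]
  simp only [torsion, d1, wedge11, Pi.add_apply, Finset.sum_apply, Pi.smul_apply, smul_eq_mul,
    Matrix.add_apply, Matrix.map_apply, Matrix.mul_apply, map_add, map_sub, map_sum, map_mul, h1,
    ← rep_e hs _ _ x, (rep_e hs _ _).pd hU _ x, mul_sub, Finset.sum_sub_distrib]
  simp only [mul_assoc]
  ring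

theorem rep_frame (hE : IsUnit (Φ.coframe hs).det) (a μ : Fin 4) :
    Rep (Φ.frame a μ) ((Φ.coframe hs)⁻¹ μ a) :=
  rep_matrixInv (F := fun x => Matrix.of fun b ν => Φ.e b ν x) (fun a μ => rep_e hs a μ)
    (Matrix.mul_nonsing_inv _ hE) μ a

theorem rep_spinLC (hE : IsUnit (Φ.coframe hs).det) (a b μ : Fin 4) :
    Rep (Φ.spinLC a b μ) (eta b b • leviM (der hU) (Φ.coframe hs) μ a b) := by
  have hdd : ∀ i F (f : smoothAlg U), Rep F f → Rep (pd i F) (der hU i f) :=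
    fun i F f h => h.pd hU i
  have hF := rep_frame hs hE
  have h1 : eta b b • leviM (der hU) (Φ.coframe hs) μ a b = ∑ α, Φ.coframe hs a α *
      ((∑ β, chr (der hU) (metricM (Φ.coframe hs)) (metricInvM (Φ.coframe hs)) μ α β
        * (eta b b • (Φ.coframe hs)⁻¹ β b)) + der hU μ (eta b b • (Φ.coframe hs)⁻¹ α b)) := by
    simp only [leviM, Matrix.mul_apply, Matrix.add_apply, Matrix.map_apply, Finset.smul_sum,
      Derivation.map_smul, mul_smul_comm, ← Finset.smul_sum, ← smul_add]
  rw [h1]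
  exact Rep.sum fun α => (rep_e hs a α).mul ((Rep.sum fun β =>
    (rep_christoffel hdd (rep_metric hs) (metricM_mul_inv hE) α β μ).mul
      ((hF b β).const_mul _)).add (((hF b α).const_mul _).pd hU μ))

include hU in
theorem spinLC_skew (hE : IsUnit (Φ.coframe hs).det) (a b μ : Fin 4) {x : Coord} (hx : x ∈ U) :
    Φ.spinLC a b μ x = -Φ.spinLC b a μ x := by
  rw [rep_spinLC hU hs hE a b μ ⟨x, hx⟩, rep_spinLC hU hs hE b a μ ⟨x, hx⟩,
    (metric_etaM_iff _).1 (leviM_metric hE μ) a b, map_neg]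

theorem connM_metric (μ : Fin 4) :
    (Φ.connM hs μ).transpose * etaM (smoothAlg U) + etaM (smoothAlg U) * Φ.connM hs μ = 0 :=
  (metric_etaM_iff _).2 fun a b => (rep_conn hs a b μ).unique fun x => by
    rw [Φ.skew, rep_conn hs b a μ x, map_neg]

theorem isLeviCivita_iff_connM (hE : IsUnit (Φ.coframe hs).det) :
    Φ.IsLeviCivita U ↔ ∀ μ, Φ.connM hs μ = leviM (der hU) (Φ.coframe hs) μ := by
  constructor
  · intro h μ
    refine Matrix.ext fun a b => ?_
    have h1 : eta b b • Φ.connM hs μ a b = eta b b • leviM (der hU) (Φ.coframe hs) μ a b :=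
      (rep_conn hs a b μ).unique fun x => by
        rw [h a b μ x x.2]; exact rep_spinLC hU hs hE a b μ x
    have h2 := congrArg (fun y => eta b b • y) h1
    simp only [smul_smul, eta_mul_self, one_smul] at h2
    exact h2
  · intro h a b μ x hx
    rw [rep_conn hs a b μ ⟨x, hx⟩, rep_spinLC hU hs hE a b μ ⟨x, hx⟩, h]

include hU in
/-- The spin connection of the frame is the only torsion-free one. -/
theorem torsion_eq_zero_iff (hE : IsUnit (Φ.coframe hs).det) :
    (∀ a μ ν, ∀ x ∈ U, Φ.torsion a μ ν x = 0) ↔ Φ.IsLeviCivita U := by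
  rw [isLeviCivita_iff_connM hU hs hE]
  simp only [← rep_eq_zero_iff (rep_torsion hU hs _ _ _), sub_eq_zero]
  constructor
  · intro h μ
    have h1 := frame_levi_civita (gi := metricInvM (Φ.coframe hs)) (Matrix.nonsing_inv_mul _ hE)
      etaM_transpose (mul_eq_one_comm.1 (metricM_mul_inv hE)) h
      (fun μ => by rw [connM_metric, etaM_map]) μ
    rw [leviM_spec _ _ hE] at h1
    have h2 : leviM (der hU) (Φ.coframe hs) μ * Φ.coframe hs = Φ.connM hs μ * Φ.coframe hs :=
      sub_right_injective h1
    have h3 := congrArg (fun M => M * (Φ.coframe hs)⁻¹) h2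
    simp only [mul_assoc, Matrix.mul_nonsing_inv _ hE, mul_one] at h3
    exact h3.symm
  · intro h a μ ν
    exact frame_torsion_free (metricM_symm) (fun μ => by rw [h]; exact leviM_spec _ _ hE μ) a μ ν

include hU in
/-- The ABI variables determine the connection. -/
theorem deviationsVanish_iff (hE : IsUnit (Φ.coframe hs).det) :
    Φ.DeviationsVanish U ↔ Φ.IsLeviCivita U := by
  constructor
  · intro h a b μ x hx
    have hz := fun i => (h i μ x hx).1
    have hh := fun i => (h i μ x hx).2
    have hc := fun a b => Φ.skew a b μ x
    have hl := fun a b => spinLC_skew hU hs hE a b μ hx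
    have hcd : ∀ a, Φ.conn a a μ x = 0 := fun a => by linarith [hc a a]
    have hld : ∀ a, Φ.spinLC a a μ x = 0 := fun a => by linarith [hl a a]
    have z0 := hz 0
    have z1 := hz 1
    have z2 := hz 2
    have h0 := hh 0
    have h1 := hh 1
    have h2 := hh 2
    simp [z, Fields.h, A, k, barberoImmirzi, immirziTensor, Fin.sum_univ_three, eps3_values,
      eps3_self₁₂, eps3_self₁₃, eps3_self₂₃, hc 2 1, hc 3 1, hc 3 2, hl 2 1, hl 3 1, hl 3 2]
      at z0 z1 z2 h0 h1 h2
    fin_cases a <;> fin_cases b <;>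
      simp [hcd, hld, hc 1 0, hc 2 0, hc 3 0, hc 2 1, hc 3 1, hc 3 2, hl 1 0, hl 2 0, hl 3 0,
        hl 2 1, hl 3 1, hl 3 2] <;> linarith
  · intro h i μ x hx
    simp [z, Fields.h, A, k, barberoImmirzi, immirziTensor, h _ _ μ x hx]

end Fields

/-! ### The Gauss constraint and the algebraic constraints -/

namespace Fields

variable {U : Set Coord} {Φ : Fields}

theorem triad_det_ne (ha : AdaptedOn Φ.e U) {x : Coord} (hx : x ∈ U) :
    (Matrix.of fun i A => Φ.triad i A x).det ≠ 0 := by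
  have h1 : IsAdapted (Matrix.of fun a μ => Φ.e a μ x) := ⟨(ha x hx).1, ((ha x hx).2).isUnit⟩
  exact h1.isUnit_triad.ne_zero

theorem lapse_ne (ha : AdaptedOn Φ.e U) {x : Coord} (hx : x ∈ U) : Φ.lapse x ≠ 0 := by
  have h1 : IsAdapted (Matrix.of fun a μ => Φ.e a μ x) := ⟨(ha x hx).1, ((ha x hx).2).isUnit⟩
  exact h1.isUnit_lapse.ne_zero

theorem rep_densTriad (hs : Φ.SmoothOn U) (A i : Fin 3) : Rep (Φ.densTriad A i)
    ((1 / 2 : ℝ) • ∑ B : Fin 3, ∑ C : Fin 3, ∑ j : Fin 3, ∑ l : Fin 3, (eps3 A B C * eps3 i j l) •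
      (Φ.coframe hs j.succ B.succ * Φ.coframe hs l.succ C.succ)) := by
  intro x
  simp only [densTriad, triad, map_smul, map_sum, map_mul, smul_eq_mul, rep_e hs _ _ x, mul_assoc]

theorem pdS_densTriad (hU : IsOpen U) (hs : Φ.SmoothOn U) (A i D : Fin 3) {x : Coord} (hx : x ∈ U) :
    pdS D (Φ.densTriad A i) x = (1 / 2) * ∑ B : Fin 3, ∑ C : Fin 3, ∑ j : Fin 3, ∑ l : Fin 3,
      eps3 A B C * eps3 i j l * (Φ.e j.succ B.succ x * pd D.succ (Φ.e l.succ C.succ) x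
        + Φ.e l.succ C.succ x * pd D.succ (Φ.e j.succ B.succ) x) := by
  rw [pdS, (rep_densTriad hs A i).pd hU D.succ ⟨x, hx⟩]
  simp only [Derivation.map_smul, map_smul, map_sum, map_add, map_mul, Derivation.leibniz,
    smul_eq_mul, ← (rep_e hs _ _).pd hU _ ⟨x, hx⟩, ← rep_e hs _ _ ⟨x, hx⟩]

/-- The Gauss constraint is the tangential part of the torsion: `DE_i = ε_{ijk} T^j ∧ e^k`. -/
theorem gauss_eq (hU : IsOpen U) (hs : Φ.SmoothOn U) (ha : AdaptedOn Φ.e U) (i : Fin 3) {x : Coord}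
    (hx : x ∈ U) : Φ.gauss i x = (1 / 2) * ∑ A : Fin 3, ∑ B : Fin 3, ∑ C : Fin 3, ∑ j : Fin 3,
      ∑ l : Fin 3, eps3 A B C * eps3 i j l * Φ.torsion j.succ A.succ B.succ x
        * Φ.e l.succ C.succ x := by
  have h0 := (ha x hx).1
  have h01 := h0 0
  have h02 := h0 1
  have h03 := h0 2
  simp only [gauss, pdS_densTriad hU hs _ _ _ hx, torsion, d1, wedge11, densTriad, triad, A,
    barberoImmirzi, Pi.add_apply, Finset.sum_apply, Pi.smul_apply, smul_eq_mul, zero_mul, add_zero]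
  have hd : ∀ a μ, Φ.conn a a μ x = 0 := fun a μ => by linarith [Φ.skew a a μ x]
  have h21 := fun μ => Φ.skew 2 1 μ x
  have h31 := fun μ => Φ.skew 3 1 μ x
  have h32 := fun μ => Φ.skew 3 2 μ x
  generalize Φ.conn = w at *
  generalize Φ.e = e at *
  simp at h01 h02 h03
  fin_cases i <;>
    simp [Fin.sum_univ_three, Fin.sum_univ_four, eps3_values, eps3_self₁₂,
      eps3_self₁₃, eps3_self₂₃, eta, hd, h21, h31, h32, h01, h02, h03] <;> ring

variable (Φ) in
/-- The coframe of `Φ` with its torsion-free spin connection (antisymmetrised, which makes no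
difference where the coframe is smooth and nondegenerate). -/
def levi : Fields where
  e := Φ.e
  conn := fun a b μ x => (Φ.spinLC a b μ x - Φ.spinLC b a μ x) / 2
  skew := fun a b μ _ => by ring

theorem levi_conn (hU : IsOpen U) (hs : Φ.SmoothOn U) (hE : IsUnit (Φ.coframe hs).det)
    (a b μ : Fin 4) {x : Coord} (hx : x ∈ U) : Φ.levi.conn a b μ x = Φ.spinLC a b μ x := by
  have := spinLC_skew hU hs hE a b μ hx
  simp only [levi]
  linarith

theorem levi_smooth (hU : IsOpen U) (hs : Φ.SmoothOn U) (hE : IsUnit (Φ.coframe hs).det) :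
    Φ.levi.SmoothOn U :=
  ⟨hs.1, fun a b μ => ((rep_spinLC hU hs hE a b μ).contDiffOn).congr fun _ hx =>
    levi_conn hU hs hE a b μ hx⟩

theorem gauss_levi (hU : IsOpen U) (hs : Φ.SmoothOn U) (ha : AdaptedOn Φ.e U) (i : Fin 3)
    {x : Coord} (hx : x ∈ U) : Φ.levi.gauss i x = 0 := by
  have hE := (isAdapted hs ha).det
  have hs' := levi_smooth hU hs hE
  have h1 : Φ.levi.IsLeviCivita U := fun a b μ _ hx => levi_conn hU hs hE a b μ hx
  have h2 := (torsion_eq_zero_iff hU hs' (isAdapted (Φ := Φ.levi) hs' ha).det).2 h1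
  rw [gauss_eq hU hs' ha i hx]
  simp [h2 _ _ _ x hx]

/-- `z` is the difference of the ABI connections of `Φ` and `Φ.levi`, whose Gauss constraints can
therefore be subtracted. -/
theorem z_eq (hU : IsOpen U) (hs : Φ.SmoothOn U) (hE : IsUnit (Φ.coframe hs).det) (i : Fin 3)
    (μ : Fin 4) {x : Coord} (hx : x ∈ U) : Φ.z i μ x = Φ.A i μ x - Φ.levi.A i μ x := by
  simp only [z, A, barberoImmirzi, Pi.sub_apply, Pi.add_apply, Finset.sum_apply, Pi.smul_apply,
    smul_eq_mul, levi_conn hU hs hE _ _ μ hx]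

/-- The Gauss constraint is the skew part of the tangential deviation of the connection. -/
theorem gauss_eq_tangent1 (hU : IsOpen U) (hs : Φ.SmoothOn U) (ha : AdaptedOn Φ.e U) (i : Fin 3)
    {x : Coord} (hx : x ∈ U) : Φ.gauss i x = ∑ D : Fin 3, Φ.triad i D x *
      ∑ A : Fin 3, ∑ B : Fin 3, eps3 D A B * Φ.tangent1 Φ.z A B x := by
  have hE := (isAdapted hs ha).det
  have h1 : Φ.gauss i x - Φ.levi.gauss i x = ∑ A : Fin 3, ∑ l : Fin 3, ∑ m : Fin 3,
      eps3 i l m * Φ.z m A.succ x * Φ.densTriad A l x := by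
    have hd : Φ.levi.densTriad = Φ.densTriad := rfl
    simp only [gauss, hd, z_eq hU hs hE _ _ hx, ← Finset.sum_sub_distrib, add_sub_add_left_eq_sub]
    refine Finset.sum_congr rfl fun _ _ => Finset.sum_congr rfl fun _ _ =>
      Finset.sum_congr rfl fun _ _ => by ring
  rw [gauss_levi hU hs ha i hx, sub_zero] at h1
  rw [h1]
  simp only [tangent1, densTriad]
  generalize Φ.z = z
  generalize Φ.triad = e
  fin_cases i <;>
    simp [Fin.sum_univ_three, eps3_values, eps3_self₁₂, eps3_self₁₃, eps3_self₂₃] <;> ring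

/-- A spacetime covector-valued field with vanishing tangent and normal projections vanishes. -/
theorem eq_zero_of_projections (ha : AdaptedOn Φ.e U) {x : Coord} (hx : x ∈ U) {a : Fin 3 → Form1}
    (ht : ∀ A B, Φ.tangent1 a A B x = 0) (hn : ∀ i, normal1 Φ.lapse Φ.shift (a i) x = 0)
    (i : Fin 3) (μ : Fin 4) : a i μ x = 0 := by
  have h1 : ∀ (A : Fin 3) (i : Fin 3), a i A.succ x = 0 := fun A i => by
    have := Matrix.eq_zero_of_vecMul_eq_zero (v := fun i => a i A.succ x) (triad_det_ne ha hx)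
      (funext fun B => ht A B)
    exact congrFun this i
  refine Fin.cases ?_ (fun A => h1 A i) μ
  have h2 := hn i
  simp only [normal1, h1, mul_zero, Finset.sum_const_zero, sub_zero] at h2
  exact (div_eq_zero_iff.1 h2).resolve_right (lapse_ne ha hx)

/-- The Gauss constraint kills the skew part of `z_{AB}`, the algebraic constraints everything
else. -/
theorem gauss_and_algConstraint_iff (hU : IsOpen U) (hs : Φ.SmoothOn U) (ha : AdaptedOn Φ.e U) :
    ((∀ i, ∀ x ∈ U, Φ.gauss i x = 0) ∧ (∀ i, ∀ x ∈ U, Φ.algConstraint i x = 0)) ↔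
      Φ.DeviationsVanish U := by
  constructor
  · rintro ⟨hg, hc⟩ i μ x hx
    -- extend the constraints from the independent components to all index pairs
    have hsym : ∀ T : Fin 3 → Fin 3 → ℝ, (∀ p : SymIdx, (T p.1.1 p.1.2 + T p.1.2 p.1.1) / 2 = 0) →
        ∀ A B, T A B = -T B A := fun T h A B => by
      rcases le_total A B with hAB | hAB
      · linarith [h ⟨(A, B), hAB⟩]
      · linarith [h ⟨(B, A), hAB⟩]
    have hskew : ∀ T : Fin 3 → Fin 3 → ℝ, (∀ p : SkewIdx, (T p.1.1 p.1.2 - T p.1.2 p.1.1) / 2 = 0) →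
        ∀ A B, T A B = T B A := fun T h A B => by
      rcases lt_trichotomy A B with hAB | hAB | hAB
      · linarith [h ⟨(A, B), hAB⟩]
      · rw [hAB]
      · linarith [h ⟨(B, A), hAB⟩]
    have z1 : ∀ A B, Φ.tangent1 Φ.z A B x = -Φ.tangent1 Φ.z B A x :=
      hsym (fun A B => Φ.tangent1 Φ.z A B x) fun p => hc (.inl p) x hx
    have z2 : ∀ i, normal1 Φ.lapse Φ.shift (Φ.z i) x = 0 := fun i => hc (.inr (.inl i)) x hx
    have h1 : ∀ A B, Φ.tangent1 Φ.h A B x = Φ.tangent1 Φ.h B A x :=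
      hskew (fun A B => Φ.tangent1 Φ.h A B x) fun p => hc (.inr (.inr (.inl p))) x hx
    have h2 : ∀ A B, Φ.tangent1 Φ.h A B x = -Φ.tangent1 Φ.h B A x :=
      hsym (fun A B => Φ.tangent1 Φ.h A B x) fun p => hc (.inr (.inr (.inr (.inl p)))) x hx
    have h3 : ∀ i, normal1 Φ.lapse Φ.shift (Φ.h i) x = 0 := fun i =>
      hc (.inr (.inr (.inr (.inr i)))) x hx
    refine ⟨eq_zero_of_projections ha hx ?_ z2 i μ, eq_zero_of_projections ha hx ?_ h3 i μ⟩
    · have h4 := Matrix.eq_zero_of_mulVec_eq_zero (triad_det_ne ha hx)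
        (v := fun D => ∑ A : Fin 3, ∑ B : Fin 3, eps3 D A B * Φ.tangent1 Φ.z A B x)
        (funext fun i => (gauss_eq_tangent1 hU hs ha i hx).symm.trans (hg i x hx))
      generalize Φ.tangent1 Φ.z = Z at *
      have e0 := congrFun h4 0
      have e1 := congrFun h4 1
      have e2 := congrFun h4 2
      simp [Fin.sum_univ_three, eps3_values, eps3_self₁₂, eps3_self₁₃, eps3_self₂₃] at e0 e1 e2
      intro A B
      fin_cases A <;> fin_cases B <;> simp <;>
        linarith [z1 0 0, z1 1 1, z1 2 2, z1 0 1, z1 0 2, z1 1 2]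
    · intro A B
      have := h1 A B
      have := h2 A B
      linarith
  · intro h
    have h1 := (deviationsVanish_iff hU hs (isAdapted hs ha).det).1 h
    have h2 := (torsion_eq_zero_iff hU hs (isAdapted hs ha).det).2 h1
    refine ⟨fun i x hx => ?_, fun i x hx => ?_⟩
    · rw [gauss_eq hU hs ha i hx]
      simp [h2 _ _ _ x hx]
    · rcases i with p | i | p | p | i <;>
        simp [algConstraint, tangent1, normal1, (h _ _ x hx).1, (h _ _ x hx).2]

end Fields

/-! ### The second Holst equation in ABI variables -/

namespace Fields

variable (γ lam : ℝ) {U : Set Coord} (Φ : Fields)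

/-- The second Holst equation, left side minus right side. -/
def holst2 (d : Fin 4) : Form3 :=
  (∑ a, ∑ b, wedge21 (Φ.curvature a b)
      ((∑ c, eps4 a b c d • Φ.e c)
        + (2 / γ) • ((1 / 2 : ℝ) • (eta b d • Φ.eLow a - eta a d • Φ.eLow b))))
    - (lam / 3) • ∑ a, ∑ b, ∑ c, eps4 a b c d • wedge21 (wedge11 (Φ.e a) (Φ.e b)) (Φ.e c)

/-- `A^i` is `ω^{jk}` for cyclic `(i, j, k)`, as a function on `ℝ⁴`, so its derivatives are those of
the connection. -/
theorem A_zero : Φ.A 0 = Φ.conn 2 3 := by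
  funext μ x
  simp [A, barberoImmirzi, Fin.sum_univ_three, eps3_values, eps3_self₁₂, eps3_self₁₃, eps3_self₂₃,
    Φ.skew 3 2]; ring

theorem A_one : Φ.A 1 = Φ.conn 3 1 := by
  funext μ x
  simp [A, barberoImmirzi, Fin.sum_univ_three, eps3_values, eps3_self₁₂, eps3_self₁₃, eps3_self₂₃,
    Φ.skew 3 1]; ring

theorem A_two : Φ.A 2 = Φ.conn 1 2 := by
  funext μ x
  simp [A, barberoImmirzi, Fin.sum_univ_three, eps3_values, eps3_self₁₂, eps3_self₁₃, eps3_self₂₃,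
    Φ.skew 2 1]; ring

theorem pd_conn_skew (a b μ ν : Fin 4) (x : Coord) :
    pd ν (Φ.conn a b μ) x = -pd ν (Φ.conn b a μ) x := by
  have : Φ.conn a b μ = -Φ.conn b a μ := funext fun x => Φ.skew a b μ x
  rw [this, pd, fderiv_neg]
  rfl

theorem curvature_skew (a b μ ν : Fin 4) (x : Coord) :
    Φ.curvature a b μ ν x = -Φ.curvature b a μ ν x := by
  simp only [curvature, d1, wedge11, Pi.add_apply, Finset.sum_apply, Pi.smul_apply, smul_eq_mul,
    Φ.pd_conn_skew a b, Fin.sum_univ_four, Φ.skew a]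
  simp only [Φ.skew b]
  ring

/-- The boost part of the curvature is `∇k`. -/
theorem curvature_boost (i : Fin 3) : Φ.curvature 0 i.succ = nabla1 Φ.A Φ.k i := by
  funext μ ν x
  have hd : ∀ a μ, Φ.conn a a μ x = 0 := fun a μ => by linarith [Φ.skew a a μ x]
  have h31 := fun μ => Φ.skew 3 1 μ x
  have h21 := fun μ => Φ.skew 2 1 μ x
  have h32 := fun μ => Φ.skew 3 2 μ x
  fin_cases i <;>
    simp [curvature, nabla1, d1, wedge11, k, immirziTensor, A_zero, A_one, A_two,
      Fin.sum_univ_three, Fin.sum_univ_four, eps3_values, eps3_self₁₂, eps3_self₁₃, eps3_self₂₃,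
      eta, hd, h31, h21, h32] <;> ring

/-- The dual of the rotation part of the curvature is `F + ½ k ∧ k`. -/
theorem curvature_rot (i : Fin 3) : (1 / 2 : ℝ) • ∑ j : Fin 3, ∑ l : Fin 3,
    eps3 i j l • Φ.curvature j.succ l.succ
      = Φ.F i + (1 / 2 : ℝ) • ∑ j : Fin 3, ∑ l : Fin 3, eps3 i j l • wedge11 (Φ.k j) (Φ.k l) := by
  funext μ ν x
  have hd : ∀ a μ, Φ.conn a a μ x = 0 := fun a μ => by linarith [Φ.skew a a μ x]
  have h10 := fun μ => Φ.skew 1 0 μ x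
  have h20 := fun μ => Φ.skew 2 0 μ x
  have h30 := fun μ => Φ.skew 3 0 μ x
  have h31 := fun μ => Φ.skew 3 1 μ x
  have h21 := fun μ => Φ.skew 2 1 μ x
  have h32 := fun μ => Φ.skew 3 2 μ x
  have p31 := fun μ ν => Φ.pd_conn_skew 3 1 μ ν x
  have p21 := fun μ ν => Φ.pd_conn_skew 2 1 μ ν x
  have p32 := fun μ ν => Φ.pd_conn_skew 3 2 μ ν x
  fin_cases i <;>
    simp [curvature, F, curvF, d1, wedge11, k, immirziTensor, A_zero, A_one, A_two,
      Fin.sum_univ_three, Fin.sum_univ_four, eps3_values, eps3_self₁₂, eps3_self₁₃, eps3_self₂₃,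
      eta, hd, h31, h21, h32, p31, p21, p32, h10, h20, h30] <;> ring

theorem curvature_rot_apply (i : Fin 3) (μ ν : Fin 4) (x : Coord) :
    Φ.F i μ ν x = (1 / 2) * (∑ j : Fin 3, ∑ l : Fin 3,
      eps3 i j l * Φ.curvature j.succ l.succ μ ν x) - (1 / 2) * ∑ j : Fin 3, ∑ l : Fin 3,
        eps3 i j l * wedge11 (Φ.k j) (Φ.k l) μ ν x := by
  have := congrFun (congrFun (congrFun (Φ.curvature_rot i) μ) ν) x
  simp only [Pi.add_apply, Finset.sum_apply, Pi.smul_apply, smul_eq_mul] at this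
  linarith

/-- The time component of the second Holst equation is the third ABI equation. -/
theorem holst2_zero : Φ.holst2 γ lam 0 = (-2 : ℝ) • Φ.field3 γ lam := by
  funext μ ν ρ x
  have hF := fun i μ ν => Φ.curvature_rot_apply i μ ν x
  have hs := fun a b μ ν => Φ.curvature_skew a b μ ν x
  have hd : ∀ a μ ν, Φ.curvature a a μ ν x = 0 := fun a μ ν => by linarith [hs a a μ ν]
  simp only [holst2, field3, ← curvature_boost, wedge21, eS, eLow, Pi.sub_apply, Pi.add_apply,
    Finset.sum_apply, Pi.smul_apply, smul_eq_mul, hF]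
  generalize Φ.curvature = R at *
  generalize Φ.e = e
  generalize Φ.k = k
  simp [wedge11, Fin.sum_univ_three, Fin.sum_univ_four, eps3_values, eps3_self₁₂, eps3_self₁₃,
    eps3_self₂₃, eps4_values, eps4_self₁₂, eps4_self₁₃, eps4_self₁₄, eps4_self₂₃, eps4_self₂₄,
    eps4_self₃₄, eta, hd, hs 1 0, hs 2 0, hs 3 0, hs 2 1, hs 3 1, hs 3 2]
  ring

/-- The spatial components of the second Holst equation are the fourth ABI equation. -/
theorem holst2_succ (h : Fin 3) : Φ.holst2 γ lam h.succ = (2 : ℝ) • Φ.field4 γ lam h := by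
  funext μ ν ρ x
  have hF := fun i μ ν => Φ.curvature_rot_apply i μ ν x
  have hs := fun a b μ ν => Φ.curvature_skew a b μ ν x
  have hd : ∀ a μ ν, Φ.curvature a a μ ν x = 0 := fun a μ ν => by linarith [hs a a μ ν]
  simp only [holst2, field4, ← curvature_boost, wedge21, eS, eLow, Pi.sub_apply, Pi.add_apply,
    Finset.sum_apply, Pi.smul_apply, smul_eq_mul, hF]
  generalize Φ.curvature = R at *
  generalize Φ.e = e
  generalize Φ.k = k
  fin_cases h <;>
  simp [wedge11, Fin.sum_univ_three, Fin.sum_univ_four, eps3_values, eps3_self₁₂, eps3_self₁₃,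
    eps3_self₂₃, eps4_values, eps4_self₁₂, eps4_self₁₃, eps4_self₁₄, eps4_self₂₃, eps4_self₂₄,
    eps4_self₃₄, eta, hd, hs 1 0, hs 2 0, hs 3 0, hs 2 1, hs 3 1, hs 3 2] <;>
  ring

end Fields

/-! ### The second Holst equation and Einstein's equations -/

/-- A totally skew 3-index array in dimension four vanishes if four of its entries do. -/
theorem eq_zero_of_skew₃ {T : Fin 4 → Fin 4 → Fin 4 → ℝ} (h1 : ∀ p q r, T p q r = -T q p r)
    (h2 : ∀ p q r, T p q r = -T p r q) (h012 : T 0 1 2 = 0) (h013 : T 0 1 3 = 0)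
    (h023 : T 0 2 3 = 0) (h123 : T 1 2 3 = 0) (p q r : Fin 4) : T p q r = 0 := by
  have d1 : ∀ p r, T p p r = 0 := fun p r => by linarith [h1 p p r]
  have d2 : ∀ p r, T r p p = 0 := fun p r => by linarith [h2 r p p]
  have d3 : ∀ p r, T p r p = 0 := fun p r => by rw [h1, d2, neg_zero]
  have s : ∀ a b c, T a b c = 0 →
      T a c b = 0 ∧ T b a c = 0 ∧ T b c a = 0 ∧ T c a b = 0 ∧ T c b a = 0 := fun a b c h =>
    ⟨by rw [h2, h, neg_zero], by rw [h1, h, neg_zero], by rw [h2, h1, h]; simp,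
      by rw [h1, h2, h]; simp, by rw [h1, h2, h1, h]; simp⟩
  have a1 := s _ _ _ h012
  have a2 := s _ _ _ h013
  have a3 := s _ _ _ h023
  have a4 := s _ _ _ h123
  fin_cases p <;> fin_cases q <;> fin_cases r <;>
    simp only [Fin.zero_eta, Fin.mk_one, Fin.reduceFinMk, d1, d2, d3, h012, h013, h023, h123, a1,
      a2, a3, a4]

/-- In an orthonormal frame, `ε_{abcd} R^{ab} ∧ e^c = 2 Λ ε_{pqrd}` says that the Ricci tensor is
`Λ` times the metric. -/
theorem eps4_curvature_iff {r : Fin 4 → Fin 4 → Fin 4 → Fin 4 → ℝ} (l : ℝ)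
    (h1 : ∀ a b p q, r a b p q = -r b a p q) (h2 : ∀ a b p q, r a b p q = -r a b q p) :
    (∀ d p q s, ∑ a, ∑ b, (eps4 a b s d * r a b p q + eps4 a b p d * r a b q s
        + eps4 a b q d * r a b s p) - 2 * l * eps4 p q s d = 0) ↔
      ∀ c q, ∑ a, r a c a q = if c = q then l else 0 := by
  have d1 : ∀ a p q, r a a p q = 0 := fun a p q => by linarith [h1 a a p q]
  have d2 : ∀ a b p, r a b p p = 0 := fun a b p => by linarith [h2 a b p p]
  constructor
  · intro h
    have e := fun d => And.intro (h d 0 1 2) (And.intro (h d 0 1 3) (And.intro (h d 0 2 3)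
      (h d 1 2 3)))
    have e0 := e 0
    have e1 := e 1
    have e2 := e 2
    have e3 := e 3
    simp [Fin.sum_univ_four, eps4_values, eps4_self₁₂, eps4_self₁₃, eps4_self₁₄, eps4_self₂₃,
      eps4_self₂₄, eps4_self₃₄, h1 1 0, h1 2 0, h1 3 0, h1 2 1, h1 3 1, h1 3 2, h2 _ _ 1 0,
      h2 _ _ 2 0, h2 _ _ 3 0, h2 _ _ 2 1, h2 _ _ 3 1, h2 _ _ 3 2] at e0 e1 e2 e3
    obtain ⟨e00, e01, e02, e03⟩ := e0
    obtain ⟨e10, e11, e12, e13⟩ := e1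
    obtain ⟨e20, e21, e22, e23⟩ := e2
    obtain ⟨e30, e31, e32, e33⟩ := e3
    intro c q
    fin_cases c <;> fin_cases q <;>
      simp [Fin.sum_univ_four, d1, d2, h1 1 0, h1 2 0, h1 3 0, h1 2 1, h1 3 1, h1 3 2, h2 _ _ 1 0,
        h2 _ _ 2 0, h2 _ _ 3 0, h2 _ _ 2 1, h2 _ _ 3 1, h2 _ _ 3 2] <;> linarith
  · intro h d
    have e : ∀ c, _ := fun c => And.intro (h c 0) (And.intro (h c 1) (And.intro (h c 2) (h c 3)))
    have e0 := e 0
    have e1 := e 1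
    have e2 := e 2
    have e3 := e 3
    simp [Fin.sum_univ_four, d1, d2, h1 1 0, h1 2 0, h1 3 0, h1 2 1, h1 3 1, h1 3 2, h2 _ _ 1 0,
        h2 _ _ 2 0, h2 _ _ 3 0, h2 _ _ 2 1, h2 _ _ 3 1, h2 _ _ 3 2] at e0 e1 e2 e3
    obtain ⟨e00, e01, e02, e03⟩ := e0
    obtain ⟨e10, e11, e12, e13⟩ := e1
    obtain ⟨e20, e21, e22, e23⟩ := e2
    obtain ⟨e30, e31, e32, e33⟩ := e3
    refine eq_zero_of_skew₃ (fun p q s => ?_) (fun p q s => ?_) ?_ ?_ ?_ ?_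
    · have : eps4 p q s d = -eps4 q p s d := by simp only [eps4]; ring
      rw [this, neg_sub', ← Finset.sum_neg_distrib]
      simp only [← Finset.sum_neg_distrib]
      congr 1
      · exact Finset.sum_congr rfl fun a _ => Finset.sum_congr rfl fun b _ => by
          rw [h2 a b p q, h2 a b q s, h2 a b s p]; ring
      · ring
    · have : eps4 p q s d = -eps4 p s q d := by simp only [eps4]; ring
      rw [this, neg_sub', ← Finset.sum_neg_distrib]
      simp only [← Finset.sum_neg_distrib]
      congr 1
      · exact Finset.sum_congr rfl fun a _ => Finset.sum_congr rfl fun b _ => by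
          rw [h2 a b p q, h2 a b q s, h2 a b s p]; ring
      · ring
    all_goals
      fin_cases d <;>
      simp [Fin.sum_univ_four, eps4_values, eps4_self₁₂, eps4_self₁₃, eps4_self₁₄, eps4_self₂₃,
        eps4_self₂₄, eps4_self₃₄, h1 1 0, h1 2 0, h1 3 0, h1 2 1, h1 3 1, h1 3 2, h2 _ _ 1 0,
        h2 _ _ 2 0, h2 _ _ 3 0, h2 _ _ 2 1, h2 _ _ 3 1, h2 _ _ 3 2] <;> linarith

section Contraction

variable (f : Fin 4 → Fin 4 → ℝ)

/-- The components `α(f_p)` in the frame `f`. -/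
def contr₁ (α : Fin 4 → ℝ) (p : Fin 4) : ℝ := ∑ μ, α μ * f μ p

/-- The components `F(f_p, f_q)` in the frame `f`. -/
def contr₂ (F : Fin 4 → Fin 4 → ℝ) (p q : Fin 4) : ℝ := ∑ μ, ∑ ν, F μ ν * f μ p * f ν q

/-- The components `T(f_p, f_q, f_r)` in the frame `f`. -/
def contr₃ (T : Fin 4 → Fin 4 → Fin 4 → ℝ) (p q r : Fin 4) : ℝ :=
  ∑ μ, ∑ ν, ∑ ρ, T μ ν ρ * f μ p * f ν q * f ρ r

theorem contr₁_eq_zero (hf : (Matrix.of f).det ≠ 0) {α : Fin 4 → ℝ} :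
    (∀ p, contr₁ f α p = 0) ↔ ∀ μ, α μ = 0 :=
  ⟨fun h => congrFun (Matrix.eq_zero_of_vecMul_eq_zero hf (funext h)),
    fun h p => by simp [contr₁, h]⟩

theorem contr₃_eq_zero (hf : (Matrix.of f).det ≠ 0) {T : Fin 4 → Fin 4 → Fin 4 → ℝ} :
    (∀ p q r, contr₃ f T p q r = 0) ↔ ∀ μ ν ρ, T μ ν ρ = 0 := by
  have h1 : ∀ p q r, contr₃ f T p q r
      = contr₁ f (fun μ => contr₁ f (fun ν => contr₁ f (T μ ν) r) q) p := fun p q r => by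
    simp only [contr₃, contr₁, Finset.sum_mul]
    exact Finset.sum_congr rfl fun μ _ => Finset.sum_congr rfl fun ν _ =>
      Finset.sum_congr rfl fun ρ _ => by ring
  constructor
  · intro h μ ν
    refine (contr₁_eq_zero f hf).1 fun r => ?_
    revert ν
    refine (contr₁_eq_zero f hf).1 fun q => ?_
    revert μ
    exact (contr₁_eq_zero f hf).1 fun p => (h1 p q r).symm.trans (h p q r)
  · intro h p q r
    simp [contr₃, h]

theorem contr₂_wedge11 (α β : Fin 4 → ℝ) (p q : Fin 4) :
    contr₂ f (fun μ ν => α μ * β ν - α ν * β μ) p q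
      = contr₁ f α p * contr₁ f β q - contr₁ f α q * contr₁ f β p := by
  have h1 : ∀ p q (α β : Fin 4 → ℝ), ∑ μ, ∑ ν, α μ * β ν * f μ p * f ν q
      = contr₁ f α p * contr₁ f β q := fun p q α β => by
    simp only [contr₁, Finset.sum_mul_sum]
    exact Finset.sum_congr rfl fun μ _ => Finset.sum_congr rfl fun ν _ => by ring
  rw [← h1, mul_comm (contr₁ f α q), ← h1, ← Finset.sum_sub_distrib]
  refine Finset.sum_congr rfl fun μ _ => ?_
  rw [← Finset.sum_sub_distrib]
  exact Finset.sum_congr rfl fun ν _ => by ring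

theorem contr₃_wedge21 (F : Fin 4 → Fin 4 → ℝ) (α : Fin 4 → ℝ) (p q r : Fin 4) :
    contr₃ f (fun μ ν ρ => F μ ν * α ρ + F ν ρ * α μ + F ρ μ * α ν) p q r
      = contr₂ f F p q * contr₁ f α r + contr₂ f F q r * contr₁ f α p
        + contr₂ f F r p * contr₁ f α q := by
  have h1 : ∀ p q r, contr₂ f F p q * contr₁ f α r
      = ∑ μ, ∑ ν, ∑ ρ, F μ ν * α ρ * f μ p * f ν q * f ρ r := fun p q r => by
    simp only [contr₂, contr₁, Finset.sum_mul, Finset.mul_sum]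
    rw [Finset.sum_comm]
    refine Finset.sum_congr rfl fun μ _ => ?_
    rw [Finset.sum_comm]
    exact Finset.sum_congr rfl fun ν _ => Finset.sum_congr rfl fun ρ _ => by ring
  have h2 : contr₂ f F q r * contr₁ f α p
      = ∑ μ, ∑ ν, ∑ ρ, F ν ρ * α μ * f μ p * f ν q * f ρ r := by
    rw [h1, Finset.sum_comm_cycle]
    exact Finset.sum_congr rfl fun μ _ => Finset.sum_congr rfl fun ν _ =>
      Finset.sum_congr rfl fun ρ _ => by ring
  have h3 : contr₂ f F r p * contr₁ f α q
      = ∑ μ, ∑ ν, ∑ ρ, F ρ μ * α ν * f μ p * f ν q * f ρ r := by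
    rw [h1, ← Finset.sum_comm_cycle]
    exact Finset.sum_congr rfl fun μ _ => Finset.sum_congr rfl fun ν _ =>
      Finset.sum_congr rfl fun ρ _ => by ring
  rw [h1, h2, h3]
  simp only [contr₃, add_mul, Finset.sum_add_distrib]

theorem contr₃_sum {ι : Type*} {s : Finset ι} (T : ι → Fin 4 → Fin 4 → Fin 4 → ℝ) (p q r : Fin 4) :
    contr₃ f (fun μ ν ρ => ∑ i ∈ s, T i μ ν ρ) p q r = ∑ i ∈ s, contr₃ f (T i) p q r := by
  simp only [contr₃, Finset.sum_mul]
  symm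
  rw [Finset.sum_comm]
  refine Finset.sum_congr rfl fun μ _ => ?_
  rw [Finset.sum_comm]
  refine Finset.sum_congr rfl fun ν _ => ?_
  rw [Finset.sum_comm]

theorem contr₃_mul (c : ℝ) (T : Fin 4 → Fin 4 → Fin 4 → ℝ) (p q r : Fin 4) :
    contr₃ f (fun μ ν ρ => c * T μ ν ρ) p q r = c * contr₃ f T p q r := by
  simp only [contr₃, Finset.mul_sum, mul_assoc]

theorem contr₃_sub (T S : Fin 4 → Fin 4 → Fin 4 → ℝ) (p q r : Fin 4) :
    contr₃ f (fun μ ν ρ => T μ ν ρ - S μ ν ρ) p q r = contr₃ f T p q r - contr₃ f S p q r := by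
  simp only [contr₃, sub_mul, Finset.sum_sub_distrib]

end Contraction

namespace Fields

variable (γ lam : ℝ) {U : Set Coord} {Φ : Fields}

theorem curvature_swap (a b μ ν : Fin 4) (x : Coord) :
    Φ.curvature a b μ ν x = -Φ.curvature a b ν μ x := by
  simp only [curvature, d1, wedge11, Pi.add_apply, Finset.sum_apply, Pi.smul_apply, smul_eq_mul,
    Fin.sum_univ_four]
  ring

theorem rep_curvature (hU : IsOpen U) (hs : Φ.SmoothOn U) (a b μ ν : Fin 4) :
    Rep (Φ.curvature a b μ ν) (eta b b • curv (der hU) (Φ.connM hs) μ ν a b) := by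
  intro x
  have h1 : ∀ a b μ, ev x (Φ.connM hs μ a b) = eta b b * Φ.conn a b μ x := fun a b μ => by
    rw [connM, Matrix.of_apply, map_smul, ← rep_toAlg _ (hs.2 a b μ) x, smul_eq_mul]
  have h2 : ∀ a b μ ν, pd ν (Φ.conn a b μ) x = eta b b * ev x (der hU ν (Φ.connM hs μ a b)) :=
    fun a b μ ν => by
      rw [(rep_conn hs a b μ).pd hU ν x, Derivation.map_smul, map_smul, smul_eq_mul]
  have h3 := eta_mul_self b
  simp only [curvature, d1, wedge11, Pi.add_apply, Finset.sum_apply, Pi.smul_apply, smul_eq_mul,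
    curv, Matrix.add_apply, Matrix.sub_apply, Matrix.map_apply, Matrix.mul_apply, map_smul, map_add,
    map_sub, map_sum, map_mul, h1, h2, Fin.sum_univ_four]
  linear_combination (-(eta 0 0 * Φ.conn a 0 μ x * Φ.conn 0 b ν x
    + eta 1 1 * Φ.conn a 1 μ x * Φ.conn 1 b ν x + eta 2 2 * Φ.conn a 2 μ x * Φ.conn 2 b ν x
    + eta 3 3 * Φ.conn a 3 μ x * Φ.conn 3 b ν x - eta 0 0 * Φ.conn a 0 ν x * Φ.conn 0 b μ x
    - eta 1 1 * Φ.conn a 1 ν x * Φ.conn 1 b μ x - eta 2 2 * Φ.conn a 2 ν x * Φ.conn 2 b μ x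
    - eta 3 3 * Φ.conn a 3 ν x * Φ.conn 3 b μ x)) * h3

/-- The first Bianchi identity `R^a_b ∧ e^b = 0`. -/
theorem bianchi (hU : IsOpen U) (hs : Φ.SmoothOn U) (hE : IsUnit (Φ.coframe hs).det)
    (hL : Φ.IsLeviCivita U) (a μ ν ρ : Fin 4) {x : Coord} (hx : x ∈ U) :
    ∑ b, eta b b * wedge21 (Φ.curvature a b) (Φ.e b) μ ν ρ x = 0 := by
  have hw := (isLeviCivita_iff_connM hU hs hE).1 hL
  have h1 := bianchi_frame (D := der hU) (θ := Φ.coframe hs) (w := Φ.connM hs)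
    (gi := metricInvM (Φ.coframe hs)) metricM_symm (der_comm hU)
    (fun μ => by rw [hw]; exact leviM_spec _ _ hE μ) a μ ν ρ
  have h2 := congrArg (ev ⟨x, hx⟩) h1
  simp only [map_sum, map_add, map_mul, map_zero, ← rep_e hs _ _ ⟨x, hx⟩] at h2
  rw [← h2]
  refine Finset.sum_congr rfl fun b _ => ?_
  simp only [wedge21, rep_curvature hU hs a b _ _ ⟨x, hx⟩, map_smul, smul_eq_mul]
  linear_combination (ev ⟨x, hx⟩ (curv (der hU) (Φ.connM hs) μ ν a b) * Φ.e b ρ x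
    + ev ⟨x, hx⟩ (curv (der hU) (Φ.connM hs) ν ρ a b) * Φ.e b μ x
    + ev ⟨x, hx⟩ (curv (der hU) (Φ.connM hs) ρ μ a b) * Φ.e b ν x) * eta_mul_self b

/-- By the Bianchi identity the Holst term drops out of the second field equation. -/
theorem holst2_eq_of_bianchi {x : Coord} {μ ν ρ : Fin 4} (h : ∀ a,
    ∑ b, eta b b * wedge21 (Φ.curvature a b) (Φ.e b) μ ν ρ x = 0) (d : Fin 4) :
    Φ.holst2 γ lam d μ ν ρ x
      = ∑ a, ∑ b, ∑ c, eps4 a b c d * wedge21 (Φ.curvature a b) (Φ.e c) μ ν ρ x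
        - lam / 3 * ∑ a, ∑ b, ∑ c, eps4 a b c d *
          wedge21 (wedge11 (Φ.e a) (Φ.e b)) (Φ.e c) μ ν ρ x := by
  have hs := fun a b μ ν => Φ.curvature_skew a b μ ν x
  have h1 : Φ.holst2 γ lam d μ ν ρ x
      = ∑ a, ∑ b, ∑ c, eps4 a b c d * wedge21 (Φ.curvature a b) (Φ.e c) μ ν ρ x
        - lam / 3 * (∑ a, ∑ b, ∑ c, eps4 a b c d *
          wedge21 (wedge11 (Φ.e a) (Φ.e b)) (Φ.e c) μ ν ρ x)
        - (2 / γ) * (eta d d * ∑ b, eta b b * wedge21 (Φ.curvature d b) (Φ.e b) μ ν ρ x) := by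
    have hd : ∀ a μ ν, Φ.curvature a a μ ν x = 0 := fun a μ ν => by linarith [hs a a μ ν]
    simp only [holst2, wedge21, eLow, Pi.sub_apply, Pi.add_apply, Finset.sum_apply, Pi.smul_apply,
      smul_eq_mul]
    generalize Φ.curvature = R at *
    generalize wedge11 = W
    generalize 2 / γ = c
    fin_cases d <;>
    simp [Fin.sum_univ_four, eps4_values, eps4_self₁₂, eps4_self₁₃, eps4_self₁₄, eps4_self₂₃,
      eps4_self₂₄, eps4_self₃₄, eta, hd, hs 1 0, hs 2 0, hs 3 0, hs 2 1, hs 3 1, hs 3 2] <;> ring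
  rw [h1, h]; ring

theorem contr₁_frame (hdet : ∀ x ∈ U, (Matrix.of fun a μ => Φ.e a μ x).det ≠ 0) {x : Coord}
    (hx : x ∈ U) (a p : Fin 4) :
    contr₁ (fun μ b => Φ.frame b μ x) (fun μ => Φ.e a μ x) p = if a = p then 1 else 0 := by
  have h1 := Matrix.mul_nonsing_inv _ (hdet x hx).isUnit
  have := congrFun (congrFun h1 a) p
  rwa [Matrix.mul_apply, Matrix.one_apply] at this

theorem frame_det_ne (hdet : ∀ x ∈ U, (Matrix.of fun a μ => Φ.e a μ x).det ≠ 0) {x : Coord}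
    (hx : x ∈ U) : (Matrix.of fun μ b => Φ.frame b μ x).det ≠ 0 := by
  have h1 : (Matrix.of fun μ b => Φ.frame b μ x) = (Matrix.of fun a μ => Φ.e a μ x)⁻¹ := rfl
  rw [h1, Matrix.det_nonsing_inv, Ring.inverse_eq_inv']
  exact inv_ne_zero (hdet x hx)

/-- The curvature components `R^{ab}_{pq}` in the frame. -/
def frameCurvature (Φ : Fields) (a b p q : Fin 4) (x : Coord) : ℝ :=
  contr₂ (fun μ b => Φ.frame b μ x) (fun μ ν => Φ.curvature a b μ ν x) p q

theorem frameCurvature_skew (a b p q : Fin 4) (x : Coord) :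
    Φ.frameCurvature a b p q x = -Φ.frameCurvature b a p q x := by
  simp only [frameCurvature, contr₂, Φ.curvature_skew a b, neg_mul, Finset.sum_neg_distrib]

theorem frameCurvature_swap (a b p q : Fin 4) (x : Coord) :
    Φ.frameCurvature a b p q x = -Φ.frameCurvature a b q p x := by
  simp only [frameCurvature, contr₂, ← Finset.sum_neg_distrib]
  rw [Finset.sum_comm]
  exact Finset.sum_congr rfl fun μ _ => Finset.sum_congr rfl fun ν _ => by
    rw [curvature_swap a b ν μ]; ring

/-- For the torsion-free connection, the second Holst equation is `Ric^c_q = Λ δ^c_q` in the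
frame. -/
theorem holst2_iff_frame (hU : IsOpen U) (hs : Φ.SmoothOn U)
    (hdet : ∀ x ∈ U, (Matrix.of fun a μ => Φ.e a μ x).det ≠ 0)
    (hL : Φ.IsLeviCivita U) {x : Coord} (hx : x ∈ U) :
    (∀ d μ ν ρ, Φ.holst2 γ lam d μ ν ρ x = 0) ↔
      ∀ c q, ∑ a, Φ.frameCurvature a c a q x = if c = q then lam else 0 := by
  have hE := isUnit_coframe_det hs hdet
  rw [← eps4_curvature_iff (r := fun a b p q => Φ.frameCurvature a b p q x) lam
    (fun a b p q => frameCurvature_skew a b p q x) (fun a b p q => frameCurvature_swap a b p q x)]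
  refine forall_congr' fun d => ?_
  rw [← contr₃_eq_zero _ (frame_det_ne hdet hx)]
  refine forall_congr' fun p => forall_congr' fun q => forall_congr' fun s => ?_
  have he := contr₁_frame hdet hx
  have h1 : (fun μ ν ρ => Φ.holst2 γ lam d μ ν ρ x) = fun μ ν ρ =>
      ∑ a, ∑ b, ∑ c, eps4 a b c d * wedge21 (Φ.curvature a b) (Φ.e c) μ ν ρ x
        - lam / 3 * ∑ a, ∑ b, ∑ c, eps4 a b c d *
          wedge21 (wedge11 (Φ.e a) (Φ.e b)) (Φ.e c) μ ν ρ x := by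
    funext μ ν ρ
    exact holst2_eq_of_bianchi γ lam (fun a => bianchi hU hs hE hL a μ ν ρ hx) d
  have h2 : ∀ a b c, contr₃ (fun μ b => Φ.frame b μ x)
      (fun μ ν ρ => wedge21 (Φ.curvature a b) (Φ.e c) μ ν ρ x) p q s
      = Φ.frameCurvature a b p q x * (if c = s then 1 else 0)
        + Φ.frameCurvature a b q s x * (if c = p then 1 else 0)
        + Φ.frameCurvature a b s p x * (if c = q then 1 else 0) := fun a b c => by
    rw [← he c s, ← he c p, ← he c q]
    exact contr₃_wedge21 _ (fun μ ν => Φ.curvature a b μ ν x) (fun μ => Φ.e c μ x) p q s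
  have h3 : ∀ a b c, contr₃ (fun μ b => Φ.frame b μ x)
      (fun μ ν ρ => wedge21 (wedge11 (Φ.e a) (Φ.e b)) (Φ.e c) μ ν ρ x) p q s
      = ((if a = p then 1 else 0) * (if b = q then 1 else 0)
          - (if a = q then 1 else 0) * (if b = p then 1 else 0)) * (if c = s then 1 else 0)
        + ((if a = q then 1 else 0) * (if b = s then 1 else 0)
          - (if a = s then 1 else 0) * (if b = q then 1 else 0)) * (if c = p then 1 else 0)
        + ((if a = s then 1 else 0) * (if b = p then 1 else 0)
          - (if a = p then 1 else 0) * (if b = s then 1 else 0)) * (if c = q then 1 else 0) :=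
    fun a b c => by
      simp only [← he]
      simp only [← contr₂_wedge11]
      exact contr₃_wedge21 _ (fun μ ν => wedge11 (Φ.e a) (Φ.e b) μ ν x) (fun μ => Φ.e c μ x) p q s
  rw [h1]
  simp only [contr₃_sub, contr₃_mul, contr₃_sum, h2, h3]
  have h4 : ∑ a, ∑ b, ∑ c, eps4 a b c d * (((if a = p then 1 else 0) * (if b = q then 1 else 0)
          - (if a = q then 1 else 0) * (if b = p then 1 else 0)) * (if c = s then 1 else 0)
        + ((if a = q then 1 else 0) * (if b = s then 1 else 0)
          - (if a = s then 1 else 0) * (if b = q then 1 else 0)) * (if c = p then 1 else 0)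
        + ((if a = s then 1 else 0) * (if b = p then 1 else 0)
          - (if a = p then 1 else 0) * (if b = s then 1 else 0)) * (if c = q then 1 else 0))
      = 6 * eps4 p q s d := by
    simp [mul_add, mul_sub, add_mul, sub_mul, Finset.sum_add_distrib, Finset.sum_sub_distrib,
      ← Finset.mul_sum, ← Finset.sum_mul]
    simp only [eps4]
    ring
  rw [h4]
  have h5 : ∀ a b, ∑ c, eps4 a b c d * (Φ.frameCurvature a b p q x * (if c = s then 1 else 0)
        + Φ.frameCurvature a b q s x * (if c = p then 1 else 0)
        + Φ.frameCurvature a b s p x * (if c = q then 1 else 0))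
      = eps4 a b s d * Φ.frameCurvature a b p q x + eps4 a b p d * Φ.frameCurvature a b q s x
        + eps4 a b q d * Φ.frameCurvature a b s p x := fun a b => by
    simp [mul_add, Finset.sum_add_distrib]
  simp only [h5]
  rw [show lam / 3 * (6 * eps4 p q s d) = 2 * lam * eps4 p q s d by ring]

/-- For the torsion-free connection, the second Holst equation is Einstein's equation. -/
theorem holst2_iff_einstein (hU : IsOpen U) (hs : Φ.SmoothOn U)
    (hdet : ∀ x ∈ U, (Matrix.of fun a μ => Φ.e a μ x).det ≠ 0) (hL : Φ.IsLeviCivita U) :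
    (∀ d μ ν ρ, ∀ x ∈ U, Φ.holst2 γ lam d μ ν ρ x = 0) ↔ Φ.EinsteinEquations lam U := by
  have hE := isUnit_coframe_det hs hdet
  have hw := (isLeviCivita_iff_connM hU hs hE).1 hL
  -- `X c d = Ric^c_d - Λ e^c_d`, with the second index a coordinate index
  set X : Fin 4 → Fin 4 → Coord → ℝ := fun c d x =>
    (∑ a, ∑ α, Φ.curvature a c α d x * Φ.frame a α x) - lam * Φ.e c d x with hX
  have h1 : ∀ x ∈ U, ((∀ c q, ∑ a, Φ.frameCurvature a c a q x = if c = q then lam else 0) ↔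
      ∀ c d, X c d x = 0) := by
    intro x hx
    refine forall_congr' fun c => ?_
    rw [← contr₁_eq_zero _ (frame_det_ne hdet hx)]
    refine forall_congr' fun q => ?_
    have h2 : contr₁ (fun μ b => Φ.frame b μ x) (fun d => X c d x) q
        = ∑ a, Φ.frameCurvature a c a q x - lam * if c = q then 1 else 0 := by
      rw [← contr₁_frame hdet hx c q]
      simp only [contr₁, hX, sub_mul, Finset.sum_sub_distrib, Finset.sum_mul, Finset.mul_sum,
        frameCurvature, contr₂]
      congr 1
      · rw [Finset.sum_comm]
        refine Finset.sum_congr rfl fun a _ => ?_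
        rw [Finset.sum_comm]
      · exact Finset.sum_congr rfl fun a _ => by ring
    rw [h2, mul_ite, mul_one, mul_zero, sub_eq_zero]
  have h2 : ∀ (x : U) b d, ev x (ric (der hU) (metricM (Φ.coframe hs))
      (metricInvM (Φ.coframe hs)) b d - algebraMap ℝ _ lam * metricM (Φ.coframe hs) b d)
      = ∑ c, eta c c * X c d x * Φ.e c b x := by
    intro x b d
    rw [ric_frame (w := Φ.connM hs) (Matrix.nonsing_inv_mul _ hE) (der_comm hU)
      (fun μ => by rw [hw]; exact leviM_spec _ _ hE μ), map_sub, map_mul, AlgHom.commutes]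
    have hg : ev x (metricM (Φ.coframe hs) b d) = Φ.metric b d x := (rep_metric hs b d x).symm
    have hR : ∀ a c α d, ev x (curv (der hU) (Φ.connM hs) α d a c)
        = eta c c * Φ.curvature a c α d x := fun a c α d => by
      rw [rep_curvature hU hs a c α d x, map_smul, smul_eq_mul, ← mul_assoc, eta_mul_self, one_mul]
    have hgs : Φ.metric b d x = ∑ c, eta c c * Φ.e c b x * Φ.e c d x := by
      simp only [metric]
      refine Finset.sum_congr rfl fun c _ => ?_
      rw [Finset.sum_eq_single c]
      · intro a _ ha; rw [eta_ne ha.symm]; ring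
      · simp
    rw [hg, hgs]
    simp only [map_sum, map_mul, hR, ← rep_e hs _ _ x, ← rep_frame hs hE _ _ x, hX, mul_sub,
      sub_mul,
      Finset.sum_sub_distrib, Finset.mul_sum, Finset.sum_mul]
    congr 1
    · rw [Finset.sum_comm_cycle]
      refine Finset.sum_congr rfl fun c _ => ?_
      rw [Finset.sum_comm]
      exact Finset.sum_congr rfl fun a _ => Finset.sum_congr rfl fun α _ => by ring
    · refine Finset.sum_congr rfl fun c _ => ?_
      rw [show algebraMap ℝ ℝ lam = lam from rfl]
      ring
  have key : ∀ x : U, (∀ c q, ∑ a, Φ.frameCurvature a c a q x = if c = q then lam else 0) ↔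
      ∀ b d, ev x (ric (der hU) (metricM (Φ.coframe hs)) (metricInvM (Φ.coframe hs)) b d
        - algebraMap ℝ _ lam * metricM (Φ.coframe hs) b d) = 0 := by
    intro x
    rw [h1 x x.2]
    simp only [h2]
    constructor
    · intro h b d
      simp [h]
    · intro h c d
      have h3 := Matrix.eq_zero_of_vecMul_eq_zero (v := fun c => eta c c * X c d x) (hdet x x.2)
        (funext fun b => h b d)
      have h4 := congrFun h3 c
      have h5 : eta c c ≠ 0 := fun h0 => by simpa [h0] using eta_mul_self c
      exact (mul_eq_zero.1 h4).resolve_left h5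
  rw [einsteinEquations_iff_ric hU hs lam hE]
  constructor
  · intro h b d
    rw [← sub_eq_zero]
    refine smoothAlg_ext fun x => ?_
    rw [map_zero]
    exact (key x).1 ((holst2_iff_frame γ lam hU hs hdet hL x.2).1 fun d μ ν ρ =>
      h d μ ν ρ x x.2) b d
  · intro h d μ ν ρ x hx
    refine (holst2_iff_frame γ lam hU hs hdet hL hx).2 ((key ⟨x, hx⟩).2 fun b d => ?_) d μ ν ρ
    rw [h b d, sub_self, map_zero]

end Fields

/-! ### The momentum constraint in triad form -/

namespace Fields

variable {U : Set Coord} {Φ : Fields}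

/-- The vector constraint consists of the tangential Bianchi identity for the spatial curvature and
of the skew part of the tangential Immirzi tensor. -/
theorem momentum_eq (ha : AdaptedOn Φ.e U) {x : Coord} (hx : x ∈ U) (B : Fin 3) :
    Φ.momentum B x = -(∑ j : Fin 3, Φ.triad j B x * ∑ b, eta b b *
        wedge21 (Φ.curvature j.succ b) (Φ.e b) 1 2 3 x)
      - ∑ C : Fin 3, ∑ D : Fin 3, ∑ E : Fin 3, eps3 C D E * Φ.tangent1 Φ.k B D x
        * Φ.tangent1 Φ.k C E x := by
  have h0 := (ha x hx).1
  have h01 := h0 0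
  have h02 := h0 1
  have h03 := h0 2
  have hF := fun i μ ν => Φ.curvature_rot_apply i μ ν x
  have hs := fun a b μ ν => Φ.curvature_skew a b μ ν x
  have hw := fun a b μ ν => curvature_swap (Φ := Φ) a b μ ν x
  have hd : ∀ a μ ν, Φ.curvature a a μ ν x = 0 := fun a μ ν => by linarith [hs a a μ ν]
  have hd' : ∀ a b μ, Φ.curvature a b μ μ x = 0 := fun a b μ => by linarith [hw a b μ μ]
  simp only [momentum, densTriad, tangent1, triad, wedge11, wedge21, hF]
  generalize Φ.curvature = R at *
  generalize Φ.k = k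
  generalize Φ.e = e at *
  simp at h01 h02 h03
  fin_cases B <;>
    simp [Fin.sum_univ_three, Fin.sum_univ_four, eps3_values, eps3_self₁₂,
      eps3_self₁₃, eps3_self₂₃, eta, hd, hd', h01, h02, h03, hs 2 1, hs 3 1, hs 3 2, hw _ _ 2 1,
      hw _ _ 3 1, hw _ _ 3 2] <;> ring

/-- Without torsion, the tangential Immirzi tensor is symmetric, as `de^0 = 0` on the leaves. -/
theorem k_symm (hU : IsOpen U) (ha : AdaptedOn Φ.e U)
    (hT : ∀ a μ ν, ∀ x ∈ U, Φ.torsion a μ ν x = 0) (A B : Fin 3) {x : Coord} (hx : x ∈ U) :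
    Φ.tangent1 Φ.k A B x = Φ.tangent1 Φ.k B A x := by
  have h0 : ∀ A B : Fin 3, pd A.succ (Φ.e 0 B.succ) x = 0 := fun A B => by
    rw [pd_congr hU (g := 0) (fun y hy => (ha y hy).1 B) _ hx]
    simp [pd]
  have h1 := hT 0 A.succ B.succ x hx
  have h2 := (ha x hx).1
  simp [torsion, d1, wedge11, h0, h2, Fin.sum_univ_succ (n := 3), eta, Fin.succ_ne_zero] at h1
  simp only [tangent1, triad, k, immirziTensor]
  rw [← sub_eq_zero, ← Finset.sum_sub_distrib, ← h1]
  simp [Fin.sum_univ_three]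
  try ring

/-- For the torsion-free connection the vector constraint is an identity. -/
theorem momentum_eq_zero (hU : IsOpen U) (hs : Φ.SmoothOn U) (ha : AdaptedOn Φ.e U)
    (hL : Φ.IsLeviCivita U) (B : Fin 3) {x : Coord} (hx : x ∈ U) : Φ.momentum B x = 0 := by
  have hE := (isAdapted hs ha).det
  have hk := fun A B => k_symm hU ha ((torsion_eq_zero_iff hU hs hE).2 hL) A B hx
  rw [momentum_eq ha hx]
  simp only [bianchi hU hs hE hL _ _ _ _ hx, mul_zero, Finset.sum_const_zero, neg_zero, zero_sub,
    neg_eq_zero]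
  generalize Φ.tangent1 Φ.k = K at *
  simp [Fin.sum_univ_three, eps3_values, eps3_self₁₂, eps3_self₁₃, eps3_self₂₃, hk 1 0, hk 2 0,
    hk 2 1]
  ring

end Fields

/-! ### Projections -/

/-- The components of `T` at `x` are totally skew. In `Form3` skewness is not built in, and the
projections only see some of the components. -/
def IsSkewAt (T : Form3) (x : Coord) : Prop :=
  ∀ μ ν ρ, T μ ν ρ x = -T ν μ ρ x ∧ T μ ν ρ x = -T μ ρ ν x

theorem isSkewAt_wedge21 {F : Form2} {x : Coord} (hF : ∀ μ ν, F μ ν x = -F ν μ x) (α : Form1) :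
    IsSkewAt (wedge21 F α) x := fun μ ν ρ => by
  simp only [wedge21]
  rw [hF μ ν, hF ν ρ, hF ρ μ]
  constructor <;> ring

theorem IsSkewAt.add {T S : Form3} {x : Coord} (hT : IsSkewAt T x) (hS : IsSkewAt S x) :
    IsSkewAt (T + S) x := fun μ ν ρ => by
  simp only [Pi.add_apply]
  constructor
  · rw [(hT μ ν ρ).1, (hS μ ν ρ).1]; ring
  · rw [(hT μ ν ρ).2, (hS μ ν ρ).2]; ring

theorem IsSkewAt.smul {T : Form3} {x : Coord} (c : ℝ) (hT : IsSkewAt T x) :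
    IsSkewAt (c • T) x := fun μ ν ρ => by
  simp only [Pi.smul_apply, smul_eq_mul]
  constructor
  · rw [(hT μ ν ρ).1]; ring
  · rw [(hT μ ν ρ).2]; ring

theorem IsSkewAt.sub {T S : Form3} {x : Coord} (hT : IsSkewAt T x) (hS : IsSkewAt S x) :
    IsSkewAt (T - S) x := by
  have := hT.add (hS.smul (-1))
  rwa [neg_one_smul, ← sub_eq_add_neg] at this

theorem IsSkewAt.sum {ι : Type*} {s : Finset ι} {T : ι → Form3} {x : Coord}
    (h : ∀ i ∈ s, IsSkewAt (T i) x) : IsSkewAt (∑ i ∈ s, T i) x := by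
  classical
  induction s using Finset.induction_on with
  | empty => exact fun μ ν ρ => by simp
  | insert i s hi ih =>
    rw [Finset.sum_insert hi]
    exact (h i (Finset.mem_insert_self i s)).add (ih fun j hj => h j (Finset.mem_insert_of_mem hj))

theorem IsSkewAt.congr {T S : Form3} {x : Coord} (hT : IsSkewAt T x)
    (h : ∀ μ ν ρ, S μ ν ρ x = T μ ν ρ x) : IsSkewAt S x := fun μ ν ρ => by
  simp only [h]; exact hT μ ν ρ

/-- A 3-form vanishes iff its tangent and normal projections do. -/
theorem IsSkewAt.eq_zero_iff {T : Form3} {x : Coord} (hT : IsSkewAt T x) {N : Coord → ℝ}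
    (hN : N x ≠ 0) (β : Fin 3 → Coord → ℝ) : (∀ μ ν ρ, T μ ν ρ x = 0) ↔
      (∀ A B C, tangent3 T A B C x = 0) ∧ ∀ B C, normal3 N β T B C x = 0 := by
  constructor
  · intro h
    simp [tangent3, normal3, h]
  · rintro ⟨h1, h2⟩
    have h3 : ∀ A B C : Fin 3, T A.succ B.succ C.succ x = 0 := h1
    have h4 : ∀ B C : Fin 3, T 0 B.succ C.succ x = 0 := fun B C => by
      have := h2 B C
      simp only [normal3, h3, mul_zero, Finset.sum_const_zero, sub_zero] at this
      exact (div_eq_zero_iff.1 this).resolve_right hN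
    exact eq_zero_of_skew₃ (fun μ ν ρ => (hT μ ν ρ).1) (fun μ ν ρ => (hT μ ν ρ).2)
      (h4 0 1) (h4 0 2) (h4 1 2) (h3 0 1 2)

namespace Fields

variable (γ lam : ℝ) {U : Set Coord} {Φ : Fields}

theorem isSkewAt_nablaB (hU : IsOpen U) (hs : Φ.SmoothOn U) (a b : Fin 4) {x : Coord} (hx : x ∈ U) :
    IsSkewAt (Φ.nablaB γ a b) x := by
  have h1 : ∀ a b, IsSkewAt (Φ.torsionWedge a b) x := fun a b =>
    (isSkewAt_wedge21 (fun μ ν => Φ.torsion_skew a μ ν x) _).sub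
      (isSkewAt_wedge21 (fun μ ν => Φ.torsion_skew b μ ν x) _)
  refine IsSkewAt.congr (T := (∑ c, ∑ d, eps4 a b c d • Φ.torsionWedge c d)
        + (2 / γ * (eta a a * eta b b)) • Φ.torsionWedge a b) ?_ fun μ ν ρ => ?_
  · exact (IsSkewAt.sum fun c _ => IsSkewAt.sum fun d _ => (h1 c d).smul _).add ((h1 a b).smul _)
  · rw [nablaB_eq γ hU hs a b μ ν ρ hx]
    simp only [Pi.add_apply, Finset.sum_apply, Pi.smul_apply, smul_eq_mul]
    ring

theorem isSkewAt_field1 (hU : IsOpen U) (hs : Φ.SmoothOn U) (i : Fin 3) {x : Coord} (hx : x ∈ U) :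
    IsSkewAt (Φ.field1 γ i) x := by
  refine IsSkewAt.congr (T := (1 / 4 : ℝ) • (∑ j : Fin 3, ∑ k : Fin 3,
    eps3 i j k • Φ.nablaB γ j.succ k.succ) + (γ / 2) • Φ.nablaB γ 0 i.succ) ?_ fun μ ν ρ => ?_
  · exact ((IsSkewAt.sum fun c _ => IsSkewAt.sum fun d _ =>
      (isSkewAt_nablaB γ hU hs _ _ hx).smul _).smul _).add ((isSkewAt_nablaB γ hU hs _ _ hx).smul _)
  · rw [field1_eq γ hU hs i μ ν ρ hx]
    simp only [Pi.add_apply, Finset.sum_apply, Pi.smul_apply, smul_eq_mul]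

theorem isSkewAt_field2 (hU : IsOpen U) (hs : Φ.SmoothOn U) (i : Fin 3) {x : Coord} (hx : x ∈ U) :
    IsSkewAt (Φ.field2 γ i) x := by
  refine IsSkewAt.congr (T := (1 / 2 : ℝ) • Φ.nablaB γ 0 i.succ - (γ / 4) • (∑ j : Fin 3,
    ∑ k : Fin 3, eps3 i j k • Φ.nablaB γ j.succ k.succ)) ?_ fun μ ν ρ => ?_
  · exact ((isSkewAt_nablaB γ hU hs _ _ hx).smul _).sub ((IsSkewAt.sum fun c _ =>
      IsSkewAt.sum fun d _ => (isSkewAt_nablaB γ hU hs _ _ hx).smul _).smul _)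
  · rw [field2_eq γ hU hs i μ ν ρ hx]
    simp only [Pi.sub_apply, Finset.sum_apply, Pi.smul_apply, smul_eq_mul]
    try ring

theorem isSkewAt_holst2 (d : Fin 4) (x : Coord) : IsSkewAt (Φ.holst2 γ lam d) x :=
  (IsSkewAt.sum fun a _ => IsSkewAt.sum fun b _ =>
    isSkewAt_wedge21 (fun μ ν => curvature_swap a b μ ν x) _).sub
  (IsSkewAt.smul _ (IsSkewAt.sum fun a _ => IsSkewAt.sum fun b _ => IsSkewAt.sum fun c _ =>
    IsSkewAt.smul _ (isSkewAt_wedge21 (fun μ ν => by simp only [wedge11]; ring) _)))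

theorem isSkewAt_field3 (x : Coord) : IsSkewAt (Φ.field3 γ lam) x := by
  have := (isSkewAt_holst2 γ lam (Φ := Φ) 0 x).smul (-1 / 2)
  rw [holst2_zero, smul_smul] at this
  norm_num at this
  exact this

theorem isSkewAt_field4 (h : Fin 3) (x : Coord) : IsSkewAt (Φ.field4 γ lam h) x := by
  have := (isSkewAt_holst2 γ lam (Φ := Φ) h.succ x).smul (1 / 2)
  rw [holst2_succ, smul_smul] at this
  norm_num at this
  exact this

theorem abiEquations_iff_projected (hU : IsOpen U) (hs : Φ.SmoothOn U) (ha : AdaptedOn Φ.e U) :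
    Φ.ABIEquations γ lam U ↔ Φ.ProjectedEquations γ lam U := by
  refine forall_congr' fun x => forall_congr' fun hx => ?_
  have hN := lapse_ne ha hx
  have e1 := fun i => (isSkewAt_field1 γ hU hs i hx).eq_zero_iff hN Φ.shift
  have e2 := fun i => (isSkewAt_field2 γ hU hs i hx).eq_zero_iff hN Φ.shift
  have e3 := (isSkewAt_field3 γ lam (Φ := Φ) x).eq_zero_iff hN Φ.shift
  have e4 := fun i => (isSkewAt_field4 γ lam (Φ := Φ) i x).eq_zero_iff hN Φ.shift
  constructor
  · intro h
    exact ⟨fun i => ((e1 i).1 fun μ ν ρ => (h μ ν ρ).1 i).1,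
      fun i => ((e1 i).1 fun μ ν ρ => (h μ ν ρ).1 i).2,
      fun i => ((e2 i).1 fun μ ν ρ => (h μ ν ρ).2.1 i).1,
      fun i => ((e2 i).1 fun μ ν ρ => (h μ ν ρ).2.1 i).2,
      (e3.1 fun μ ν ρ => (h μ ν ρ).2.2.1).1, (e3.1 fun μ ν ρ => (h μ ν ρ).2.2.1).2,
      fun i => ((e4 i).1 fun μ ν ρ => (h μ ν ρ).2.2.2 i).1,
      fun i => ((e4 i).1 fun μ ν ρ => (h μ ν ρ).2.2.2 i).2⟩
  · rintro ⟨h1, h1', h2, h2', h3, h3', h4, h4'⟩ μ ν ρ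
    exact ⟨fun i => (e1 i).2 ⟨h1 i, h1' i⟩ μ ν ρ, fun i => (e2 i).2 ⟨h2 i, h2' i⟩ μ ν ρ,
      e3.2 ⟨h3, h3'⟩ μ ν ρ, fun i => (e4 i).2 ⟨h4 i, h4' i⟩ μ ν ρ⟩

/-! ### The equivalences -/

/-- The Holst field equations say that the connection is torsion-free and the metric Einstein. -/
theorem holstEquations_iff (hγ : γ ≠ 0) (hU : IsOpen U) (hs : Φ.SmoothOn U)
    (hdet : ∀ x ∈ U, (Matrix.of fun a μ => Φ.e a μ x).det ≠ 0) :
    Φ.HolstEquations γ lam U ↔ Φ.IsLeviCivita U ∧ Φ.EinsteinEquations lam U := by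
  have hE := isUnit_coframe_det hs hdet
  have h2 : (∀ d μ ν ρ, ∀ x ∈ U, (∑ a, ∑ b, wedge21 (Φ.curvature a b)
      ((∑ c, eps4 a b c d • Φ.e c)
        + (2 / γ) • ((1 / 2 : ℝ) • (eta b d • Φ.eLow a - eta a d • Φ.eLow b)))) μ ν ρ x
    = ((lam / 3) • ∑ a, ∑ b, ∑ c, eps4 a b c d •
        wedge21 (wedge11 (Φ.e a) (Φ.e b)) (Φ.e c)) μ ν ρ x) ↔
      ∀ d μ ν ρ, ∀ x ∈ U, Φ.holst2 γ lam d μ ν ρ x = 0 :=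
    forall_congr' fun d => forall_congr' fun μ => forall_congr' fun ν => forall_congr' fun ρ =>
      forall_congr' fun x => forall_congr' fun _ => sub_eq_zero.symm
  have h3 : (∀ a b μ ν ρ, ∀ x ∈ U, Φ.nablaB γ a b μ ν ρ x = 0) ↔ Φ.IsLeviCivita U :=
    ((torsion_tfae γ hγ hU hs hdet).out 0 2).trans (torsion_eq_zero_iff hU hs hE)
  rw [HolstEquations, h2, h3]
  exact and_congr_right fun hL => holst2_iff_einstein γ lam hU hs hdet hL

theorem abiEquations_iff (hγ : γ ≠ 0) (hU : IsOpen U) (hs : Φ.SmoothOn U)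
    (hdet : ∀ x ∈ U, (Matrix.of fun a μ => Φ.e a μ x).det ≠ 0) :
    Φ.ABIEquations γ lam U ↔ Φ.IsLeviCivita U ∧ Φ.EinsteinEquations lam U := by
  have hE := isUnit_coframe_det hs hdet
  have h1 := ((torsion_tfae γ hγ hU hs hdet).out 1 2).trans (torsion_eq_zero_iff hU hs hE)
  have h2 : ∀ μ ν ρ x, (Φ.field3 γ lam μ ν ρ x = 0 ∧ ∀ i, Φ.field4 γ lam i μ ν ρ x = 0) ↔
      ∀ d, Φ.holst2 γ lam d μ ν ρ x = 0 := fun μ ν ρ x => by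
    rw [Fin.forall_fin_succ (P := fun d => Φ.holst2 γ lam d μ ν ρ x = 0)]
    simp only [holst2_zero, holst2_succ, Pi.smul_apply, smul_eq_zero]
    norm_num
  constructor
  · intro h
    have hL := h1.1 fun i μ ν ρ x hx => ⟨(h x hx μ ν ρ).1 i, (h x hx μ ν ρ).2.1 i⟩
    exact ⟨hL, (holst2_iff_einstein γ lam hU hs hdet hL).1 fun d μ ν ρ x hx =>
      (h2 μ ν ρ x).1 (h x hx μ ν ρ).2.2 d⟩
  · rintro ⟨hL, hG⟩ x hx μ ν ρ
    have h3 := h1.2 hL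
    exact ⟨fun i => (h3 i μ ν ρ x hx).1, fun i => (h3 i μ ν ρ x hx).2, (h2 μ ν ρ x).2 fun d =>
      (holst2_iff_einstein γ lam hU hs hdet hL).2 hG d μ ν ρ x hx⟩

/-- The differential and algebraic constraints on the connection give `z = h = 0`; the rest of the
system is ADM. -/
theorem systemHolds_iff (hU : IsOpen U) (hs : Φ.SmoothOn U) (ha : AdaptedOn Φ.e U) :
    Φ.SystemHolds lam U ↔
      Φ.DeviationsVanish U ∧ ADMEquations lam U Φ.lapse Φ.shift Φ.leafMetric Φ.chi := by
  have hE := (isAdapted hs ha).det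
  rw [← gauss_and_algConstraint_iff hU hs ha, admEquations_iff hU hs lam ha]
  constructor
  · intro h
    refine ⟨⟨fun i => h (.inl (.inl i)), fun i => h (.inr (.inl i))⟩,
      fun C => h (.inl (.inr (.inl C))), h (.inl (.inr (.inr (.inl ())))), fun A B x hx => ?_⟩
    rcases le_total A B with hAB | hAB
    · exact h (.inr (.inr ⟨(A, B), hAB⟩)) x hx
    · rw [evolution_symm hU hs lam ha A B x hx]
      exact h (.inr (.inr ⟨(B, A), hAB⟩)) x hx
  · rintro ⟨hg, h1, h2, h3⟩ i x hx
    have hL := (deviationsVanish_iff hU hs hE).1 ((gauss_and_algConstraint_iff hU hs ha).1 hg)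
    rcases i with (i | C | _ | B) | i | p
    · exact hg.1 i x hx
    · exact h1 C x hx
    · exact h2 x hx
    · exact momentum_eq_zero hU hs ha hL B hx
    · exact hg.2 i x hx
    · exact h3 _ _ x hx

theorem fieldEquations_tfae (hγ : γ ≠ 0) (hU : IsOpen U) (hs : Φ.SmoothOn U)
    (ha : AdaptedOn Φ.e U) : List.TFAE
        [ Φ.HolstEquations γ lam U,
          Φ.ABIEquations γ lam U,
          Φ.ProjectedEquations γ lam U,
          Φ.SystemHolds lam U,
          Φ.DeviationsVanish U ∧ ADMEquations lam U Φ.lapse Φ.shift Φ.leafMetric Φ.chi,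
          Φ.IsLeviCivita U ∧ Φ.EinsteinEquations lam U ] := by
  have hdet : ∀ x ∈ U, (Matrix.of fun a μ => Φ.e a μ x).det ≠ 0 := fun x hx => (ha x hx).2
  have hE := isUnit_coframe_det hs hdet
  tfae_have 1 ↔ 6 := holstEquations_iff γ lam hγ hU hs hdet
  tfae_have 2 ↔ 6 := abiEquations_iff γ lam hγ hU hs hdet
  tfae_have 2 ↔ 3 := abiEquations_iff_projected γ lam hU hs ha
  tfae_have 4 ↔ 5 := systemHolds_iff lam hU hs ha
  tfae_have 5 ↔ 6 := by
    rw [deviationsVanish_iff hU hs hE, admEquations_iff hU hs lam ha,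
      einsteinEquations_iff_adm hU hs lam ha]
  tfae_finish

theorem torsionEquations_tfae (hγ : γ ≠ 0) (hU : IsOpen U) (hs : Φ.SmoothOn U)
    (ha : AdaptedOn Φ.e U) : List.TFAE
        [ ∀ i μ ν ρ, ∀ x ∈ U, Φ.field1 γ i μ ν ρ x = 0 ∧ Φ.field2 γ i μ ν ρ x = 0,
          (∀ i, ∀ x ∈ U, Φ.gauss i x = 0) ∧ (∀ i, ∀ x ∈ U, Φ.algConstraint i x = 0),
          Φ.DeviationsVanish U ] := by
  have hdet : ∀ x ∈ U, (Matrix.of fun a μ => Φ.e a μ x).det ≠ 0 := fun x hx => (ha x hx).2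
  have hE := isUnit_coframe_det hs hdet
  tfae_have 1 ↔ 3 := ((torsion_tfae γ hγ hU hs hdet).out 1 2).trans
    ((torsion_eq_zero_iff hU hs hE).trans (deviationsVanish_iff hU hs hE).symm)
  tfae_have 2 ↔ 3 := gauss_and_algConstraint_iff hU hs ha
  tfae_finish

end Fields

/-! ### The fields from their components -/

namespace Fields

variable {U : Set Coord}

/-- The coframe with given lapse, shift and triad and the connection with given ABI variables. -/
def ofComponents (c : FieldIdx → Coord → ℝ) : Fields where
  e := Fin.cases
    (Fin.cases (c (.inl ())) fun _ => 0)
    (fun i => Fin.cases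
      (fun x => ∑ A, c (.inr (.inr (.inl (i, A)))) x * c (.inr (.inl A)) x)
      (fun A => c (.inr (.inr (.inl (i, A))))))
  conn := Fin.cases
    (Fin.cases 0 fun i μ => c (.inr (.inr (.inr (.inr (i, μ))))))
    (fun j => Fin.cases
      (fun μ x => -c (.inr (.inr (.inr (.inr (j, μ))))) x)
      (fun l μ x => ∑ i, eps3 i j l * c (.inr (.inr (.inr (.inl (i, μ))))) x))
  skew := fun a b μ x => by
    refine Fin.cases ?_ (fun j => ?_) a <;> refine Fin.cases ?_ (fun l => ?_) b
    · simp
    · simp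
    · simp
    · simp only [Fin.cases_succ, ← Finset.sum_neg_distrib]
      refine Finset.sum_congr rfl fun i _ => ?_
      simp only [eps3]; ring

variable {c : FieldIdx → Coord → ℝ}

theorem ofComponents_smooth (hc : ∀ i, ContDiffOn ℝ ∞ (c i) U) : (ofComponents c).SmoothOn U := by
  refine ⟨fun a μ => ?_, fun a b μ => ?_⟩
  · refine Fin.cases ?_ (fun i => ?_) a <;> refine Fin.cases ?_ (fun A => ?_) μ
    · exact hc _
    · exact contDiffOn_const
    · change ContDiffOn ℝ ∞ (fun x => ∑ A, c (.inr (.inr (.inl (i, A)))) x * c (.inr (.inl A)) x) U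
      exact ContDiffOn.sum fun A _ => (hc _).mul (hc _)
    · exact hc _
  · refine Fin.cases ?_ (fun i => ?_) a <;> refine Fin.cases ?_ (fun j => ?_) b
    · exact contDiffOn_const
    · exact hc _
    · exact (hc _).neg
    · change ContDiffOn ℝ ∞
        (fun x => ∑ m, eps3 m i j * c (.inr (.inr (.inr (.inl (m, μ))))) x) U
      exact ContDiffOn.sum fun A _ => contDiffOn_const.mul (hc _)

theorem ofComponents_adapted (h : ∀ x ∈ U, c (.inl ()) x ≠ 0 ∧
    (Matrix.of fun i A : Fin 3 => c (.inr (.inr (.inl (i, A)))) x).det ≠ 0) :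
    AdaptedOn (ofComponents c).e U := fun x hx => by
  refine ⟨fun A => rfl, ?_⟩
  rw [IsAdapted.det_eq (E := Matrix.of fun a μ => (ofComponents c).e a μ x) fun A => rfl]
  exact mul_ne_zero (h x hx).1 (h x hx).2

theorem ofComponents_component (h : ∀ x ∈ U, c (.inl ()) x ≠ 0 ∧
    (Matrix.of fun i A : Fin 3 => c (.inr (.inr (.inl (i, A)))) x).det ≠ 0) (i : FieldIdx)
    {x : Coord} (hx : x ∈ U) : (ofComponents c).component i x = c i x := by
  rcases i with _ | A | p | ⟨i, μ⟩ | p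
  · rfl
  · have h1 := Matrix.nonsing_inv_mul _ (h x hx).2.isUnit
    have h2 := congrFun (congrArg (fun M => Matrix.mulVec M fun A => c (.inr (.inl A)) x) h1) A
    rw [← Matrix.mulVec_mulVec, Matrix.one_mulVec] at h2
    exact h2
  · rfl
  · fin_cases i <;>
      simp [component, A, barberoImmirzi, ofComponents, Fin.sum_univ_three, eps3_values,
        eps3_self₁₂, eps3_self₁₃, eps3_self₂₃] <;> ring
  · rfl

/-- In an adapted frame the coframe is determined by lapse, shift and triad. -/
theorem e_zero_eq {Φ : Fields} (ha : AdaptedOn Φ.e U) {x : Coord} (hx : x ∈ U) (i : Fin 3) :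
    Φ.e i.succ 0 x = ∑ A, Φ.triad i A x * Φ.shift A x := by
  have h1 : IsAdapted (Matrix.of fun a μ => Φ.e a μ x) := ⟨(ha x hx).1, ((ha x hx).2).isUnit⟩
  exact (h1.triad_shift i).symm

/-- The connection is determined by the ABI variables. -/
theorem conn_eq_of_A_k {Φ Ψ : Fields} {x : Coord} {μ : Fin 4} (hA : ∀ i, Ψ.A i μ x = Φ.A i μ x)
    (hk : ∀ i, Ψ.k i μ x = Φ.k i μ x) (a b : Fin 4) : Ψ.conn a b μ x = Φ.conn a b μ x := by
  have a0 := hA 0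
  have a1 := hA 1
  have a2 := hA 2
  rw [A_zero, A_zero] at a0
  rw [A_one, A_one] at a1
  rw [A_two, A_two] at a2
  have k0 : Ψ.conn 0 1 μ x = Φ.conn 0 1 μ x := hk 0
  have k1 : Ψ.conn 0 2 μ x = Φ.conn 0 2 μ x := hk 1
  have k2 : Ψ.conn 0 3 μ x = Φ.conn 0 3 μ x := hk 2
  have p := fun a b => Φ.skew a b μ x
  have q := fun a b => Ψ.skew a b μ x
  fin_cases a <;> fin_cases b <;> simp only [Fin.zero_eta, Fin.mk_one, Fin.reduceFinMk] <;>
    linarith [p 0 0, p 1 1, p 2 2, p 3 3, q 0 0, q 1 1, q 2 2, q 3 3, p 0 1, p 0 2, p 0 3, p 1 2,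
      p 1 3, p 2 3, q 0 1, q 0 2, q 0 3, q 1 2, q 1 3, q 2 3]

theorem eq_of_component_eq {Φ Ψ : Fields} (hΦ : AdaptedOn Φ.e U) (hΨ : AdaptedOn Ψ.e U)
    {x : Coord} (hx : x ∈ U) (h : ∀ i, Ψ.component i x = Φ.component i x) :
    (∀ a μ, Ψ.e a μ x = Φ.e a μ x) ∧ ∀ a b μ, Ψ.conn a b μ x = Φ.conn a b μ x := by
  have ht : ∀ i A, Ψ.triad i A x = Φ.triad i A x := fun i A => h (.inr (.inr (.inl (i, A))))
  have hsh : ∀ A, Ψ.shift A x = Φ.shift A x := fun A => h (.inr (.inl A))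
  refine ⟨fun a μ => ?_, fun a b μ => conn_eq_of_A_k
    (fun i => h (.inr (.inr (.inr (.inl (i, μ))))))
    (fun i => h (.inr (.inr (.inr (.inr (i, μ)))))) a b⟩
  refine Fin.cases ?_ (fun i => ?_) a <;> refine Fin.cases ?_ (fun A => ?_) μ
  · exact h (.inl ())
  · rw [(hΦ x hx).1, (hΨ x hx).1]
  · rw [e_zero_eq hΦ hx, e_zero_eq hΨ hx]
    simp only [ht, hsh]
  · exact ht i A

end Fields

/-! ### Boosts -/

section
variable (w : Fin 3 → ℝ) (i j : Fin 3)

theorem boost_zero_zero : boost w 0 0 = Real.sqrt (1 + ∑ i, w i ^ 2) := rfl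

theorem boost_zero_succ : boost w 0 i.succ = w i := rfl

theorem boost_succ_zero : boost w i.succ 0 = w i := rfl

theorem boost_succ_succ : boost w i.succ j.succ
    = (if i = j then 1 else 0) + w i * w j / (1 + Real.sqrt (1 + ∑ i, w i ^ 2)) := rfl

end

/-- Boosts with opposite parameters are inverse to each other. -/
theorem boost_mul_neg (w : Fin 3 → ℝ) : boost w * boost (-w) = 1 := by
  have hs0 : 0 ≤ ∑ i, w i ^ 2 := Finset.sum_nonneg fun i _ => sq_nonneg _
  have hc0 : 0 ≤ Real.sqrt (1 + ∑ i, w i ^ 2) := Real.sqrt_nonneg _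
  have hcc : Real.sqrt (1 + ∑ i, w i ^ 2) ^ 2 = 1 + ∑ i, w i * w i := by
    rw [Real.sq_sqrt (by positivity)]; simp only [sq]
  have hd : (1 + Real.sqrt (1 + ∑ i, w i ^ 2))⁻¹ * (1 + Real.sqrt (1 + ∑ i, w i ^ 2)) = 1 :=
    inv_mul_cancel₀ (by positivity)
  ext a b
  refine Fin.cases ?_ (fun i => ?_) a <;> refine Fin.cases ?_ (fun j => ?_) b <;>
    simp only [Matrix.mul_apply, sum_univ_succ4, boost_zero_zero, boost_zero_succ, boost_succ_zero,
      boost_succ_succ, Pi.neg_apply, neg_sq, div_eq_mul_inv] <;>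
    generalize Real.sqrt (1 + ∑ i, w i ^ 2) = c at * <;>
    generalize (1 + c)⁻¹ = d at * <;>
    generalize hs : ∑ i, w i * w i = s at *
  · rw [Matrix.one_apply_eq]
    simp only [mul_neg, Finset.sum_neg_distrib, hs]
    linear_combination hcc
  · have h1 : ∑ k, w k * ((if k = j then 1 else 0) + -w k * -w j * d) = w j + s * (w j * d) := by
      simp only [mul_add, Finset.sum_add_distrib, ← hs, Finset.sum_mul]
      congr 1
      · simp
      · exact Finset.sum_congr rfl fun k _ => by ring
    rw [h1, Matrix.one_apply_ne (Fin.succ_ne_zero j).symm]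
    linear_combination (w j * (c - 1)) * hd - w j * d * hcc
  · have h1 : ∑ k, ((if i = k then 1 else 0) + w i * w k * d) * -w k = -(w i + s * (w i * d)) := by
      simp only [add_mul, Finset.sum_add_distrib, ← hs, Finset.sum_mul, neg_add]
      congr 1
      · simp
      · rw [← Finset.sum_neg_distrib]
        exact Finset.sum_congr rfl fun k _ => by ring
    rw [h1, Matrix.one_apply_ne (Fin.succ_ne_zero i)]
    linear_combination -(w i * (c - 1)) * hd + w i * d * hcc
  · have h1 : ∑ k, ((if i = k then 1 else 0) + w i * w k * d)
        * ((if k = j then 1 else 0) + -w k * -w j * d)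
        = (if i = j then 1 else 0) + 2 * (w i * w j * d) + s * (w i * w j * d * d) := by
      have h2 : ∀ k, ((if i = k then 1 else 0) + w i * w k * d)
          * ((if k = j then 1 else 0) + -w k * -w j * d)
          = (if i = k then (if k = j then 1 else 0) + w k * w j * d else 0)
            + (if k = j then w i * w k * d else 0) + w k * w k * (w i * w j * d * d) := fun k => by
        split_ifs <;> ring
      simp only [h2, Finset.sum_add_distrib, ← hs, Finset.sum_mul]
      simp
      ring
    rw [h1, Matrix.one_apply]
    simp only [Fin.succ_inj]
    linear_combination (w i * w j + w i * w j * d * (c - 1)) * hd - w i * w j * d * d * hcc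

theorem boost_det_ne (w : Fin 3 → ℝ) : (boost w).det ≠ 0 := fun h => by
  have := congrArg Matrix.det (boost_mul_neg w)
  rw [Matrix.det_mul, h, zero_mul, Matrix.det_one] at this
  exact zero_ne_one this

/-- The leaf metric is `TᵀT - n nᵀ`, with `T` and `n` the tangential parts of `e^i` and `e^0`. -/
theorem sum_sq_pos {g : Matrix (Fin 3) (Fin 3) ℝ} (hg : g.PosDef) {n : Fin 3 → ℝ}
    {T : Matrix (Fin 3) (Fin 3) ℝ} (hgT : ∀ A B, g A B = ∑ i, T i A * T i B - n A * n B)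
    {v : Fin 3 → ℝ} (hv : v ≠ 0) :
    0 < ∑ i, (T.mulVec v) i ^ 2 - (∑ A, n A * v A) ^ 2 := by
  have h1 := hg.dotProduct_mulVec_pos hv
  have h2 : star v ⬝ᵥ g.mulVec v = ∑ i, (T.mulVec v) i ^ 2 - (∑ A, n A * v A) ^ 2 := by
    simp only [dotProduct, Matrix.mulVec, Pi.star_apply, star_trivial, hgT, Fin.sum_univ_three]
    ring
  rwa [h2] at h1

section
variable {g : Matrix (Fin 3) (Fin 3) ℝ} (hg : g.PosDef) {n : Fin 3 → ℝ}
    {T : Matrix (Fin 3) (Fin 3) ℝ} (hgT : ∀ A B, g A B = ∑ i, T i A * T i B - n A * n B)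
include hg hgT

/-- On a spacelike leaf the spatial part of the coframe is nondegenerate. -/
theorem det_ne_zero_of_spacelike : T.det ≠ 0 := by
  intro h
  obtain ⟨v, hv, hTv⟩ := Matrix.exists_mulVec_eq_zero_iff.2 h
  have h1 := sum_sq_pos hg hgT hv
  rw [hTv] at h1
  simp at h1
  nlinarith [sq_nonneg (∑ A, n A * v A)]

/-- On a spacelike leaf the velocity `u` of the coframe, `e^0 = u_i e^i`, is subluminal. -/
theorem sum_sq_lt_one : ∑ i, (∑ A, n A * T⁻¹ A i) ^ 2 < 1 := by
  have hT := det_ne_zero_of_spacelike hg hgT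
  set u : Fin 3 → ℝ := fun i => ∑ A, n A * T⁻¹ A i with hu
  change ∑ i, u i ^ 2 < 1
  by_cases hu0 : u = 0
  · simp [hu0]
  have h2 : T.mulVec (T⁻¹.mulVec u) = u := by
    rw [Matrix.mulVec_mulVec, Matrix.mul_nonsing_inv _ hT.isUnit, Matrix.one_mulVec]
  have h3 : T⁻¹.mulVec u ≠ 0 := fun h => hu0 (by rw [← h2, h, Matrix.mulVec_zero])
  have h1 := sum_sq_pos hg hgT h3
  have h4 : ∑ A, n A * (T⁻¹.mulVec u) A = ∑ i, u i ^ 2 := by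
    simp only [Matrix.mulVec, dotProduct, Finset.mul_sum]
    rw [Finset.sum_comm]
    refine Finset.sum_congr rfl fun i _ => ?_
    rw [sq]
    nth_rewrite 2 [hu]
    simp only [Finset.sum_mul]
    exact Finset.sum_congr rfl fun A _ => by ring
  rw [h2, h4] at h1
  have h5 : 0 ≤ ∑ i, u i ^ 2 := Finset.sum_nonneg fun i _ => sq_nonneg _
  nlinarith

end

/-- The equation `√(1 + |w|²) u + w = 0` for the boost parameter that removes the velocity `u`. -/
theorem sqrt_mul_eq_neg_iff {u w : Fin 3 → ℝ} (hu : ∑ i, u i ^ 2 < 1) :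
    (∀ i, Real.sqrt (1 + ∑ j, w j ^ 2) * u i + w i = 0) ↔
      ∀ i, w i = -u i / Real.sqrt (1 - ∑ j, u j ^ 2) := by
  have hd : 0 < Real.sqrt (1 - ∑ j, u j ^ 2) := Real.sqrt_pos.2 (by linarith)
  have hdd := Real.sq_sqrt (show 0 ≤ 1 - ∑ j, u j ^ 2 by linarith)
  constructor
  · intro h i
    have hw : ∀ i, w i = -(Real.sqrt (1 + ∑ j, w j ^ 2) * u i) := fun i => by linarith [h i]
    have hs : 0 ≤ ∑ j, w j ^ 2 := Finset.sum_nonneg fun i _ => sq_nonneg _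
    have hc := Real.sq_sqrt (show 0 ≤ 1 + ∑ j, w j ^ 2 by linarith)
    have hc0 := Real.sqrt_nonneg (1 + ∑ j, w j ^ 2)
    have h1 : ∑ j, w j ^ 2 = Real.sqrt (1 + ∑ j, w j ^ 2) ^ 2 * ∑ j, u j ^ 2 := by
      rw [Finset.mul_sum]
      exact Finset.sum_congr rfl fun j _ => by rw [hw j]; ring_nf
    have h2 : Real.sqrt (1 + ∑ j, w j ^ 2) * Real.sqrt (1 - ∑ j, u j ^ 2) = 1 := by
      rw [← pow_eq_one_iff_of_nonneg (mul_nonneg hc0 hd.le) two_ne_zero, mul_pow, hdd]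
      linarith
    rw [eq_div_iff hd.ne', hw i]
    linear_combination -u i * h2
  · intro h i
    have h1 : 1 + ∑ j, w j ^ 2 = (Real.sqrt (1 - ∑ j, u j ^ 2))⁻¹ ^ 2 := by
      have h2 : ∑ j, w j ^ 2 = (∑ j, u j ^ 2) * (Real.sqrt (1 - ∑ j, u j ^ 2))⁻¹ ^ 2 := by
        rw [Finset.sum_mul]
        exact Finset.sum_congr rfl fun j _ => by rw [h j]; ring
      have h3 : (Real.sqrt (1 - ∑ j, u j ^ 2))⁻¹ ^ 2 * Real.sqrt (1 - ∑ j, u j ^ 2) ^ 2 = 1 := by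
        rw [← mul_pow, inv_mul_cancel₀ hd.ne', one_pow]
      rw [hdd] at h3
      rw [h2]; linarith
    rw [h1, Real.sqrt_sq (inv_nonneg.2 hd.le), h i]
    ring

/-- Write `e^0 = u_i e^i` on the leaves. The coframe boosted by `v` is adapted iff
`v = -u / √(1 - |u|²)`. -/
theorem boostCoframe_adapted_iff {U : Set Coord} {e : Fin 4 → Form1}
    (h : ∀ x ∈ U, (Matrix.of fun a μ => e a μ x).det ≠ 0 ∧ (Matrix.of fun A B : Fin 3 =>
      ∑ a, ∑ b, eta a b * e a A.succ x * e b B.succ x).PosDef) (v : Fin 3 → Coord → ℝ) :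
    Fields.AdaptedOn (boostCoframe v e) U ↔ ∀ x ∈ U, ∀ i, v i x =
      -(∑ A : Fin 3, e 0 A.succ x * (Matrix.of fun j C : Fin 3 => e j.succ C.succ x)⁻¹ A i)
        / Real.sqrt (1 - ∑ j, (∑ A : Fin 3, e 0 A.succ x
          * (Matrix.of fun j C : Fin 3 => e j.succ C.succ x)⁻¹ A j) ^ 2) := by
  refine forall_congr' fun x => forall_congr' fun hx => ?_
  obtain ⟨hdet, hg⟩ := h x hx
  set T : Matrix (Fin 3) (Fin 3) ℝ := Matrix.of fun j C : Fin 3 => e j.succ C.succ x with hT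
  have hgT : ∀ A B : Fin 3, (Matrix.of fun A B : Fin 3 =>
      ∑ a, ∑ b, eta a b * e a A.succ x * e b B.succ x) A B
      = ∑ i, T i A * T i B - e 0 A.succ x * e 0 B.succ x := fun A B => by
    simp [hT, sum_univ_succ4, eta, Fin.succ_ne_zero, (Fin.succ_ne_zero _).symm]
    ring
  have hTd := det_ne_zero_of_spacelike (n := fun A => e 0 A.succ x) hg hgT
  have hu := sum_sq_lt_one (n := fun A => e 0 A.succ x) hg hgT
  set u : Fin 3 → ℝ := fun i => ∑ A : Fin 3, e 0 A.succ x * T⁻¹ A i with hu_def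
  have hue : ∀ A : Fin 3, ∑ i, u i * T i A = e 0 A.succ x := fun A => by
    have h1 := congrArg (fun M => Matrix.vecMul (fun A : Fin 3 => e 0 A.succ x) M)
      (Matrix.nonsing_inv_mul T hTd.isUnit)
    rw [← Matrix.vecMul_vecMul, Matrix.vecMul_one] at h1
    exact congrFun h1 A
  have h1 : (Matrix.of fun a μ => boostCoframe v e a μ x)
      = boost (fun i => v i x) * Matrix.of fun a μ => e a μ x := by
    ext a μ
    simp [boostCoframe, Matrix.mul_apply]
  rw [h1, Matrix.det_mul, and_iff_left (mul_ne_zero (boost_det_ne _) hdet)]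
  refine Iff.trans ?_ (sqrt_mul_eq_neg_iff (w := fun i => v i x) hu)
  have h2 : ∀ A : Fin 3, boostCoframe v e 0 A.succ x
      = Matrix.vecMul (fun i => Real.sqrt (1 + ∑ j, v j x ^ 2) * u i + v i x) T A := fun A => by
    simp only [boostCoframe, sum_univ_succ4, boost_zero_zero, boost_zero_succ, ← hue, Matrix.vecMul,
      dotProduct, add_mul, Finset.sum_add_distrib, Finset.mul_sum, mul_assoc]
    rfl
  simp only [h2]
  constructor
  · intro h3 i
    exact congrFun (Matrix.eq_zero_of_vecMul_eq_zero hTd (funext h3)) i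
  · intro h3 A
    have : (fun i => Real.sqrt (1 + ∑ j, v j x ^ 2) * u i + v i x) = 0 := funext h3
    rw [this, Matrix.zero_vecMul, Pi.zero_apply]

/-- Exactly one field of boosts adapts a given coframe with spacelike leaves, and it is smooth. -/
theorem exists_unique_boost {U : Set Coord} {e : Fin 4 → Form1}
    (hs : ∀ a μ, ContDiffOn ℝ ∞ (e a μ) U)
    (h : ∀ x ∈ U, (Matrix.of fun a μ => e a μ x).det ≠ 0 ∧ (Matrix.of fun A B : Fin 3 =>
      ∑ a, ∑ b, eta a b * e a A.succ x * e b B.succ x).PosDef) :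
    ∃ w : Fin 3 → Coord → ℝ, (∀ i, ContDiffOn ℝ ∞ (w i) U) ∧
      Fields.AdaptedOn (boostCoframe w e) U ∧
      ∀ v : Fin 3 → Coord → ℝ, Fields.AdaptedOn (boostCoframe v e) U →
        ∀ i, ∀ x ∈ U, v i x = w i x := by
  have hgT : ∀ x, ∀ A B : Fin 3, (Matrix.of fun A B : Fin 3 =>
      ∑ a, ∑ b, eta a b * e a A.succ x * e b B.succ x) A B
      = ∑ i, (Matrix.of fun j C : Fin 3 => e j.succ C.succ x) i A
        * (Matrix.of fun j C : Fin 3 => e j.succ C.succ x) i B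
        - e 0 A.succ x * e 0 B.succ x := fun x A B => by
    simp [sum_univ_succ4, eta, Fin.succ_ne_zero, (Fin.succ_ne_zero _).symm]
    ring
  set u : Fin 3 → Coord → ℝ := fun i x => ∑ A : Fin 3, e 0 A.succ x
    * (Matrix.of fun j C : Fin 3 => e j.succ C.succ x)⁻¹ A i with hu
  have hus : ∀ i, ContDiffOn ℝ ∞ (u i) U := by
    set E : Matrix (Fin 3) (Fin 3) (smoothAlg U) :=
      Matrix.of fun j C => toAlg (e j.succ C.succ) (hs _ _) with hE
    have hdet : IsUnit E.det := smoothAlg_isUnit _ fun x => by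
      rw [(ev x).map_det E]
      exact det_ne_zero_of_spacelike (n := fun A => e 0 A.succ x) (h x x.2).2 (hgT x)
    have hrep := rep_matrixInv (F := fun x => Matrix.of fun j C : Fin 3 => e j.succ C.succ x)
      (fun j C => rep_toAlg (e j.succ C.succ) (hs _ _)) (Matrix.mul_nonsing_inv E hdet)
    exact fun i => ContDiffOn.sum fun A _ => (hs _ _).mul (hrep A i).contDiffOn
  have hu1 : ∀ x ∈ U, ∑ j, u j x ^ 2 < 1 := fun x hx =>
    sum_sq_lt_one (n := fun A => e 0 A.succ x) (h x hx).2 (hgT x)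
  refine ⟨fun i x => -u i x / Real.sqrt (1 - ∑ j, u j x ^ 2), fun i => ?_,
    (boostCoframe_adapted_iff h _).2 fun x _ i => rfl,
    fun v hv i x hx => (boostCoframe_adapted_iff h v).1 hv x hx i⟩
  have hpos : ∀ x ∈ U, 0 < 1 - ∑ j, u j x ^ 2 := fun x hx => by linarith [hu1 x hx]
  exact (hus i).neg.div ((contDiffOn_const.sub (ContDiffOn.sum fun j _ => (hus j).pow 2)).sqrt
    fun x hx => (hpos x hx).ne') fun x hx => (Real.sqrt_pos.2 (hpos x hx)).ne'

end HolstADM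

end

theorem mainTheorem1 (γ lam : ℝ) (hγ : γ ≠ 0) (U : Set HolstADM.Coord) (hU : IsOpen U) :
    -- equivalence of the field equations, their projections, the 37 equations, ADM, Einstein
    (∀ Φ : HolstADM.Fields, Φ.SmoothOn U → HolstADM.Fields.AdaptedOn Φ.e U →
      List.TFAE
        [ Φ.HolstEquations γ lam U,
          Φ.ABIEquations γ lam U,
          Φ.ProjectedEquations γ lam U,
          Φ.SystemHolds lam U,
          Φ.DeviationsVanish U ∧
            HolstADM.ADMEquations lam U Φ.lapse Φ.shift Φ.leafMetric Φ.chi,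
          Φ.IsLeviCivita U ∧ Φ.EinsteinEquations lam U ] ∧
      List.TFAE
        [ ∀ i μ ν ρ, ∀ x ∈ U, Φ.field1 γ i μ ν ρ x = 0 ∧ Φ.field2 γ i μ ν ρ x = 0,
          (∀ i, ∀ x ∈ U, Φ.gauss i x = 0) ∧ (∀ i, ∀ x ∈ U, Φ.algConstraint i x = 0),
          Φ.DeviationsVanish U ]) ∧
    -- number of equations and number of field components
    (Fintype.card HolstADM.DiffIdx = 10 ∧ Fintype.card HolstADM.AlgIdx = 21 ∧
      Fintype.card HolstADM.EvolIdx = 6 ∧ Fintype.card HolstADM.EqIdx = 37 ∧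
      Fintype.card HolstADM.FieldIdx = 37) ∧
    -- the 37 components are free and determine the fields with adapted frame
    (∀ c : HolstADM.FieldIdx → HolstADM.Coord → ℝ,
      (∀ i, ContDiffOn ℝ ∞ (c i) U) →
      (∀ x ∈ U, c (.inl ()) x ≠ 0 ∧
        (Matrix.of fun i A : Fin 3 => c (.inr (.inr (.inl (i, A)))) x).det ≠ 0) →
      ∃ Φ : HolstADM.Fields, Φ.SmoothOn U ∧ HolstADM.Fields.AdaptedOn Φ.e U ∧
        (∀ i, ∀ x ∈ U, Φ.component i x = c i x) ∧
        ∀ Ψ : HolstADM.Fields, HolstADM.Fields.AdaptedOn Ψ.e U →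
          (∀ i, ∀ x ∈ U, Ψ.component i x = c i x) →
          ∀ x ∈ U, (∀ a μ, Ψ.e a μ x = Φ.e a μ x) ∧ (∀ a b μ, Ψ.conn a b μ x = Φ.conn a b μ x)) ∧
    -- exactly three boost parameters are used to adapt a coframe with spacelike leaves
    (∀ e : Fin 4 → HolstADM.Form1,
      (∀ a μ, ContDiffOn ℝ ∞ (e a μ) U) →
      (∀ x ∈ U, (Matrix.of fun a μ => e a μ x).det ≠ 0 ∧
        (Matrix.of fun A B : Fin 3 =>
          ∑ a, ∑ b, HolstADM.eta a b * e a A.succ x * e b B.succ x).PosDef) →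
      ∃ w : Fin 3 → HolstADM.Coord → ℝ, (∀ i, ContDiffOn ℝ ∞ (w i) U) ∧
        HolstADM.Fields.AdaptedOn (HolstADM.boostCoframe w e) U ∧
        ∀ v : Fin 3 → HolstADM.Coord → ℝ,
          HolstADM.Fields.AdaptedOn (HolstADM.boostCoframe v e) U →
          ∀ i, ∀ x ∈ U, v i x = w i x) := by
  refine ⟨fun Φ hs ha => ⟨HolstADM.Fields.fieldEquations_tfae γ lam hγ hU hs ha,
      HolstADM.Fields.torsionEquations_tfae γ hγ hU hs ha⟩, ?_, fun c hc h => ?_,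
    fun e hs h => HolstADM.exists_unique_boost hs h⟩
  · refine ⟨?_, ?_, ?_, ?_, ?_⟩ <;> decide
  · have ha := HolstADM.Fields.ofComponents_adapted h
    exact ⟨HolstADM.Fields.ofComponents c, HolstADM.Fields.ofComponents_smooth hc, ha,
      fun i x hx => HolstADM.Fields.ofComponents_component h i hx, fun Ψ hΨ hΨc x hx =>
        HolstADM.Fields.eq_of_component_eq ha hΨ hx fun i => by
          rw [hΨc i x hx, HolstADM.Fields.ofComponents_component h i hx]⟩
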